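/- A circuit-hyperplane of a matroid $M$ is a subset of its ground set that is both a circuit and a hyperplane of $M$. For a matroid $M$ of rank $r$ on a ground set with $n$ elements, let $w(M)$ be the number of circuit-hyperplanes of $M$ divided by $\binom{n}{r}$ (every circuit-hyperplane has cardinality $r$), and let $d(M)$ be the number of dependent sets of $M$ of cardinality $r$ divided by $\binom{n}{r}$. A property is said to hold for asymptotically almost all matroids on $n$ elements if the fraction of the matroids with ground set $\{1,\dots,n\}$ that have the property tends to $1$ as $n\to\infty$. Theorem. Asymptotically almost all matroids $M$ on $n$ elements satisfy $$w(M)\ \ge\ \frac{1}{5n}.$$ Hence $d(M)=\Omega(1/n)$ for almost all matroids, that is, there is a constant $c>0$ such that asymptotically almost all matroids $M$ on $n$ elements satisfy $d(M)\ge c/n$. -/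

import Mathlib

open Filter Topology

namespace MatroidAsymptotics

/-- The matroids with ground set the standard `n`-element set (here `Fin n`). -/
def matroidsOn (n : ℕ) : Set (Matroid (Fin n)) := {M | M.E = Set.univ}

/-- There are only finitely many matroids on a finite type, so that the cardinalities (`Set.ncard`)
of sets of matroids used below are the true ones. -/
theorem finite_matroid (α : Type*) [Finite α] : Finite (Matroid α) :=
  Finite.of_injective (β := Set α × (Set α → Prop)) (fun M ↦ (M.E, M.IsBase)) fun _ _ h ↦
    Matroid.ext_isBase (congrArg Prod.fst h) fun B _ ↦
      iff_of_eq (congrFun (congrArg Prod.snd h) B)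

/-- Asymptotically almost all matroids have property `P`: the proportion of the matroids with
ground set `Fin n` that satisfy `P` tends to `1` as `n → ∞`. -/
def AlmostAll (P : (n : ℕ) → Matroid (Fin n) → Prop) : Prop :=
  Tendsto (fun n : ℕ ↦ (({M ∈ matroidsOn n | P n M}.ncard : ℕ) : ℝ) / ((matroidsOn n).ncard : ℝ))
    atTop (𝓝 1)

/-- The rank `r(M)` of a matroid of finite rank, as a natural number. -/
noncomputable def rank {α : Type*} (M : Matroid α) : ℕ := M.eRank.toNat

/-- A hyperplane: a flat of rank `r(M) - 1` (none if `r(M) = 0`). -/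
def IsHyperplane {α : Type*} (M : Matroid α) (H : Set α) : Prop :=
  M.IsFlat H ∧ M.eRk H + 1 = M.eRank

/-- `W(M)`, the set of circuit-hyperplanes of `M`. -/
def circuitHyperplanes {α : Type*} (M : Matroid α) : Set (Set α) :=
  {X | M.IsCircuit X ∧ IsHyperplane M X}

/-- The non-bases of `M`: the dependent sets of cardinality `r(M)`. -/
def nonBases {α : Type*} (M : Matroid α) : Set (Set α) :=
  {X | M.Dep X ∧ X.encard = M.eRank}

/-- `w(M)`, the number of circuit-hyperplanes divided by the number `n.choose r` of subsets of the
ground set of cardinality `r`, where `n = |E(M)|` and `r = r(M)`. -/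
noncomputable def w {α : Type*} (M : Matroid α) : ℝ :=
  ((circuitHyperplanes M).ncard : ℝ) / (M.E.ncard.choose (rank M) : ℝ)

/-- `d(M)`, the fraction of the `r`-subsets of the ground set that are dependent, `r = r(M)`. -/
noncomputable def d {α : Type*} (M : Matroid α) : ℝ :=
  ((nonBases M).ncard : ℝ) / (M.E.ncard.choose (rank M) : ℝ)

end MatroidAsymptotics

namespace MatroidAsymptotics

open Finset

/-! Write U = C(n, n/2)/n (`scale`). A matroid of rank r is determined by its nonbases, the r-sets
of smaller rank. Join two r-sets when they differ by one exchange (the Johnson graph). For 0 < r < n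
every stable set of this graph is the set of nonbases of a matroid, so there are at least 2^U
matroids. It suffices to show that, for each rank, the matroids with too few circuit-hyperplanes are
at most a fraction n⁻² of all matroids. Ranks far from n/2 are negligible because C(n, r) is then
much smaller than U.

For r near n/2 a matroid is described in two stages. First, `exists_certificate` finds a family of
O(U log n / n^(1/4)) sets that certifies a part 𝓚 of the nonbases. Every other nonbase has rank r -
1, fewer than B coloops and fewer than B further elements in its closure. All but fewer than θ of
the r-sets comparable to a dependent (r-1)-set or nonspanning (r+1)-set lie in 𝓚. Hence the coloops
and the closure of an uncertified nonbase can be read off from 𝓚 (`coloopsIn_eq`, `spannedIn_eq`).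
Second, `exists_encodes` chooses a largest set S of uncertified nonbases with distinct circuits and
distinct closures. S is stable, and 𝓚 and S determine all nonbases. The sets X - x (x a coloop of X)
and X + y (y spanned by X), for X in S, are the items. They leave large traces in 𝓚, disjoint once
tagged as lower or upper.

The count splits on the size of 𝓚 against U n / (log n)². If 𝓚 is large, containers for packings of
traces show that half of 𝓚 meets boundedly many candidate items per set. Subsets of a stable set in
that half can be grafted onto S at bounded cost (`card_mul_le_card_stableSets_mul`), so the encoded
families are far fewer than the stable sets. If 𝓚 is small, there are few items, and the rest of S
consists of isolated nonbases, which are circuit-hyperplanes. When there are at most U/5 of these,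
containers for stable sets bound the choices by about (9^(1/5) (10/9)^(9/4))^U, exponentially less
than 2^U.

The statement on d follows because circuit-hyperplanes are dependent r-sets. -/

/-- The rank function of a matroid on a finite ground set. -/
structure RankFunction (α : Type*) [DecidableEq α] where
  rk : Finset α → ℕ
  rk_empty : rk ∅ = 0
  mono : ∀ S T, S ⊆ T → rk S ≤ rk T
  rk_insert_le : ∀ x S, rk (insert x S) ≤ rk S + 1
  submod : ∀ S T, rk (S ∪ T) + rk (S ∩ T) ≤ rk S + rk T

/-! ### Single exchanges -/

/-- The set obtained from `X` by exchanging `x` for `y`. -/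
def swap {α : Type*} [DecidableEq α] (X : Finset α) (x y : α) : Finset α := insert y (X.erase x)

section Swap

variable {α : Type*} [DecidableEq α]

theorem card_swap {X : Finset α} {x y : α} (hx : x ∈ X) (hy : y ∉ X) :
    (swap X x y).card = X.card := by
  have h := card_pos.2 ⟨x, hx⟩
  rw [swap, card_insert_of_notMem (fun h ↦ hy (mem_of_mem_erase h)), card_erase_of_mem hx]
  omega

theorem sdiff_swap {X : Finset α} {x y : α} (hx : x ∈ X) (hy : y ∉ X) : X \ swap X x y = {x} := by
  ext a
  simp only [swap, Finset.mem_sdiff, mem_insert, mem_erase, mem_singleton]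
  constructor
  · rintro ⟨h1, h2⟩
    by_contra h
    exact h2 (Or.inr ⟨h, h1⟩)
  · rintro rfl
    refine ⟨hx, ?_⟩
    rintro (h | h)
    · exact hy (h ▸ hx)
    · exact h.1 rfl

theorem swap_sdiff {X : Finset α} {x y : α} (hy : y ∉ X) : swap X x y \ X = {y} := by
  ext a
  simp only [swap, Finset.mem_sdiff, mem_insert, mem_erase, mem_singleton]
  constructor
  · rintro ⟨h1 | h1, h2⟩
    · exact h1
    · exact absurd h1.2 h2
  · rintro rfl
    exact ⟨Or.inl rfl, hy⟩

theorem swap_subset_insert (X : Finset α) (x y : α) : swap X x y ⊆ insert y X :=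
  insert_subset_insert _ (erase_subset _ _)

theorem erase_subset_swap (X : Finset α) (x y : α) : X.erase x ⊆ swap X x y :=
  subset_insert _ _

theorem swap_erase_self {X : Finset α} {x y : α} (hy : y ∉ X) :
    (swap X x y).erase y = X.erase x :=
  erase_insert (fun h ↦ hy (mem_of_mem_erase h))

theorem swap_injOn (X : Finset α) :
    Set.InjOn (fun p : α × α ↦ swap X p.1 p.2) {p | p.1 ∈ X ∧ p.2 ∉ X} := by
  rintro ⟨x, y⟩ ⟨hx, hy⟩ ⟨x', y'⟩ ⟨hx', hy'⟩ h
  simp only at h hx hy hx' hy'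
  have h1 : ({x} : Finset α) = {x'} := by rw [← sdiff_swap hx hy, ← sdiff_swap hx' hy', h]
  have h2 : ({y} : Finset α) = {y'} := by
    rw [← swap_sdiff (x := x) hy, ← swap_sdiff (x := x') hy', h]
  rw [singleton_inj.1 h1, singleton_inj.1 h2]

theorem exists_eq_swap {X Y : Finset α} (hc : X.card = Y.card) (h : (X \ Y).card = 1) :
    ∃ x ∈ X, ∃ y, y ∉ X ∧ Y = swap X x y := by
  have h' : (Y \ X).card = 1 := by rw [← card_sdiff_comm hc, h]
  obtain ⟨x, hx⟩ := card_eq_one.1 h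
  obtain ⟨y, hy⟩ := card_eq_one.1 h'
  have hx' : x ∈ X ∧ x ∉ Y := by rw [← Finset.mem_sdiff, hx]; simp
  have hy' : y ∈ Y ∧ y ∉ X := by rw [← Finset.mem_sdiff, hy]; simp
  refine ⟨x, hx'.1, y, hy'.2, ?_⟩
  ext a
  simp only [swap, mem_insert, mem_erase]
  constructor
  · intro ha
    by_cases haX : a ∈ X
    · exact Or.inr ⟨fun h ↦ hx'.2 (h ▸ ha), haX⟩
    · left
      have : a ∈ Y \ X := Finset.mem_sdiff.2 ⟨ha, haX⟩
      rw [hy] at this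
      simpa using this
  · rintro (rfl | ⟨h1, h2⟩)
    · exact hy'.1
    · by_contra haY
      have : a ∈ X \ Y := Finset.mem_sdiff.2 ⟨h2, haY⟩
      rw [hx] at this
      exact h1 (by simpa using this)

end Swap

/-! ### Coloops, circuits and closures from the rank function -/

namespace RankFunction

variable {α : Type*} [DecidableEq α] (ρ : RankFunction α)

theorem rk_insert_add_le {S T : Finset α} (h : S ⊆ T) (x : α) :
    ρ.rk (insert x T) + ρ.rk S ≤ ρ.rk T + ρ.rk (insert x S) := by
  have h1 := ρ.submod T (insert x S)
  have h2 : T ∪ insert x S = insert x T := by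
    rw [union_insert, union_eq_left.2 h]
  have h3 : ρ.rk S ≤ ρ.rk (T ∩ insert x S) :=
    ρ.mono _ _ (subset_inter h (subset_insert _ _))
  rw [h2] at h1
  omega

theorem rk_insert_eq_of_subset {S T : Finset α} (h : S ⊆ T) {x : α}
    (hx : ρ.rk (insert x S) = ρ.rk S) : ρ.rk (insert x T) = ρ.rk T := by
  have h1 := ρ.rk_insert_add_le h x
  have h2 := ρ.mono _ _ (subset_insert x T)
  omega

theorem rk_union_eq {X T : Finset α} (h : ∀ t ∈ T, ρ.rk (insert t X) = ρ.rk X) :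
    ρ.rk (X ∪ T) = ρ.rk X := by
  induction T using Finset.induction_on with
  | empty => simp
  | insert a T _ ih =>
    rw [union_insert, ρ.rk_insert_eq_of_subset subset_union_left (h a (mem_insert_self _ _)),
      ih (fun t ht ↦ h t (mem_insert_of_mem ht))]

theorem rk_union_le (S T : Finset α) : ρ.rk (S ∪ T) ≤ ρ.rk S + T.card := by
  induction T using Finset.induction_on with
  | empty => simp
  | insert a T ha ih =>
    rw [union_insert, card_insert_of_notMem ha]
    have := ρ.rk_insert_le a (S ∪ T)
    omega

theorem rk_le_add_card_sdiff {S T : Finset α} (h : S ⊆ T) :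
    ρ.rk T ≤ ρ.rk S + (T \ S).card := by
  have := ρ.rk_union_le S (T \ S)
  rwa [union_sdiff_of_subset h] at this

theorem rk_le_card (S : Finset α) : ρ.rk S ≤ S.card := by
  have := ρ.rk_union_le ∅ S
  rwa [empty_union, ρ.rk_empty, zero_add] at this

/-- The elements of `X` whose removal lowers the rank. -/
def coloops (X : Finset α) : Finset α := {x ∈ X | ρ.rk (X.erase x) < ρ.rk X}

theorem coloops_subset (X : Finset α) : ρ.coloops X ⊆ X := filter_subset _ _

theorem rk_erase_of_notMem_coloops {X : Finset α} {x : α} (hx : x ∉ ρ.coloops X) :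
    ρ.rk (X.erase x) = ρ.rk X := by
  by_cases h : x ∈ X
  · refine le_antisymm (ρ.mono _ _ (erase_subset _ _)) ?_
    by_contra h'
    exact hx (mem_filter.2 ⟨h, not_le.1 h'⟩)
  · rw [erase_eq_of_notMem h]

theorem rk_erase_of_mem_coloops {X : Finset α} {x : α} (hx : x ∈ ρ.coloops X) :
    ρ.rk (X.erase x) + 1 = ρ.rk X := by
  obtain ⟨h1, h2⟩ := mem_filter.1 hx
  have := ρ.rk_insert_le x (X.erase x)
  rw [insert_erase h1] at this
  omega

theorem rk_sdiff_add_card_le {X L : Finset α} (h : L ⊆ ρ.coloops X) :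
    ρ.rk (X \ L) + L.card ≤ ρ.rk X := by
  induction L using Finset.induction_on with
  | empty => simp
  | insert a L ha ih =>
    have hL := ih (fun x hx ↦ h (mem_insert_of_mem hx))
    have haX := h (mem_insert_self _ _)
    have h1 := ρ.rk_erase_of_mem_coloops haX
    have haX' := ρ.coloops_subset _ haX
    have h2 : X \ insert a L = (X \ L).erase a := by
      ext b; simp only [Finset.mem_sdiff, mem_insert, mem_erase]; tauto
    have h3 := ρ.rk_insert_add_le (S := (X \ L).erase a) (T := X.erase a)
      (erase_subset_erase _ sdiff_subset) a
    rw [insert_erase haX', insert_erase (Finset.mem_sdiff.2 ⟨haX', ha⟩)] at h3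
    rw [h2, card_insert_of_notMem ha]
    omega

/-- The unique circuit of a set of nullity one. -/
def core (X : Finset α) : Finset α := X \ ρ.coloops X

theorem core_subset (X : Finset α) : ρ.core X ⊆ X := sdiff_subset

theorem rk_core_add_card (X : Finset α) :
    ρ.rk (ρ.core X) + (ρ.coloops X).card ≤ ρ.rk X :=
  ρ.rk_sdiff_add_card_le subset_rfl

theorem mem_core {X : Finset α} {x : α} : x ∈ ρ.core X ↔ x ∈ X ∧ ρ.rk (X.erase x) = ρ.rk X := by
  rw [core, Finset.mem_sdiff]
  refine and_congr_right fun hx ↦ ⟨ρ.rk_erase_of_notMem_coloops, fun h h' ↦ ?_⟩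
  have := ρ.rk_erase_of_mem_coloops h'
  omega

/-- The rank hypothesis says that all elements of `X \ G` are coloops of `X`, and adding coloops
creates no circuit. -/
theorem core_eq_of_subset {X G : Finset α} (h : G ⊆ X)
    (hr : ρ.rk X = ρ.rk G + (X \ G).card) : ρ.core G = ρ.core X := by
  ext x
  rw [mem_core, mem_core]
  have key : x ∈ G → ρ.rk (X.erase x) ≤ ρ.rk (G.erase x) + (X \ G).card := by
    intro hx
    have := ρ.rk_le_add_card_sdiff (erase_subset_erase x h)
    have h2 : X.erase x \ G.erase x = X \ G := by
      ext a
      simp only [Finset.mem_sdiff, mem_erase]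
      constructor
      · rintro ⟨⟨h1, h2⟩, h3⟩; exact ⟨h2, fun h ↦ h3 ⟨h1, h⟩⟩
      · rintro ⟨h1, h2⟩
        exact ⟨⟨fun h ↦ h2 (h ▸ hx), h1⟩, fun h ↦ h2 h.2⟩
    rwa [h2] at this
  constructor
  · rintro ⟨hx, hG⟩
    refine ⟨h hx, ?_⟩
    have := ρ.rk_insert_eq_of_subset (erase_subset_erase x h) (x := x)
      (by rw [insert_erase hx, hG])
    rw [insert_erase (h hx)] at this
    exact this.symm
  · rintro ⟨hx, hX⟩
    have hxG : x ∈ G := by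
      by_contra hxG
      have h1 := ρ.rk_le_add_card_sdiff (subset_erase.2 ⟨h, hxG⟩)
      have h2 : ((X.erase x) \ G).card + 1 = (X \ G).card := by
        rw [erase_sdiff_comm, card_erase_add_one (Finset.mem_sdiff.2 ⟨hx, hxG⟩)]
      omega
    refine ⟨hxG, ?_⟩
    have := key hxG
    have h3 := ρ.mono _ _ (erase_subset x G)
    omega

variable [Fintype α]

/-- The elements outside `X` in the closure of `X`. -/
def spanned (X : Finset α) : Finset α := {y | y ∉ X ∧ ρ.rk (insert y X) = ρ.rk X}

theorem mem_spanned {X : Finset α} {y : α} :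
    y ∈ ρ.spanned X ↔ y ∉ X ∧ ρ.rk (insert y X) = ρ.rk X := by simp [spanned]

theorem rk_insert_of_notMem_spanned {X : Finset α} {y : α} (hy : y ∉ X)
    (h : y ∉ ρ.spanned X) : ρ.rk (insert y X) = ρ.rk X + 1 := by
  have h1 := ρ.rk_insert_le y X
  have h2 := ρ.mono _ _ (subset_insert y X)
  have h3 : ρ.rk (insert y X) ≠ ρ.rk X := fun h' ↦ h (ρ.mem_spanned.2 ⟨hy, h'⟩)
  omega

/-- The closure. -/
def hull (X : Finset α) : Finset α := X ∪ ρ.spanned X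

theorem subset_hull (X : Finset α) : X ⊆ ρ.hull X := subset_union_left

theorem mem_hull {X : Finset α} {y : α} : y ∈ ρ.hull X ↔ ρ.rk (insert y X) = ρ.rk X := by
  rw [hull, mem_union, mem_spanned]
  constructor
  · rintro (h | h)
    · rw [insert_eq_of_mem h]
    · exact h.2
  · intro h
    by_cases hy : y ∈ X
    · exact Or.inl hy
    · exact Or.inr ⟨hy, h⟩

theorem rk_hull (X : Finset α) : ρ.rk (ρ.hull X) = ρ.rk X :=
  ρ.rk_union_eq fun _ ht ↦ (ρ.mem_spanned.1 ht).2

theorem hull_eq_of_subset {X G : Finset α} (h : X ⊆ G) (hr : ρ.rk X = ρ.rk G) :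
    ρ.hull X = ρ.hull G := by
  ext y
  rw [mem_hull, mem_hull]
  refine ⟨ρ.rk_insert_eq_of_subset h, fun hy ↦ le_antisymm ?_ (ρ.mono _ _ (subset_insert _ _))⟩
  have := ρ.mono _ _ (insert_subset_insert y h)
  omega

/-- An exchange can lower the rank only if a coloop leaves and its replacement already lies in the
closure. -/
theorem rk_swap_ge {X : Finset α} {x y : α}
    (hxy : x ∉ ρ.coloops X ∨ y ∉ ρ.hull X) : ρ.rk X ≤ ρ.rk (swap X x y) := by
  rcases hxy with h | h
  · rw [← ρ.rk_erase_of_notMem_coloops h]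
    exact ρ.mono _ _ (erase_subset_swap _ _ _)
  · have hyX : y ∉ X := fun h' ↦ h (ρ.subset_hull _ h')
    have h1 := ρ.rk_insert_of_notMem_spanned hyX (fun h' ↦ h (mem_union_right _ h'))
    have h2 := ρ.rk_insert_le x (swap X x y)
    have h3 : ρ.rk (insert y X) ≤ ρ.rk (insert x (swap X x y)) := by
      refine ρ.mono _ _ fun a ha ↦ ?_
      simp only [swap, mem_insert, mem_erase] at ha ⊢
      tauto
    omega

/-- Dropping a non-coloop keeps the rank, and by submodularity the new element raises the rank of
the smaller set as well. -/
theorem rk_swap_of_notMem {X : Finset α} {x y : α}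
    (hx : x ∉ ρ.coloops X) (hy : y ∉ ρ.hull X) : ρ.rk (swap X x y) = ρ.rk X + 1 := by
  have hyX : y ∉ X := fun h' ↦ hy (ρ.subset_hull _ h')
  have h1 := ρ.rk_insert_of_notMem_spanned hyX (fun h' ↦ hy (mem_union_right _ h'))
  have h2 := ρ.rk_erase_of_notMem_coloops hx
  have h3 := ρ.rk_insert_add_le (erase_subset x X) y
  have h4 := ρ.mono _ _ (swap_subset_insert X x y)
  rw [swap] at *
  omega

end RankFunction

/-! ### The Johnson graph, its cliques, and greedy covering -/

/-- The `r`-element subsets of the ground set. -/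
abbrev layer (α : Type*) [Fintype α] (r : ℕ) : Finset (Finset α) :=
  powersetCard r univ

theorem mem_layer {α : Type*} [Fintype α] {r : ℕ} {X : Finset α} :
    X ∈ layer α r ↔ X.card = r := mem_powersetCard_univ

section Layers

variable {α : Type*} [DecidableEq α] [Fintype α]

/-- The `r`-sets comparable to `G`. -/
def clique (r : ℕ) (G : Finset α) : Finset (Finset α) := {X ∈ layer α r | G ⊆ X ∨ X ⊆ G}

theorem mem_clique {r : ℕ} {G X : Finset α} :
    X ∈ clique r G ↔ X.card = r ∧ (G ⊆ X ∨ X ⊆ G) := by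
  rw [clique, mem_filter, mem_layer]

/-- The `r`-sets certified by a family `𝓕`: those comparable to a member of another cardinality,
and those at distance at most one from a member of cardinality `r`. -/
def certified (r : ℕ) (𝓕 : Finset (Finset α)) : Finset (Finset α) :=
  {X ∈ layer α r | ∃ F ∈ 𝓕, (F.card ≠ r ∧ (F ⊆ X ∨ X ⊆ F)) ∨ (F.card = r ∧ (X \ F).card ≤ 1)}

theorem mem_certified {r : ℕ} {𝓕 : Finset (Finset α)} {X : Finset α} :
    X ∈ certified r 𝓕 ↔ X.card = r ∧
      ∃ F ∈ 𝓕, (F.card ≠ r ∧ (F ⊆ X ∨ X ⊆ F)) ∨ (F.card = r ∧ (X \ F).card ≤ 1) := by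
  rw [certified, mem_filter, mem_layer]

theorem certified_mono {r : ℕ} {𝓕 𝓖 : Finset (Finset α)} (h : 𝓕 ⊆ 𝓖) :
    certified r 𝓕 ⊆ certified r 𝓖 := by
  intro X
  rw [mem_certified, mem_certified]
  rintro ⟨hX, F, hF, h'⟩
  exact ⟨hX, F, h hF, h'⟩

theorem clique_subset_certified {r : ℕ} {𝓕 : Finset (Finset α)} {G : Finset α} (hG : G ∈ 𝓕)
    (hr : G.card ≠ r) : clique r G ⊆ certified r 𝓕 := by
  intro X hX
  rw [mem_clique] at hX
  exact mem_certified.2 ⟨hX.1, G, hG, Or.inl ⟨hr, hX.2⟩⟩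

/-- A stable set of the Johnson graph. -/
def IsStable (S : Finset (Finset α)) : Prop := ∀ X ∈ S, ∀ Y ∈ S, (X \ Y).card ≠ 1

/-- A stable subset of maximum size dominates `T`. This lets nonbases of corank at least two be
certified by a neighbour. -/
theorem exists_maximal_stable {r : ℕ} {T : Finset (Finset α)} (hT : T ⊆ layer α r) :
    ∃ Z ⊆ T, IsStable Z ∧ ∀ X ∈ T, ∃ Y ∈ Z, (X \ Y).card ≤ 1 := by
  classical
  obtain ⟨Z, hZ, hmax⟩ := exists_max_image (T.powerset.filter IsStable) Finset.card
    ⟨∅, mem_filter.2 ⟨empty_mem_powerset _, fun X hX ↦ absurd hX (notMem_empty _)⟩⟩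
  rw [mem_filter, mem_powerset] at hZ
  refine ⟨Z, hZ.1, hZ.2, fun X hX ↦ ?_⟩
  by_contra! hcon
  have hXZ : X ∉ Z := by
    intro h
    have := hcon X h
    simp at this
  have hst : IsStable (insert X Z) := by
    intro U hU W hW
    rcases mem_insert.1 hU with hU | hU
    · rcases mem_insert.1 hW with hW | hW
      · simp [hU, hW]
      · exact hU ▸ (hcon W hW).ne'
    · rcases mem_insert.1 hW with hW | hW
      · rw [card_sdiff_comm ((mem_layer.1 (hT (hZ.1 hU))).trans
          (mem_layer.1 (hT (hW ▸ hX))).symm), hW]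
        exact (hcon U hU).ne'
      · exact hZ.2 U hU W hW
  have := hmax (insert X Z)
    (mem_filter.2 ⟨mem_powerset.2 (insert_subset hX hZ.1), hst⟩)
  rw [card_insert_of_notMem hXZ] at this
  omega

/-- Members of `𝓘` are added as long as each covers at least `θ` new `r`-sets. The newly covered
sets lie in `𝓛`, which bounds how many are added. -/
theorem exists_greedy_cover (r : ℕ) {θ : ℕ} (hθ : 0 < θ) (𝓕 𝓘 𝓛 : Finset (Finset α))
    (hr : ∀ G ∈ 𝓘, G.card ≠ r)
    (h𝓛 : ∀ G ∈ 𝓘, clique r G \ certified r 𝓕 ⊆ 𝓛) :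
    ∃ 𝓖 ⊆ 𝓘, 𝓖.card * θ ≤ 𝓛.card ∧
      ∀ G ∈ 𝓘, (clique r G \ certified r (𝓕 ∪ 𝓖)).card < θ := by
  obtain ⟨𝓖, h𝓖, hmax⟩ := exists_max_image
    (𝓘.powerset.filter fun 𝓖 ↦ 𝓖.card * θ ≤ (certified r (𝓕 ∪ 𝓖) ∩ 𝓛).card) Finset.card
    ⟨∅, mem_filter.2 ⟨empty_mem_powerset _, by simp⟩⟩
  rw [mem_filter, mem_powerset] at h𝓖
  refine ⟨𝓖, h𝓖.1, h𝓖.2.trans (card_le_card inter_subset_right), fun G hG ↦ ?_⟩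
  by_contra! hcon
  have hG𝓖 : G ∉ 𝓖 := by
    intro h
    have h1 := clique_subset_certified (mem_union_right 𝓕 h) (hr G hG)
    rw [sdiff_eq_empty_iff_subset.2 h1, card_empty] at hcon
    omega
  have hsub : (certified r (𝓕 ∪ 𝓖) ∩ 𝓛) ∪ (clique r G \ certified r (𝓕 ∪ 𝓖)) ⊆
      certified r (𝓕 ∪ insert G 𝓖) ∩ 𝓛 := by
    refine union_subset (inter_subset_inter (certified_mono ?_) subset_rfl) ?_
    · exact union_subset_union_right (subset_insert _ _)
    · refine subset_inter (sdiff_subset.trans (clique_subset_certified ?_ (hr G hG))) ?_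
      · exact mem_union_right _ (mem_insert_self _ _)
      · exact (sdiff_subset_sdiff subset_rfl (certified_mono subset_union_left)).trans (h𝓛 G hG)
  have hdisj : Disjoint (certified r (𝓕 ∪ 𝓖) ∩ 𝓛) (clique r G \ certified r (𝓕 ∪ 𝓖)) :=
    disjoint_left.2 fun X h1 h2 ↦ (Finset.mem_sdiff.1 h2).2 (mem_of_mem_inter_left h1)
  have h1 := card_le_card hsub
  rw [card_union_of_disjoint hdisj] at h1
  have h2 := hmax (insert G 𝓖) (mem_filter.2
    ⟨mem_powerset.2 (insert_subset hG h𝓖.1), by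
      rw [card_insert_of_notMem hG𝓖, add_mul, one_mul]
      have := h𝓖.2
      omega⟩)
  rw [card_insert_of_notMem hG𝓖] at h2
  omega

end Layers

/-! ### Small certificates for most nonbases -/

namespace RankFunction

variable {α : Type*} [DecidableEq α] [Fintype α] (ρ : RankFunction α)

/-- The `r`-sets that are not bases, where `r` is the rank. -/
def nonbases (r : ℕ) : Finset (Finset α) := {X ∈ layer α r | ρ.rk X < r}

theorem mem_nonbases {r : ℕ} {X : Finset α} : X ∈ ρ.nonbases r ↔ X.card = r ∧ ρ.rk X < r := by
  rw [nonbases, mem_filter, mem_layer]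

/-- The nonbases that contain no dependent `(r - B)`-set, and are contained in no nonspanning
`(r + B)`-set. -/
def narrow (r B : ℕ) : Finset (Finset α) :=
  {X ∈ ρ.nonbases r | (∀ D, D ⊆ X → D.card = r - B → ρ.rk D = r - B) ∧
    ∀ F, X ⊆ F → F.card = r + B → r ≤ ρ.rk F}

variable {ρ} {r B : ℕ} {X : Finset α}

/-- Deleting `B` coloops would leave a dependent `(r - B)`-subset. -/
theorem card_coloops_lt (hX : X ∈ ρ.narrow r B) : (ρ.coloops X).card < B := by
  obtain ⟨hX, h, -⟩ := mem_filter.1 hX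
  obtain ⟨hc, hr⟩ := ρ.mem_nonbases.1 hX
  by_contra! hB
  obtain ⟨L, hL, rfl⟩ := exists_subset_card_eq hB
  have h1 := ρ.rk_sdiff_add_card_le hL
  have h2 := h (X \ L) sdiff_subset
    (by rw [card_sdiff_of_subset (hL.trans (ρ.coloops_subset X)), hc])
  omega

/-- Adding `B` spanned elements would give a nonspanning `(r + B)`-superset. -/
theorem card_spanned_lt (hX : X ∈ ρ.narrow r B) : (ρ.spanned X).card < B := by
  obtain ⟨hX, -, h⟩ := mem_filter.1 hX
  obtain ⟨hc, hr⟩ := ρ.mem_nonbases.1 hX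
  by_contra! hB
  obtain ⟨T, hT, rfl⟩ := exists_subset_card_eq hB
  have h1 : ρ.rk (X ∪ T) = ρ.rk X := ρ.rk_union_eq fun t ht ↦ (ρ.mem_spanned.1 (hT ht)).2
  have h2 := h (X ∪ T) subset_union_left (by
    rw [card_union_of_disjoint (disjoint_left.2 fun a ha hT' ↦ (ρ.mem_spanned.1 (hT hT')).1 ha),
      hc])
  omega

variable (ρ) in
/-- The `X'` obtained from `X` by an exchange that increases the rank. -/
def RaisedBy (X X' : Finset α) : Prop :=
  ∃ x ∈ ρ.core X, ∃ z, z ∉ ρ.hull X ∧ X' = swap X x z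

theorem card_raisedBy_ge [∀ X X', Decidable (ρ.RaisedBy X X')] (hc : X.card = r)
    (hA : (ρ.coloops X).card < B) (hB : (ρ.spanned X).card < B) :
    (r - B) * (Fintype.card α - r - B) ≤ ((layer α r).filter (ρ.RaisedBy X)).card := by
  have h1 : r - B ≤ (ρ.core X).card := by
    rw [core, card_sdiff_of_subset (ρ.coloops_subset X)]; omega
  have h2 : Fintype.card α - r - B ≤ (ρ.hull X)ᶜ.card := by
    rw [card_compl]
    have : (ρ.hull X).card ≤ X.card + (ρ.spanned X).card := card_union_le _ _
    omega
  calc (r - B) * (Fintype.card α - r - B) ≤ (ρ.core X).card * (ρ.hull X)ᶜ.card :=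
        Nat.mul_le_mul h1 h2
    _ = (ρ.core X ×ˢ (ρ.hull X)ᶜ).card := (card_product _ _).symm
    _ ≤ _ := by
      refine card_le_card_of_injOn (fun p ↦ swap X p.1 p.2) ?_ ?_
      · rintro ⟨x, z⟩ h
        rw [mem_coe, mem_product, mem_compl] at h
        refine mem_coe.2 (mem_filter.2 ⟨mem_layer.2 ?_, x, h.1, z, h.2, rfl⟩)
        rw [card_swap (ρ.core_subset X h.1) (fun h' ↦ h.2 (ρ.subset_hull X h')), hc]
      · refine (swap_injOn X).mono ?_
        rintro ⟨x, z⟩ h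
        rw [mem_coe, mem_product, mem_compl] at h
        exact ⟨ρ.core_subset X h.1, fun h' ↦ h.2 (ρ.subset_hull X h')⟩

/-- Double counting of rank-raising exchanges: a narrow nonbase admits almost `r * (n - r)` of them,
while at most `r * B` narrow nonbases lead to a given `r`-set. -/
theorem card_narrow_mul_le : (ρ.narrow r B).card * ((r - B) * (Fintype.card α - r - B)) ≤
    (Fintype.card α).choose r * (r * B) := by
  classical
  rw [← card_univ, ← card_powersetCard]
  refine card_mul_le_card_mul ρ.RaisedBy (fun X hX ↦ ?_) (fun X' hX' ↦ ?_)
  · exact card_raisedBy_ge (ρ.mem_nonbases.1 (mem_filter.1 hX).1).1 (card_coloops_lt hX)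
      (card_spanned_lt hX)
  · have hsub : (ρ.narrow r B).bipartiteBelow ρ.RaisedBy X' ⊆
        X'.biUnion fun z ↦ {X ∈ ρ.narrow r B | ∃ x ∈ ρ.core X, z ∉ ρ.hull X ∧ X' = swap X x z} := by
      intro X hX
      rw [mem_bipartiteBelow] at hX
      obtain ⟨hX, x, hx, z, hz, rfl⟩ := hX
      rw [mem_biUnion]
      exact ⟨z, mem_insert_self _ _, mem_filter.2 ⟨hX, x, hx, hz, rfl⟩⟩
    refine (card_le_card hsub).trans ?_
    refine (card_biUnion_le_card_mul _ _ B fun z _ ↦ ?_).trans_eq (by rw [mem_layer.1 hX'])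
    rcases eq_empty_or_nonempty
      {X ∈ ρ.narrow r B | ∃ x ∈ ρ.core X, z ∉ ρ.hull X ∧ X' = swap X x z} with he | ⟨X₀, h₀⟩
    · rw [he]; simp
    obtain ⟨hn, x₀, hx₀, hz₀, rfl⟩ := mem_filter.1 h₀
    have hzX₀ : z ∉ X₀ := fun h ↦ hz₀ (ρ.subset_hull _ h)
    -- With the entering element `z` fixed, all sources contain `X₀.erase x₀`. The element each of
    -- them adds lies in the closure of that set, which is the closure of `X₀`; this leaves `x₀` and
    -- fewer than `B` others.
    have hsub2 : {X ∈ ρ.narrow r B | ∃ x ∈ ρ.core X, z ∉ ρ.hull X ∧ swap X₀ x₀ z = swap X x z} ⊆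
        (insert x₀ (ρ.spanned X₀)).image fun x ↦ insert x (X₀.erase x₀) := by
      intro X hX
      obtain ⟨-, x, hx, hz, heq⟩ := mem_filter.1 hX
      have hzX : z ∉ X := fun h ↦ hz (ρ.subset_hull _ h)
      have he : X₀.erase x₀ = X.erase x := by
        rw [← swap_erase_self (x := x₀) hzX₀, heq, swap_erase_self hzX]
      have hx' := ρ.mem_core.1 hx
      have hx₀' := ρ.mem_core.1 hx₀
      refine mem_image.2 ⟨x, ?_, by rw [he, insert_erase hx'.1]⟩
      rw [mem_insert]
      by_cases h : x = x₀
      · exact Or.inl h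
      right
      rw [mem_spanned]
      refine ⟨fun hxX ↦ ?_, ρ.rk_insert_eq_of_subset (erase_subset x₀ X₀) ?_⟩
      · have : x ∈ X.erase x := he ▸ mem_erase.2 ⟨h, hxX⟩
        simp at this
      · rw [he, insert_erase hx'.1, hx'.2]
    refine (card_le_card hsub2).trans (card_image_le.trans ((card_insert_le _ _).trans ?_))
    exact card_spanned_lt hn

/-- The same double count, but stability and corank at least two reduce the multiplicity from `r *
B` to `B`: a source is determined by the element that entered, which is a coloop of the target. -/
theorem card_stable_mul_le {Z : Finset (Finset α)} (hZ : Z ⊆ ρ.narrow r B) (hst : IsStable Z)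
    (hrk : ∀ X ∈ Z, ρ.rk X + 2 ≤ r) :
    Z.card * ((r - B) * (Fintype.card α - r - B)) ≤ (Fintype.card α).choose r * B := by
  classical
  rw [← card_univ, ← card_powersetCard]
  refine card_mul_le_card_mul ρ.RaisedBy (fun X hX ↦ ?_) (fun X' hX' ↦ ?_)
  · exact card_raisedBy_ge (ρ.mem_nonbases.1 (mem_filter.1 (hZ hX)).1).1 (card_coloops_lt (hZ hX))
      (card_spanned_lt (hZ hX))
  · have hX'c : X'.card = r := mem_layer.1 hX'
    have hz : ∀ X ∈ Z.bipartiteBelow ρ.RaisedBy X', ∃ z ∈ ρ.coloops X', X'.erase z ⊆ X ∧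
        (ρ.coloops X').card ≤ B := by
      intro X hX
      rw [mem_bipartiteBelow] at hX
      obtain ⟨hX, x, hx, z, hz, rfl⟩ := hX
      have hzX : z ∉ X := fun h ↦ hz (ρ.subset_hull _ h)
      have hx' := ρ.mem_core.1 hx
      have hxc : x ∉ ρ.coloops X := (Finset.mem_sdiff.1 hx).2
      have hrs := ρ.rk_swap_of_notMem hxc hz
      have hzc : z ∈ ρ.coloops (swap X x z) := by
        refine mem_filter.2 ⟨mem_insert_self _ _, ?_⟩
        rw [swap_erase_self hzX, hrs, hx'.2]
        omega
      refine ⟨z, hzc, ?_, ?_⟩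
      · rw [swap_erase_self hzX]; exact erase_subset _ _
      -- The target has rank at most `r - 1`. With more than `B` coloops, removing `B` of them, `z`
      -- included, would leave a dependent `(r - B)`-subset of the narrow set `X`.
      · by_contra! hB
        have hB0 : 0 < B := (Nat.zero_le _).trans_lt (card_coloops_lt (hZ hX))
        obtain ⟨L, hzL, hL, hLB⟩ := exists_subsuperset_card_eq
          (singleton_subset_iff.2 hzc) (n := B) (by rw [card_singleton]; omega) hB.le
        have h1 := ρ.rk_sdiff_add_card_le hL
        obtain ⟨hX1, h2, -⟩ := mem_filter.1 (hZ hX)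
        have h3 := h2 (swap X x z \ L) (by
          intro a ha
          rw [Finset.mem_sdiff, swap, mem_insert] at ha
          rcases ha.1 with rfl | h
          · exact absurd (hzL (mem_singleton_self _)) ha.2
          · exact mem_of_mem_erase h)
          (by rw [card_sdiff_of_subset (hL.trans (ρ.coloops_subset _)), hX'c, hLB])
        have h4 := hrk X hX
        omega
    rcases eq_empty_or_nonempty (Z.bipartiteBelow ρ.RaisedBy X') with he | ⟨X₀, h₀⟩
    · rw [he]; simp
    obtain ⟨z₀, _, _, hB⟩ := hz X₀ h₀
    have : Nonempty α := ⟨z₀⟩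
    refine le_trans ?_ hB
    choose! f hf1 hf2 _ using hz
    -- Two sources with the same entering element share `r - 1` elements, so they coincide by
    -- stability.
    refine card_le_card_of_injOn f (fun X hX ↦ hf1 X hX) fun X hX Y hY hXY ↦ ?_
    have hXZ := ((mem_bipartiteBelow _).1 hX).1
    have hYZ := ((mem_bipartiteBelow _).1 hY).1
    have hXc := (ρ.mem_nonbases.1 (mem_filter.1 (hZ hXZ)).1).1
    have hYc := (ρ.mem_nonbases.1 (mem_filter.1 (hZ hYZ)).1).1
    have h1 := hf2 X hX
    have h2 := hf2 Y hY
    rw [← hXY] at h2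
    have h3 := card_le_card (subset_inter h1 h2)
    rw [card_erase_of_mem (ρ.coloops_subset _ (hf1 X hX)), hX'c] at h3
    have h4 := card_sdiff_add_card_inter X Y
    have h5 := hst X hXZ Y hYZ
    have h6 : (X \ Y).card = 0 := by omega
    rw [card_eq_zero, sdiff_eq_empty_iff_subset] at h6
    exact eq_of_subset_of_card_le h6 (by omega)

variable (ρ) in
/-- The dependent `(r - 1)`-sets and the nonspanning `(r + 1)`-sets: all `r`-sets comparable to
them are nonbases. -/
def full (r : ℕ) : Finset (Finset α) :=
  {G | (G.card + 1 = r ∧ ρ.rk G < G.card) ∨ (G.card = r + 1 ∧ ρ.rk G < r)}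

theorem mem_full {G : Finset α} : G ∈ ρ.full r ↔
    (G.card + 1 = r ∧ ρ.rk G < G.card) ∨ (G.card = r + 1 ∧ ρ.rk G < r) := by
  simp [full]

theorem mem_nonbases_of_subset {F : Finset α} (hX : X.card = r) (hF : ρ.rk F < F.card)
    (h : F ⊆ X) : X ∈ ρ.nonbases r := by
  have h1 := ρ.rk_le_add_card_sdiff h
  rw [card_sdiff_of_subset h] at h1
  have h2 := card_le_card h
  exact ρ.mem_nonbases.2 ⟨hX, by omega⟩

theorem mem_nonbases_of_superset {F : Finset α} (hX : X.card = r) (hF : ρ.rk F < r)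
    (h : X ⊆ F) : X ∈ ρ.nonbases r :=
  ρ.mem_nonbases.2 ⟨hX, (ρ.mono _ _ h).trans_lt hF⟩

theorem clique_subset_nonbases {G : Finset α} (hG : G ∈ ρ.full r) :
    clique r G ⊆ ρ.nonbases r := by
  intro X hX
  obtain ⟨hc, h⟩ := mem_clique.1 hX
  rcases mem_full.1 hG with ⟨h1, h2⟩ | ⟨h1, h2⟩ <;> rcases h with h | h
  · exact mem_nonbases_of_subset hc h2 h
  · have := card_le_card h; omega
  · have := card_le_card h; omega
  · exact mem_nonbases_of_superset hc h2 h

-- The family has three parts. Dependent `(r - B)`-sets and nonspanning `(r + B)`-sets certify every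
-- nonbase that is not narrow. A maximal stable set of narrow nonbases of corank at least two
-- certifies its neighbours, since one exchange raises the rank by at most one. A greedy choice from
-- `full` covers the cliques; it stays small because the sets left to cover are narrow. The numbers
-- `z` and `g` count the last two parts.
variable (ρ) in
theorem exists_certificate (hB : 2 ≤ B) (hBr : B ≤ r) {θ : ℕ} (hθ : 0 < θ) :
    ∃ (𝓕 : Finset (Finset α)) (z g : ℕ),
      𝓕.card ≤ (Fintype.card α).choose (r - B) + (Fintype.card α).choose (r + B) + z + g ∧
      z * ((r - B) * (Fintype.card α - r - B)) ≤ (Fintype.card α).choose r * B ∧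
      g * θ * ((r - B) * (Fintype.card α - r - B)) ≤ (Fintype.card α).choose r * (r * B) ∧
      certified r 𝓕 ⊆ ρ.nonbases r ∧
      (∀ X ∈ ρ.nonbases r, X ∉ certified r 𝓕 →
        ρ.rk X + 1 = r ∧ (ρ.coloops X).card < B ∧ (ρ.spanned X).card < B) ∧
      ∀ G ∈ ρ.full r, (clique r G \ certified r 𝓕).card < θ := by
  obtain ⟨Z, hZT, hZst, hZmax⟩ := exists_maximal_stable (r := r)
    (T := {X ∈ ρ.narrow r B | ρ.rk X + 2 ≤ r})
    (fun X hX ↦ mem_layer.2 (ρ.mem_nonbases.1 (mem_filter.1 (mem_filter.1 hX).1).1).1)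
  have hZn : Z ⊆ ρ.narrow r B := hZT.trans (filter_subset _ _)
  have hZr : ∀ X ∈ Z, ρ.rk X + 2 ≤ r := fun X hX ↦ (mem_filter.1 (hZT hX)).2
  let 𝓐 : Finset (Finset α) := {D ∈ layer α (r - B) | ρ.rk D < r - B}
  let 𝓒 : Finset (Finset α) := {F ∈ layer α (r + B) | ρ.rk F < r}
  let 𝓕₀ := 𝓐 ∪ 𝓒 ∪ Z
  have hnar : ∀ X ∈ ρ.nonbases r, X ∉ certified r 𝓕₀ → X ∈ ρ.narrow r B := by
    intro X hX hX'
    have hc := (ρ.mem_nonbases.1 hX).1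
    rw [mem_certified] at hX'
    push Not at hX'
    refine mem_filter.2 ⟨hX, fun D hD hDc ↦ ?_, fun F hF hFc ↦ ?_⟩
    · by_contra hne
      have h1 := ρ.rk_le_card D
      have h2 := (hX' hc D (mem_union_left _ (mem_union_left _ (mem_filter.2
        ⟨mem_layer.2 hDc, by omega⟩)))).1 (by omega)
      exact h2.1 hD
    · by_contra hne
      have h2 := (hX' hc F (mem_union_left _ (mem_union_right _ (mem_filter.2
        ⟨mem_layer.2 hFc, by omega⟩)))).1 (by omega)
      exact h2.2 hF
  obtain ⟨𝓖, h𝓖, hcard, hcov⟩ := exists_greedy_cover r hθ 𝓕₀ (ρ.full r) (ρ.narrow r B)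
    (fun G hG ↦ by rcases mem_full.1 hG with h | h <;> omega)
    (fun G hG X hX ↦ by
      rw [Finset.mem_sdiff] at hX
      exact hnar X (clique_subset_nonbases hG hX.1) hX.2)
  refine ⟨𝓕₀ ∪ 𝓖, Z.card, 𝓖.card, ?_, card_stable_mul_le hZn hZst hZr, ?_, ?_, ?_, hcov⟩
  · have h1 : 𝓐.card ≤ (Fintype.card α).choose (r - B) := by
      rw [← card_univ, ← card_powersetCard]
      exact card_le_card (filter_subset _ _)
    have h2 : 𝓒.card ≤ (Fintype.card α).choose (r + B) := by
      rw [← card_univ, ← card_powersetCard]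
      exact card_le_card (filter_subset _ _)
    have h3 := card_union_le 𝓐 𝓒
    have h4 : 𝓕₀.card ≤ (𝓐 ∪ 𝓒).card + Z.card := card_union_le (𝓐 ∪ 𝓒) Z
    have h5 := card_union_le 𝓕₀ 𝓖
    omega
  · exact (Nat.mul_le_mul_right _ hcard).trans card_narrow_mul_le
  · intro X hX
    obtain ⟨hc, F, hF, hFX⟩ := mem_certified.1 hX
    rcases mem_union.1 hF with hF | hF
    · rcases mem_union.1 hF with hF | hF
      · rcases mem_union.1 hF with hF | hF
        · obtain ⟨h1, h2⟩ := mem_filter.1 hF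
          rw [mem_layer] at h1
          rcases hFX with ⟨-, h | h⟩ | ⟨h, -⟩
          · exact mem_nonbases_of_subset hc (by omega) h
          · have := card_le_card h; omega
          · omega
        · obtain ⟨h1, h2⟩ := mem_filter.1 hF
          rw [mem_layer] at h1
          rcases hFX with ⟨-, h | h⟩ | ⟨h, -⟩
          · have := card_le_card h; omega
          · exact mem_nonbases_of_superset hc h2 h
          · omega
      · have h1 := hZr F hF
        have h2 := (ρ.mem_nonbases.1 (mem_filter.1 (hZn hF)).1).1
        rcases hFX with ⟨h, -⟩ | ⟨-, h⟩
        · exact absurd h2 h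
        · have h3 := ρ.rk_union_le F (X \ F)
          have h4 := ρ.mono X (F ∪ X \ F) (by rw [union_sdiff_self_eq_union]; exact subset_union_right)
          exact ρ.mem_nonbases.2 ⟨hc, by omega⟩
    · have hFf := h𝓖 hF
      have hne : F.card ≠ r := by rcases mem_full.1 hFf with h | h <;> omega
      rcases hFX with ⟨-, h⟩ | ⟨h, -⟩
      · exact clique_subset_nonbases hFf (mem_clique.2 ⟨hc, h⟩)
      · exact absurd h hne
  · intro X hX hX'
    have hn := hnar X hX fun h ↦ hX' (certified_mono subset_union_left h)
    refine ⟨?_, card_coloops_lt hn, card_spanned_lt hn⟩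
    have hc := ρ.mem_nonbases.1 hX
    by_contra hne
    obtain ⟨Y, hY, hXY⟩ := hZmax X (mem_filter.2 ⟨hn, by omega⟩)
    refine hX' (mem_certified.2 ⟨hc.1, Y, mem_union_left _ (mem_union_right _ hY), Or.inr ⟨?_, hXY⟩⟩)
    exact (ρ.mem_nonbases.1 (mem_filter.1 (hZn hY)).1).1

end RankFunction

/-! ### Reading matroid structure off the certified nonbases -/

section Decoding

variable {α : Type*} [DecidableEq α] [Fintype α]

/-- The coloops of `X`, as read off from the neighbours of `X` in `𝓚`. -/
def coloopsIn (𝓚 : Finset (Finset α)) (B : ℕ) (X : Finset α) : Finset α :=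
  {x ∈ X | B ≤ (univ.filter fun z ↦ z ∉ X ∧ swap X x z ∈ 𝓚).card}

/-- The elements spanned by `X`, as read off from the neighbours of `X` in `𝓚`. -/
def spannedIn (𝓚 : Finset (Finset α)) (B : ℕ) (X : Finset α) : Finset α :=
  {y | y ∉ X ∧ B ≤ (X.filter fun x ↦ swap X x y ∈ 𝓚).card}

theorem mem_coloopsIn {𝓚 : Finset (Finset α)} {B : ℕ} {X : Finset α} {x : α} :
    x ∈ coloopsIn 𝓚 B X ↔ x ∈ X ∧ B ≤ (univ.filter fun z ↦ z ∉ X ∧ swap X x z ∈ 𝓚).card :=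
  mem_filter

theorem mem_spannedIn {𝓚 : Finset (Finset α)} {B : ℕ} {X : Finset α} {y : α} :
    y ∈ spannedIn 𝓚 B X ↔ y ∉ X ∧ B ≤ (X.filter fun x ↦ swap X x y ∈ 𝓚).card := by
  simp [spannedIn]

/-- The `r`-sets that are forced to be nonbases by `𝓚` and the nonbases in `P`. -/
def forced (r B : ℕ) (𝓚 P : Finset (Finset α)) : Finset (Finset α) :=
  𝓚 ∪ {X ∈ layer α r | ∃ Y ∈ P, Y \ coloopsIn 𝓚 B Y ⊆ X ∨ X ⊆ Y ∪ spannedIn 𝓚 B Y}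

/-- The dependent `(r - 1)`-sets and nonspanning `(r + 1)`-sets comparable to members of `S`. -/
def items (B : ℕ) (𝓚 S : Finset (Finset α)) : Finset (Finset α) :=
  S.biUnion fun X ↦ (coloopsIn 𝓚 B X).image X.erase ∪ (spannedIn 𝓚 B X).image (insert · X)

theorem mem_items {B : ℕ} {𝓚 S : Finset (Finset α)} {G : Finset α} :
    G ∈ items B 𝓚 S ↔ ∃ X ∈ S, (∃ x ∈ coloopsIn 𝓚 B X, X.erase x = G) ∨
      ∃ y ∈ spannedIn 𝓚 B X, insert y X = G := by
  simp [items]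

/-- The members of `𝓚` comparable to `G` that are recognised as having corank one. -/
def trace (r B : ℕ) (𝓚 : Finset (Finset α)) (G : Finset α) : Finset (Finset α) :=
  {X ∈ 𝓚 | X ∈ clique r G ∧ ∃ Y ∈ clique r G, Y ∉ 𝓚 ∧
    (Disjoint (Y \ X) (coloopsIn 𝓚 B Y) ∨ Disjoint (X \ Y) (spannedIn 𝓚 B Y))}

theorem mem_trace {r B : ℕ} {𝓚 : Finset (Finset α)} {G X : Finset α} :
    X ∈ trace r B 𝓚 G ↔ X ∈ 𝓚 ∧ X ∈ clique r G ∧ ∃ Y ∈ clique r G, Y ∉ 𝓚 ∧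
      (Disjoint (Y \ X) (coloopsIn 𝓚 B Y) ∨ Disjoint (X \ Y) (spannedIn 𝓚 B Y)) := mem_filter

/-- The trace of `G`, tagged with the type of `G`. -/
def taggedTrace (r B : ℕ) (𝓚 : Finset (Finset α)) (G : Finset α) : Finset (Finset α × Bool) :=
  trace r B 𝓚 G ×ˢ {decide (r < G.card)}

theorem card_taggedTrace (r B : ℕ) (𝓚 : Finset (Finset α)) (G : Finset α) :
    (taggedTrace r B 𝓚 G).card = (trace r B 𝓚 G).card := by
  simp [taggedTrace]

theorem mem_taggedTrace {r B : ℕ} {𝓚 : Finset (Finset α)} {G : Finset α} {p : Finset α × Bool} :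
    p ∈ taggedTrace r B 𝓚 G ↔ p.1 ∈ trace r B 𝓚 G ∧ p.2 = decide (r < G.card) := by
  rw [taggedTrace, mem_product, mem_singleton]

theorem mem_clique_erase {r : ℕ} {X : Finset α} (hX : X.card = r) (x : α) :
    X ∈ clique r (X.erase x) := mem_clique.2 ⟨hX, Or.inl (erase_subset _ _)⟩

theorem mem_clique_insert {r : ℕ} {X : Finset α} (hX : X.card = r) (y : α) :
    X ∈ clique r (insert y X) := mem_clique.2 ⟨hX, Or.inr (subset_insert _ _)⟩

theorem swap_mem_clique_erase {r : ℕ} {X : Finset α} (hX : X.card = r) {x y : α} (hx : x ∈ X)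
    (hy : y ∉ X) : swap X x y ∈ clique r (X.erase x) :=
  mem_clique.2 ⟨(card_swap hx hy).trans hX, Or.inl (erase_subset_swap _ _ _)⟩

theorem swap_mem_clique_insert {r : ℕ} {X : Finset α} (hX : X.card = r) {x y : α} (hx : x ∈ X)
    (hy : y ∉ X) : swap X x y ∈ clique r (insert y X) :=
  mem_clique.2 ⟨(card_swap hx hy).trans hX, Or.inr (swap_subset_insert _ _ _)⟩

theorem subset_of_mem_clique_of_lt {r : ℕ} {G X : Finset α} (h : X ∈ clique r G)
    (hG : G.card + 1 = r) : G ⊆ X := by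
  obtain ⟨hX, h | h⟩ := mem_clique.1 h
  · exact h
  · have := card_le_card h; omega

theorem subset_of_mem_clique_of_gt {r : ℕ} {G X : Finset α} (h : X ∈ clique r G)
    (hG : G.card = r + 1) : X ⊆ G := by
  obtain ⟨hX, h | h⟩ := mem_clique.1 h
  · have := card_le_card h; omega
  · exact h

theorem card_sdiff_le_one {r : ℕ} {G X Y : Finset α} (hG : G.card + 1 = r ∨ G.card = r + 1)
    (hX : X ∈ clique r G) (hY : Y ∈ clique r G) : (X \ Y).card ≤ 1 := by
  have hXc := (mem_clique.1 hX).1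
  have hYc := (mem_clique.1 hY).1
  rcases hG with hG | hG
  · have h1 := subset_of_mem_clique_of_lt hX hG
    have h2 := subset_of_mem_clique_of_lt hY hG
    have h3 := card_le_card (sdiff_subset_sdiff (subset_refl X) h2)
    rw [card_sdiff_of_subset h1] at h3
    omega
  · have h1 := subset_of_mem_clique_of_gt hX hG
    have h2 := subset_of_mem_clique_of_gt hY hG
    have h3 := card_le_card (sdiff_subset_sdiff h1 (subset_refl Y))
    rw [card_sdiff_of_subset h2] at h3
    omega

theorem exists_swap_of_mem_clique {r : ℕ} {G X Y : Finset α}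
    (hG : G.card + 1 = r ∨ G.card = r + 1) (hX : X ∈ clique r G) (hY : Y ∈ clique r G)
    (hne : X ≠ Y) : ∃ x ∈ X, ∃ y, y ∉ X ∧ Y = swap X x y := by
  have hXc := (mem_clique.1 hX).1
  have hYc := (mem_clique.1 hY).1
  refine exists_eq_swap (hXc.trans hYc.symm) (le_antisymm (card_sdiff_le_one hG hX hY) ?_)
  rw [Nat.one_le_iff_ne_zero, Ne, card_eq_zero, sdiff_eq_empty_iff_subset]
  exact fun h ↦ hne (eq_of_subset_of_card_le h (by omega))

theorem card_of_mem_items {r B : ℕ} {𝓚 S : Finset (Finset α)} (hS : S ⊆ layer α r) {G : Finset α}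
    (hG : G ∈ items B 𝓚 S) : G.card + 1 = r ∨ G.card = r + 1 := by
  obtain ⟨X, hX, ⟨x, hx, rfl⟩ | ⟨y, hy, rfl⟩⟩ := mem_items.1 hG
  · left
    rw [card_erase_add_one (mem_coloopsIn.1 hx).1, mem_layer.1 (hS hX)]
  · right
    rw [card_insert_of_notMem (mem_spannedIn.1 hy).1, mem_layer.1 (hS hX)]

/-- A common `r`-set is the union of two distinct `(r - 1)`-sets or the intersection of two distinct
`(r + 1)`-sets, hence unique. The tag excludes mixed pairs, whose cliques can share two sets. -/
theorem card_taggedTrace_inter_le {r B : ℕ} {𝓚 : Finset (Finset α)} {G G' : Finset α}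
    (hG : G.card + 1 = r ∨ G.card = r + 1) (hG' : G'.card + 1 = r ∨ G'.card = r + 1)
    (hne : G ≠ G') : (taggedTrace r B 𝓚 G ∩ taggedTrace r B 𝓚 G').card ≤ 1 := by
  rw [card_le_one]
  rintro ⟨X, b⟩ hX ⟨Y, b'⟩ hY
  rw [mem_inter, mem_taggedTrace, mem_taggedTrace] at hX hY
  obtain ⟨⟨hX1, hb1⟩, hX2, hb2⟩ := hX
  obtain ⟨⟨hY1, hb3⟩, hY2, hb4⟩ := hY
  simp only at *
  have hX1 := (mem_trace.1 hX1).2.1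
  have hX2 := (mem_trace.1 hX2).2.1
  have hY1 := (mem_trace.1 hY1).2.1
  have hY2 := (mem_trace.1 hY2).2.1
  have hXc := (mem_clique.1 hX1).1
  have hYc := (mem_clique.1 hY1).1
  have hbb : (r < G.card) ↔ (r < G'.card) := by
    rw [← decide_eq_decide, ← hb1, ← hb2]
  rw [Prod.mk.injEq]
  refine ⟨?_, hb1.trans hb3.symm⟩
  rcases hG with hG | hG
  · have hG' : G'.card + 1 = r := by omega
    have h1 := union_subset (subset_of_mem_clique_of_lt hX1 hG) (subset_of_mem_clique_of_lt hX2 hG')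
    have h2 := union_subset (subset_of_mem_clique_of_lt hY1 hG) (subset_of_mem_clique_of_lt hY2 hG')
    have h3 : r ≤ (G ∪ G').card := by
      by_contra h
      have e1 := eq_of_subset_of_card_le (subset_union_left (s₁ := G) (s₂ := G')) (by omega)
      have e2 := eq_of_subset_of_card_le (subset_union_right (s₁ := G) (s₂ := G')) (by omega)
      exact hne (e1.trans e2.symm)
    rw [← eq_of_subset_of_card_le h1 (by omega), ← eq_of_subset_of_card_le h2 (by omega)]
  · have hG' : G'.card = r + 1 := by omega
    have h1 := subset_inter (subset_of_mem_clique_of_gt hX1 hG) (subset_of_mem_clique_of_gt hX2 hG')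
    have h2 := subset_inter (subset_of_mem_clique_of_gt hY1 hG) (subset_of_mem_clique_of_gt hY2 hG')
    have h3 : (G ∩ G').card ≤ r := by
      by_contra h
      have e1 := eq_of_subset_of_card_le (inter_subset_left (s₁ := G) (s₂ := G')) (by omega)
      have e2 := eq_of_subset_of_card_le (inter_subset_right (s₁ := G) (s₂ := G')) (by omega)
      exact hne (e1.symm.trans e2)
    rw [eq_of_subset_of_card_le h1 (by omega), eq_of_subset_of_card_le h2 (by omega)]

/-- A stable set `S` that encodes the family `K` of nonbases, relative to a known part `𝓚`. -/
structure Encodes (r B m : ℕ) (𝓚 K S : Finset (Finset α)) : Prop where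
  subset_layer : S ⊆ layer α r
  disjoint : Disjoint S 𝓚
  stable : IsStable S
  le_card_trace : ∀ G ∈ items B 𝓚 S, m ≤ (trace r B 𝓚 G).card
  disjoint_taggedTrace : ∀ G ∈ items B 𝓚 S, ∀ G' ∈ items B 𝓚 S, G ≠ G' →
    Disjoint (taggedTrace r B 𝓚 G) (taggedTrace r B 𝓚 G')
  forced_eq : ∀ P, S ⊆ P → P ⊆ S ∪ (items B 𝓚 S).biUnion (clique r) \ 𝓚 → forced r B 𝓚 P = K
  exists_item : ∀ X ∈ S, ∀ Y ∈ 𝓚, (X \ Y).card = 1 →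
    ∃ G ∈ items B 𝓚 S, X ∈ clique r G ∧ Y ∈ clique r G
  isolated : ∀ X ∈ S, coloopsIn 𝓚 B X = ∅ → spannedIn 𝓚 B X = ∅ → X ∈ K ∧
    ∀ Y ∈ K, (X \ Y).card ≠ 1

end Decoding

/-! ### Encoding the remaining nonbases by a stable set -/

namespace RankFunction

variable {α : Type*} [DecidableEq α] [Fintype α] {ρ : RankFunction α} {r B θ m : ℕ}
  {X : Finset α} {𝓚 : Finset (Finset α)}

theorem erase_mem_full (hX : X.card = r) (hr : ρ.rk X + 1 = r) {x : α} (hx : x ∈ ρ.coloops X) :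
    X.erase x ∈ ρ.full r := by
  have h1 := card_erase_add_one (ρ.coloops_subset X hx)
  have h2 := ρ.rk_erase_of_mem_coloops hx
  exact mem_full.2 (Or.inl (by omega))

theorem insert_mem_full (hX : X.card = r) (hr : ρ.rk X + 1 = r) {y : α} (hy : y ∈ ρ.spanned X) :
    insert y X ∈ ρ.full r := by
  obtain ⟨h1, h2⟩ := ρ.mem_spanned.1 hy
  exact mem_full.2 (Or.inr ⟨by rw [card_insert_of_notMem h1, hX], by omega⟩)

theorem card_of_mem_full {G : Finset α} (hG : G ∈ ρ.full r) :
    G.card + 1 = r ∨ G.card = r + 1 := by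
  rcases mem_full.1 hG with h | h <;> omega

theorem notMem_hull {y : α} (h1 : y ∉ X) (h2 : y ∉ ρ.spanned X) : y ∉ ρ.hull X := by
  rw [hull, mem_union]; tauto

/-- Two nonbases of corank one with a common dependent `(r - 1)`-subset have the same circuit. -/
theorem core_eq_core {G X' : Finset α} (hG : G.card + 1 = r) (hGf : G ∈ ρ.full r)
    (hX : X.card = r) (hX' : X'.card = r) (hXr : ρ.rk X + 1 = r) (hXr' : ρ.rk X' + 1 = r)
    (hGX : G ⊆ X) (hGX' : G ⊆ X') : ρ.core X = ρ.core X' := by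
  have key : ∀ Y : Finset α, Y.card = r → ρ.rk Y + 1 = r → G ⊆ Y → ρ.core G = ρ.core Y := by
    intro Y hY hYr hGY
    refine ρ.core_eq_of_subset hGY ?_
    have h1 := ρ.rk_le_add_card_sdiff hGY
    have h2 := card_sdiff_of_subset hGY
    rcases mem_full.1 hGf with h | h <;> omega
  rw [← key X hX hXr hGX, ← key X' hX' hXr' hGX']

/-- Two nonbases of corank one with a common nonspanning `(r + 1)`-superset have the same closure. -/
theorem hull_eq_hull {G X' : Finset α} (hG : G.card = r + 1) (hGf : G ∈ ρ.full r)
    (hXr : ρ.rk X + 1 = r) (hXr' : ρ.rk X' + 1 = r)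
    (hGX : X ⊆ G) (hGX' : X' ⊆ G) : ρ.hull X = ρ.hull X' := by
  have key : ∀ Y : Finset α, ρ.rk Y + 1 = r → Y ⊆ G → ρ.hull Y = ρ.hull G := by
    intro Y hYr hGY
    refine ρ.hull_eq_of_subset hGY ?_
    have h1 := ρ.mono _ _ hGY
    rcases mem_full.1 hGf with h | h <;> omega
  rw [key X hXr hGX, key X' hXr' hGX']

variable (ρ r B θ 𝓚) in
/-- The properties of the certified sets used for decoding. -/
structure Certificate : Prop where
  subset : 𝓚 ⊆ ρ.nonbases r
  rk_eq : ∀ X ∈ ρ.nonbases r, X ∉ 𝓚 → ρ.rk X + 1 = r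
  coloops_lt : ∀ X ∈ ρ.nonbases r, X ∉ 𝓚 → (ρ.coloops X).card < B
  spanned_lt : ∀ X ∈ ρ.nonbases r, X ∉ 𝓚 → (ρ.spanned X).card < B
  covered : ∀ G ∈ ρ.full r, (clique r G \ 𝓚).card < θ
  le_rank : m + B + θ ≤ r
  le_corank : m + B + θ + r ≤ Fintype.card α

namespace Certificate

variable (h : ρ.Certificate r B θ (m := m) 𝓚)
include h

theorem card_filter_erase_lt (hX : X ∈ ρ.nonbases r) (hX' : X ∉ 𝓚) {x : α}
    (hx : x ∈ ρ.coloops X) : (univ.filter fun z ↦ z ∉ X ∧ swap X x z ∉ 𝓚).card < θ := by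
  have hXc := (ρ.mem_nonbases.1 hX).1
  have hxX := ρ.coloops_subset X hx
  refine lt_of_le_of_lt ?_ (h.covered _ (erase_mem_full hXc (h.rk_eq X hX hX') hx))
  refine card_le_card_of_injOn (fun z ↦ swap X x z) ?_ ?_
  · intro z hz
    obtain ⟨-, hz1, hz2⟩ := mem_filter.1 hz
    exact mem_coe.2 (Finset.mem_sdiff.2 ⟨swap_mem_clique_erase hXc hxX hz1, hz2⟩)
  · intro z hz z' hz' heq
    have h1 := (mem_filter.1 hz).2.1
    have h2 := (mem_filter.1 hz').2.1
    exact congrArg Prod.snd (swap_injOn X (x₁ := (x, z)) (x₂ := (x, z')) ⟨hxX, h1⟩ ⟨hxX, h2⟩ heq)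

theorem card_filter_insert_lt (hX : X ∈ ρ.nonbases r) (hX' : X ∉ 𝓚) {y : α}
    (hy : y ∈ ρ.spanned X) : (X.filter fun x ↦ swap X x y ∉ 𝓚).card < θ := by
  have hXc := (ρ.mem_nonbases.1 hX).1
  have hyX := (ρ.mem_spanned.1 hy).1
  refine lt_of_le_of_lt ?_ (h.covered _ (insert_mem_full hXc (h.rk_eq X hX hX') hy))
  refine card_le_card_of_injOn (fun x ↦ swap X x y) ?_ ?_
  · intro x hx
    obtain ⟨hx1, hx2⟩ := mem_filter.1 hx
    exact mem_coe.2 (Finset.mem_sdiff.2 ⟨swap_mem_clique_insert hXc hx1 hyX, hx2⟩)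
  · intro x hx x' hx' heq
    have h1 := (mem_filter.1 hx).1
    have h2 := (mem_filter.1 hx').1
    exact congrArg Prod.fst (swap_injOn X (x₁ := (x, y)) (x₂ := (x', y)) ⟨h1, hyX⟩ ⟨h2, hyX⟩ heq)

/-- If `x` is not a coloop, exchanging it for `z` gives a nonbase only when `z` is spanned, which
happens fewer than `B` times. If `x` is a coloop, every exchange gives a nonbase and all but fewer
than `θ` lie in `𝓚`, which leaves at least `B`. -/
theorem coloopsIn_eq (hX : X ∈ ρ.nonbases r) (hX' : X ∉ 𝓚) : coloopsIn 𝓚 B X = ρ.coloops X := by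
  have hXc := (ρ.mem_nonbases.1 hX).1
  ext x
  rw [mem_coloopsIn]
  constructor
  · rintro ⟨hx, hB⟩
    by_contra hxc
    have hsub : (univ.filter fun z ↦ z ∉ X ∧ swap X x z ∈ 𝓚) ⊆ ρ.spanned X := by
      intro z hz
      obtain ⟨-, hz1, hz2⟩ := mem_filter.1 hz
      by_contra hzs
      have h1 := ρ.rk_swap_of_notMem hxc (notMem_hull hz1 hzs)
      have h2 := (ρ.mem_nonbases.1 (h.subset hz2)).2
      have h3 := h.rk_eq X hX hX'
      omega
    have h1 := card_le_card hsub
    have h2 := h.spanned_lt X hX hX'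
    omega
  · intro hx
    refine ⟨ρ.coloops_subset X hx, ?_⟩
    have h1 := h.card_filter_erase_lt hX hX' hx
    have h2 := card_filter_add_card_filter_not (s := Xᶜ) (fun z ↦ swap X x z ∈ 𝓚)
    have h3 : Xᶜ.filter (fun z ↦ swap X x z ∈ 𝓚) =
        univ.filter fun z ↦ z ∉ X ∧ swap X x z ∈ 𝓚 := by ext; simp
    have h4 : Xᶜ.filter (fun z ↦ swap X x z ∉ 𝓚) =
        univ.filter fun z ↦ z ∉ X ∧ swap X x z ∉ 𝓚 := by ext; simp
    rw [h3, h4, card_compl] at h2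
    have := h.le_corank
    omega

/-- The same threshold argument with the leaving and the entering element interchanged. -/
theorem spannedIn_eq (hX : X ∈ ρ.nonbases r) (hX' : X ∉ 𝓚) : spannedIn 𝓚 B X = ρ.spanned X := by
  have hXc := (ρ.mem_nonbases.1 hX).1
  ext y
  rw [mem_spannedIn]
  constructor
  · rintro ⟨hy, hB⟩
    by_contra hys
    have hsub : (X.filter fun x ↦ swap X x y ∈ 𝓚) ⊆ ρ.coloops X := by
      intro x hx
      obtain ⟨hx1, hx2⟩ := mem_filter.1 hx
      by_contra hxc
      have h1 := ρ.rk_swap_of_notMem hxc (notMem_hull hy hys)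
      have h2 := (ρ.mem_nonbases.1 (h.subset hx2)).2
      have h3 := h.rk_eq X hX hX'
      omega
    have h1 := card_le_card hsub
    have h2 := h.coloops_lt X hX hX'
    omega
  · intro hy
    refine ⟨(ρ.mem_spanned.1 hy).1, ?_⟩
    have h1 := h.card_filter_insert_lt hX hX' hy
    have h2 := card_filter_add_card_filter_not (s := X) (fun x ↦ swap X x y ∈ 𝓚)
    have := h.le_rank
    omega

/-- Deleting coloops keeps a set dependent and taking the closure keeps it nonspanning. Both
properties make the comparable `r`-sets nonbases. -/
theorem forced_subset {P : Finset (Finset α)} (hP : P ⊆ ρ.nonbases r \ 𝓚) :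
    forced r B 𝓚 P ⊆ ρ.nonbases r := by
  refine union_subset h.subset fun X hX ↦ ?_
  obtain ⟨hXc, Y, hY, hXY⟩ := mem_filter.1 hX
  rw [mem_layer] at hXc
  obtain ⟨hY1, hY2⟩ := Finset.mem_sdiff.1 (hP hY)
  obtain ⟨hYc, hYr⟩ := ρ.mem_nonbases.1 hY1
  rw [h.coloopsIn_eq hY1 hY2, h.spannedIn_eq hY1 hY2] at hXY
  rcases hXY with hXY | hXY
  · refine mem_nonbases_of_subset hXc ?_ hXY
    have h1 := ρ.rk_core_add_card Y
    have h2 := card_sdiff_add_card_eq_card (ρ.coloops_subset Y)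
    rw [core] at h1
    omega
  · refine mem_nonbases_of_superset hXc ?_ hXY
    have := ρ.rk_hull Y
    rw [hull] at this
    omega

theorem mem_full_of_mem_items {S : Finset (Finset α)} (hS : S ⊆ ρ.nonbases r \ 𝓚) {G : Finset α}
    (hG : G ∈ items B 𝓚 S) : G ∈ ρ.full r := by
  obtain ⟨X, hX, hG⟩ := mem_items.1 hG
  obtain ⟨hX1, hX2⟩ := Finset.mem_sdiff.1 (hS hX)
  rw [h.coloopsIn_eq hX1 hX2, h.spannedIn_eq hX1 hX2] at hG
  have hXc := (ρ.mem_nonbases.1 hX1).1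
  obtain ⟨x, hx, rfl⟩ | ⟨y, hy, rfl⟩ := hG
  · exact erase_mem_full hXc (h.rk_eq X hX1 hX2) hx
  · exact insert_mem_full hXc (h.rk_eq X hX1 hX2) hy

/-- The witness `Y` is an uncertified nonbase, so it has rank `r - 1`, and the exchange from `Y` to
`X` cannot lower the rank by `rk_swap_ge`. -/
theorem rk_of_mem_trace {G : Finset α} (hG : G ∈ ρ.full r) (hX : X ∈ trace r B 𝓚 G) :
    ρ.rk X + 1 = r := by
  obtain ⟨hX1, hX2, Y, hY, hY2, hXY⟩ := mem_trace.1 hX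
  have hY1 := clique_subset_nonbases hG hY
  rw [h.coloopsIn_eq hY1 hY2, h.spannedIn_eq hY1 hY2] at hXY
  obtain ⟨y, hy, x, hx, rfl⟩ := exists_swap_of_mem_clique (card_of_mem_full hG) hY hX2
    (fun he ↦ hY2 (he ▸ hX1))
  rw [sdiff_swap hy hx, swap_sdiff hx, disjoint_singleton_left, disjoint_singleton_left] at hXY
  have h1 := ρ.rk_swap_ge (hXY.imp_right fun h ↦ notMem_hull hx h)
  have h2 := h.rk_eq Y hY1 hY2
  have h3 := (ρ.mem_nonbases.1 (h.subset hX1)).2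
  omega

/-- Exchanging the coloop `x` for an element outside the closure, or a non-coloop for the spanned
element `y`, gives a member of the trace with `X` itself as witness, unless the result is one of the
fewer than `θ` uncertified sets. -/
theorem le_card_trace {S : Finset (Finset α)} (hS : S ⊆ ρ.nonbases r \ 𝓚) {G : Finset α}
    (hG : G ∈ items B 𝓚 S) : m ≤ (trace r B 𝓚 G).card := by
  obtain ⟨X, hX, hG⟩ := mem_items.1 hG
  obtain ⟨hX1, hX2⟩ := Finset.mem_sdiff.1 (hS hX)
  have hco := h.coloopsIn_eq hX1 hX2
  have hsp := h.spannedIn_eq hX1 hX2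
  rw [hco, hsp] at hG
  have hXc := (ρ.mem_nonbases.1 hX1).1
  obtain ⟨x, hx, rfl⟩ | ⟨y, hy, rfl⟩ := hG
  · have hxX := ρ.coloops_subset X hx
    have h1 := h.card_filter_erase_lt hX1 hX2 hx
    have h2 := card_filter_add_card_filter_not (s := (ρ.hull X)ᶜ) (fun z ↦ swap X x z ∈ 𝓚)
    have h3 : ((ρ.hull X)ᶜ.filter fun z ↦ swap X x z ∉ 𝓚) ⊆
        univ.filter fun z ↦ z ∉ X ∧ swap X x z ∉ 𝓚 := by
      intro z hz
      obtain ⟨hz1, hz2⟩ := mem_filter.1 hz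
      exact mem_filter.2 ⟨mem_univ _, fun h' ↦ mem_compl.1 hz1 (ρ.subset_hull X h'), hz2⟩
    have h4 := card_le_card h3
    have h5 : (ρ.hull X).card ≤ X.card + (ρ.spanned X).card := card_union_le _ _
    have h6 := h.spanned_lt X hX1 hX2
    have h7 : ((ρ.hull X)ᶜ.filter fun z ↦ swap X x z ∈ 𝓚).card ≤
        (trace r B 𝓚 (X.erase x)).card := by
      refine card_le_card_of_injOn (fun z ↦ swap X x z) ?_ ?_
      · intro z hz
        obtain ⟨hz1, hz2⟩ := mem_filter.1 hz
        rw [mem_compl] at hz1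
        have hzX : z ∉ X := fun h' ↦ hz1 (ρ.subset_hull X h')
        refine mem_coe.2 (mem_trace.2 ⟨hz2, swap_mem_clique_erase hXc hxX hzX, X,
          mem_clique_erase hXc x, hX2, Or.inr ?_⟩)
        rw [swap_sdiff hzX, disjoint_singleton_left, hsp]
        exact fun h' ↦ hz1 (mem_union_right _ h')
      · intro z hz z' hz' heq
        have h1 := mem_compl.1 (mem_filter.1 hz).1
        have h2 := mem_compl.1 (mem_filter.1 hz').1
        exact congrArg Prod.snd (swap_injOn X (x₁ := (x, z)) (x₂ := (x, z'))
          ⟨hxX, fun h' ↦ h1 (ρ.subset_hull X h')⟩ ⟨hxX, fun h' ↦ h2 (ρ.subset_hull X h')⟩ heq)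
    rw [card_compl] at h2
    have := h.le_corank
    omega
  · have hyX := (ρ.mem_spanned.1 hy).1
    have h1 := h.card_filter_insert_lt hX1 hX2 hy
    have h2 := card_filter_add_card_filter_not (s := ρ.core X) (fun x ↦ swap X x y ∈ 𝓚)
    have h4 := card_le_card (filter_subset_filter (fun x ↦ swap X x y ∉ 𝓚) (ρ.core_subset X))
    have h5 := card_sdiff_add_card_eq_card (ρ.coloops_subset X)
    have h6 := h.coloops_lt X hX1 hX2
    have h7 : ((ρ.core X).filter fun x ↦ swap X x y ∈ 𝓚).card ≤
        (trace r B 𝓚 (insert y X)).card := by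
      refine card_le_card_of_injOn (fun x ↦ swap X x y) ?_ ?_
      · intro x hx
        obtain ⟨hx1, hx2⟩ := mem_filter.1 hx
        have hxX := ρ.core_subset X hx1
        refine mem_coe.2 (mem_trace.2 ⟨hx2, swap_mem_clique_insert hXc hxX hyX, X,
          mem_clique_insert hXc y, hX2, Or.inl ?_⟩)
        rw [sdiff_swap hxX hyX, disjoint_singleton_left, hco]
        exact (Finset.mem_sdiff.1 hx1).2
      · intro x hx x' hx' heq
        have h1 := ρ.core_subset X (mem_filter.1 hx).1
        have h2 := ρ.core_subset X (mem_filter.1 hx').1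
        exact congrArg Prod.fst (swap_injOn X (x₁ := (x, y)) (x₂ := (x', y)) ⟨h1, hyX⟩ ⟨h2, hyX⟩ heq)
    rw [core] at *
    have := h.le_rank
    omega

theorem mem_coloops_or_mem_spanned (hX : X ∈ ρ.nonbases r) (hX' : X ∉ 𝓚) {x y : α} (hy : y ∉ X)
    (hs : swap X x y ∈ ρ.nonbases r) : x ∈ ρ.coloops X ∨ y ∈ ρ.spanned X := by
  by_contra! hcon
  have h1 := ρ.rk_swap_of_notMem hcon.1 (notMem_hull hy hcon.2)
  have h2 := h.rk_eq X hX hX'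
  have h3 := (ρ.mem_nonbases.1 hs).2
  omega

/-- A common member `Y` has corank one, so it shares its circuit (or its closure) with the members
of `S` that produce `G` and `G'`; by injectivity these are one set `X`. Two different items of `X`
then force `Y = X`, which is not in `𝓚`. -/
theorem disjoint_taggedTrace {S : Finset (Finset α)} (hS : S ⊆ ρ.nonbases r \ 𝓚)
    (hc : Set.InjOn ρ.core S) (hh : Set.InjOn ρ.hull S) {G G' : Finset α}
    (hG : G ∈ items B 𝓚 S) (hG' : G' ∈ items B 𝓚 S) (hne : G ≠ G') :
    Disjoint (taggedTrace r B 𝓚 G) (taggedTrace r B 𝓚 G') := by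
  rw [disjoint_left]
  rintro ⟨Y, b⟩ h1 h2
  rw [mem_taggedTrace] at h1 h2
  simp only at h1 h2
  have hf := h.mem_full_of_mem_items hS hG
  have hf' := h.mem_full_of_mem_items hS hG'
  have hYr := h.rk_of_mem_trace hf h1.1
  have hY1 := mem_trace.1 h1.1
  have hY2 := mem_trace.1 h2.1
  have hYc := (mem_clique.1 hY1.2.1).1
  have hbb : (r < G.card) ↔ (r < G'.card) := by
    rw [← decide_eq_decide, ← h1.2, ← h2.2]
  obtain ⟨X, hX, hGX⟩ := mem_items.1 hG
  obtain ⟨X', hX', hGX'⟩ := mem_items.1 hG'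
  obtain ⟨hXn, hXk⟩ := Finset.mem_sdiff.1 (hS hX)
  obtain ⟨hXn', hXk'⟩ := Finset.mem_sdiff.1 (hS hX')
  have hXc := (ρ.mem_nonbases.1 hXn).1
  have hXc' := (ρ.mem_nonbases.1 hXn').1
  have hXr := h.rk_eq X hXn hXk
  have hXr' := h.rk_eq X' hXn' hXk'
  have hYX : Y ≠ X := fun he ↦ hXk (he ▸ hY1.1)
  rcases hGX with ⟨x, hx, rfl⟩ | ⟨y, hy, rfl⟩
  · have hx := (mem_coloopsIn.1 hx).1
    have hc1 : (X.erase x).card + 1 = r := by rw [card_erase_add_one hx, hXc]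
    rcases hGX' with ⟨x', hx', rfl⟩ | ⟨y', hy', rfl⟩
    · have hx' := (mem_coloopsIn.1 hx').1
      have hc2 : (X'.erase x').card + 1 = r := by rw [card_erase_add_one hx', hXc']
      have e1 := core_eq_core hc1 hf hXc hYc hXr hYr (erase_subset _ _)
        (subset_of_mem_clique_of_lt hY1.2.1 hc1)
      have e2 := core_eq_core hc2 hf' hXc' hYc hXr' hYr (erase_subset _ _)
        (subset_of_mem_clique_of_lt hY2.2.1 hc2)
      obtain rfl := hc hX hX' (e1.trans e2.symm)
      have hxx : x ≠ x' := fun he ↦ hne (by rw [he])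
      refine hYX (eq_of_subset_of_card_le ?_ (by omega)).symm
      intro a ha
      by_cases hax : a = x
      · exact subset_of_mem_clique_of_lt hY2.2.1 hc2 (mem_erase.2 ⟨hax ▸ hxx, ha⟩)
      · exact subset_of_mem_clique_of_lt hY1.2.1 hc1 (mem_erase.2 ⟨hax, ha⟩)
    · have := card_insert_of_notMem (mem_spannedIn.1 hy').1
      omega
  · have hy := (mem_spannedIn.1 hy).1
    have hc1 : (insert y X).card = r + 1 := by rw [card_insert_of_notMem hy, hXc]
    rcases hGX' with ⟨x', hx', rfl⟩ | ⟨y', hy', rfl⟩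
    · have := card_erase_add_one (mem_coloopsIn.1 hx').1
      omega
    · have hy' := (mem_spannedIn.1 hy').1
      have hc2 : (insert y' X').card = r + 1 := by rw [card_insert_of_notMem hy', hXc']
      have s1 := subset_of_mem_clique_of_gt hY1.2.1 hc1
      have s2 := subset_of_mem_clique_of_gt hY2.2.1 hc2
      have e1 := hull_eq_hull hc1 hf hXr hYr (subset_insert _ _) s1
      have e2 := hull_eq_hull hc2 hf' hXr' hYr (subset_insert _ _) s2
      obtain rfl := hh hX hX' (e1.trans e2.symm)
      have hyy : y ≠ y' := fun he ↦ hne (by rw [he])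
      refine hYX (eq_of_subset_of_card_le ?_ (by omega))
      intro a ha
      rcases mem_insert.1 (s1 ha) with rfl | h1
      · rcases mem_insert.1 (s2 ha) with h2 | h2
        · exact absurd h2 hyy
        · exact h2
      · exact h1

/-- `S` is a largest set of uncertified nonbases with distinct circuits and distinct closures. By
maximality every uncertified nonbase shares its circuit or its closure with a member of `S`, and so
is forced. Adjacent uncertified nonbases always share one of the two, so `S` is stable. -/
theorem exists_encodes : ∃ S, Encodes r B m 𝓚 (ρ.nonbases r) S := by
  obtain ⟨S, hS, hmax⟩ := exists_max_image
    ((ρ.nonbases r \ 𝓚).powerset.filter fun S ↦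
      (∀ X ∈ S, ∀ Y ∈ S, ρ.core X = ρ.core Y → X = Y) ∧
      (∀ X ∈ S, ∀ Y ∈ S, ρ.hull X = ρ.hull Y → X = Y)) Finset.card
    ⟨∅, mem_filter.2 ⟨empty_mem_powerset _, by simp, by simp⟩⟩
  obtain ⟨hS, hc, hh⟩ := mem_filter.1 hS
  rw [mem_powerset] at hS
  have hSl : S ⊆ layer α r := hS.trans (sdiff_subset.trans (filter_subset _ _))
  have hspl : ∀ X ∈ ρ.nonbases r, X ∉ 𝓚 →
      ∃ Y ∈ S, ρ.core X = ρ.core Y ∨ ρ.hull X = ρ.hull Y := by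
    intro X hX hX'
    by_contra! hcon
    have hXS : X ∉ S := fun hXS ↦ (hcon X hXS).1 rfl
    have := hmax (insert X S) (mem_filter.2 ⟨mem_powerset.2 (insert_subset
      (Finset.mem_sdiff.2 ⟨hX, hX'⟩) hS), ?_, ?_⟩)
    · rw [card_insert_of_notMem hXS] at this
      omega
    · intro U hU W hW he
      rcases mem_insert.1 hU with hU | hU <;> rcases mem_insert.1 hW with hW | hW
      · rw [hU, hW]
      · exact absurd (hU ▸ he) (hcon W hW).1
      · exact absurd (hW ▸ he.symm) (hcon U hU).1
      · exact hc U hU W hW he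
    · intro U hU W hW he
      rcases mem_insert.1 hU with hU | hU <;> rcases mem_insert.1 hW with hW | hW
      · rw [hU, hW]
      · exact absurd (hU ▸ he) (hcon W hW).2
      · exact absurd (hW ▸ he.symm) (hcon U hU).2
      · exact hh U hU W hW he
  have hmem : ∀ X ∈ S, X ∈ ρ.nonbases r ∧ X ∉ 𝓚 := fun X hX ↦ Finset.mem_sdiff.1 (hS hX)
  have hitem : ∀ X ∈ S, ∀ x ∈ X, ∀ y, y ∉ X → swap X x y ∈ ρ.nonbases r →
      ∃ G ∈ items B 𝓚 S, X ∈ clique r G ∧ swap X x y ∈ clique r G := by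
    intro X hX x hx y hy hs
    obtain ⟨hX1, hX2⟩ := hmem X hX
    have hXc := (ρ.mem_nonbases.1 hX1).1
    rcases h.mem_coloops_or_mem_spanned hX1 hX2 hy hs with h1 | h1
    · refine ⟨X.erase x, mem_items.2 ⟨X, hX, Or.inl ⟨x, ?_, rfl⟩⟩, mem_clique_erase hXc x,
        swap_mem_clique_erase hXc hx hy⟩
      rwa [h.coloopsIn_eq hX1 hX2]
    · refine ⟨insert y X, mem_items.2 ⟨X, hX, Or.inr ⟨y, ?_, rfl⟩⟩, mem_clique_insert hXc y,
        swap_mem_clique_insert hXc hx hy⟩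
      rwa [h.spannedIn_eq hX1 hX2]
  have hcard : ∀ X ∈ S, X.card = r := fun X hX ↦ mem_layer.1 (hSl hX)
  refine ⟨S, hSl, ?_, ?_, fun G hG ↦ h.le_card_trace hS hG, ?_, ?_, ?_, ?_⟩
  · exact disjoint_left.2 fun X hX ↦ (hmem X hX).2
  · intro X hX Y hY hXY
    obtain ⟨hX1, hX2⟩ := hmem X hX
    obtain ⟨hY1, hY2⟩ := hmem Y hY
    have hXc := hcard X hX
    have hYc := hcard Y hY
    have hXr := h.rk_eq X hX1 hX2
    have hYr := h.rk_eq Y hY1 hY2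
    obtain ⟨x, hx, y, hy, rfl⟩ := exists_eq_swap (hXc.trans hYc.symm) hXY
    have hne : X ≠ swap X x y := fun he ↦ hy (he ▸ mem_insert_self _ _)
    rcases h.mem_coloops_or_mem_spanned hX1 hX2 hy hY1 with h1 | h1
    · refine hne (hc X hX _ hY (core_eq_core (G := X.erase x) ?_
        (erase_mem_full hXc hXr h1) hXc hYc hXr hYr (erase_subset _ _) (erase_subset_swap _ _ _)))
      rw [card_erase_add_one hx, hXc]
    · refine hne (hh X hX _ hY (hull_eq_hull (G := insert y X) ?_
        (insert_mem_full hXc hXr h1) hXr hYr (subset_insert _ _) (swap_subset_insert _ _ _)))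
      rw [card_insert_of_notMem hy, hXc]
  · exact fun G hG G' hG' hne ↦ h.disjoint_taggedTrace hS (fun X hX Y hY ↦ hc X hX Y hY)
      (fun X hX Y hY ↦ hh X hX Y hY) hG hG' hne
  -- Enlarging `S` to `P` is harmless, since item cliques consist of nonbases. This slack is what
  -- later permits decoding after some members of `S` have been dropped.
  · intro P hSP hPS
    refine Subset.antisymm (h.forced_subset fun X hX ↦ ?_) fun X hX ↦ ?_
    · rcases mem_union.1 (hPS hX) with hX | hX
      · exact hS hX
      · obtain ⟨hX1, hX2⟩ := Finset.mem_sdiff.1 hX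
        obtain ⟨G, hG, hX1⟩ := mem_biUnion.1 hX1
        exact Finset.mem_sdiff.2
          ⟨clique_subset_nonbases (h.mem_full_of_mem_items hS hG) hX1, hX2⟩
    · by_cases hX' : X ∈ 𝓚
      · exact mem_union_left _ hX'
      obtain ⟨Y, hY, hXY⟩ := hspl X hX hX'
      obtain ⟨hY1, hY2⟩ := hmem Y hY
      refine mem_union_right _ (mem_filter.2
        ⟨mem_layer.2 (ρ.mem_nonbases.1 hX).1, Y, hSP hY, ?_⟩)
      rw [h.coloopsIn_eq hY1 hY2, h.spannedIn_eq hY1 hY2]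
      rcases hXY with he | he
      · left
        change ρ.core Y ⊆ X
        rw [← he]
        exact ρ.core_subset X
      · right
        change X ⊆ ρ.hull Y
        rw [← he]
        exact ρ.subset_hull X
  · intro X hX Y hY hXY
    have hYc := (ρ.mem_nonbases.1 (h.subset hY)).1
    obtain ⟨x, hx, y, hy, rfl⟩ := exists_eq_swap ((hcard X hX).trans hYc.symm) hXY
    exact hitem X hX x hx y hy (h.subset hY)
  · intro X hX hX1 hX2
    obtain ⟨hXn, hXk⟩ := hmem X hX
    rw [h.coloopsIn_eq hXn hXk] at hX1
    rw [h.spannedIn_eq hXn hXk] at hX2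
    refine ⟨hXn, fun Y hY hXY ↦ ?_⟩
    have hYc := (ρ.mem_nonbases.1 hY).1
    obtain ⟨x, hx, y, hy, rfl⟩ := exists_eq_swap ((hcard X hX).trans hYc.symm) hXY
    rcases h.mem_coloops_or_mem_spanned hXn hXk hy hY with h1 | h1
    · rw [hX1] at h1; exact absurd h1 (notMem_empty _)
    · rw [hX2] at h1; exact absurd h1 (notMem_empty _)

end Certificate

end RankFunction

/-! ### Containers for independent sets and packings -/

/-- A bound for the number of small subsets of a finite set. -/
theorem card_filter_powerset_le {ι : Type*} {y w : ℝ} (hy : 1 ≤ y) (U : Finset ι) :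
    ((U.powerset.filter fun T ↦ (T.card : ℝ) ≤ w).card : ℝ) ≤ y ^ w * (1 + y⁻¹) ^ U.card := by
  have hy0 : 0 < y := by linarith
  have h1 : ∑ T ∈ U.powerset, y⁻¹ ^ T.card = (1 + y⁻¹) ^ U.card := by
    have := Finset.sum_pow_mul_eq_add_pow y⁻¹ 1 U
    simp only [one_pow, mul_one] at this
    rw [this, add_comm]
  -- Each counted `T` has weight `y ^ w * y⁻¹ ^ T.card ≥ 1`, and the weights over the whole power
  -- set sum to the right-hand side.
  rw [← h1, mul_sum, card_eq_sum_ones, Nat.cast_sum]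
  refine (sum_le_sum fun T hT ↦ ?_).trans
    (sum_le_sum_of_subset_of_nonneg (filter_subset _ _) fun T _ _ ↦ by positivity)
  have hT := (mem_filter.1 hT).2
  rw [Nat.cast_one, ← Real.rpow_natCast, Real.inv_rpow hy0.le, ← div_eq_mul_inv,
    one_le_div (by positivity)]
  exact Real.rpow_le_rpow_of_exponent_le hy hT

section Containers

variable {ι β : Type*} [DecidableEq ι] [DecidableEq β]

/-- The Kleitman–Winston algorithm, as a container lemma. -/
theorem exists_containers (c : ι → ι → Prop) [∀ i j, Decidable (c i j)] {s γ y : ℝ} (hy : 1 ≤ y)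
    {U₀ : Finset ι}
    (h : ∀ U ⊆ U₀, s < U.card → ∃ v ∈ U, γ * U.card ≤ (U.filter fun w ↦ w ≠ v ∧ c v w).card) :
    ∀ (u k : ℕ) (U : Finset ι), U.card ≤ u → U ⊆ U₀ → U.card * Real.exp (-γ) ^ k ≤ s →
      ∃ 𝒞 : Finset (Finset ι), (𝒞.card : ℝ) ≤ y ^ k * (1 + y⁻¹) ^ u ∧
        (∀ C ∈ 𝒞, (C.card : ℝ) ≤ s + k) ∧
        ∀ Q ⊆ U, (∀ i ∈ Q, ∀ j ∈ Q, j ≠ i → ¬ c i j) → ∃ C ∈ 𝒞, Q ⊆ C := by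
  have hy0 : (0 : ℝ) < y := by linarith
  have hy1 : 0 ≤ y⁻¹ := by positivity
  intro u
  induction u with
  | zero =>
    intro k U hU hUU hs
    refine ⟨{∅}, ?_, ?_, fun Q hQ _ ↦ ⟨∅, by simp, ?_⟩⟩
    · simpa using one_le_pow₀ hy
    · rw [Nat.le_zero.1 hU] at hs
      simp only [CharP.cast_eq_zero, zero_mul] at hs
      simp only [mem_singleton, forall_eq, card_empty, CharP.cast_eq_zero]
      positivity
    · rw [← card_eq_zero.1 (Nat.le_zero.1 hU)]; exact hQ
  | succ u ih =>
    intro k U hU hUU hs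
    by_cases hUs : (U.card : ℝ) ≤ s
    · refine ⟨{U}, ?_, ?_, fun Q hQ _ ↦ ⟨U, by simp, hQ⟩⟩
      · simpa using one_le_mul_of_one_le_of_one_le (one_le_pow₀ (n := k) hy)
          (one_le_pow₀ (n := u + 1) (by linarith : (1 : ℝ) ≤ 1 + y⁻¹))
      · simp only [mem_singleton, forall_eq]
        have : (0 : ℝ) ≤ k := k.cast_nonneg
        linarith
    obtain ⟨v, hv, hdeg⟩ := h U hUU (not_le.1 hUs)
    obtain ⟨k, rfl⟩ : ∃ k', k = k' + 1 := by
      refine Nat.exists_eq_succ_of_ne_zero ?_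
      rintro rfl
      simp only [pow_zero, mul_one] at hs
      exact hUs hs
    have he : 0 < Real.exp (-γ) := Real.exp_pos _
    -- Independent sets avoiding `v`: only `v` is deleted, and the budget stays the same.
    obtain ⟨𝒞₁, h11, h12, h13⟩ := ih (k + 1) (U.erase v)
      (by rw [card_erase_of_mem hv]; omega) ((erase_subset _ _).trans hUU)
      (le_trans (by gcongr; exact erase_subset _ _) hs)
    set D := U.filter fun w ↦ w ≠ v ∧ c v w with hD
    set U' := (U.erase v) \ D with hU'
    have hU'c : (U'.card : ℝ) ≤ Real.exp (-γ) * U.card := by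
      have h1 : U'.card + D.card ≤ U.card := by
        rw [hU', card_sdiff_add_card]
        exact card_le_card (union_subset (erase_subset _ _) (filter_subset _ _))
      have h2 : (U'.card : ℝ) + D.card ≤ U.card := by exact_mod_cast h1
      have h3 := Real.add_one_le_exp (-γ)
      have h4 : (0 : ℝ) ≤ U.card := by positivity
      nlinarith
    -- Independent sets containing `v`: the neighbours go as well, which shrinks `U` by the factor
    -- `exp (-γ)` and uses one unit of budget.
    obtain ⟨𝒞₂, h21, h22, h23⟩ := ih k U'
      ((card_le_card sdiff_subset).trans (by rw [card_erase_of_mem hv]; omega))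
      (sdiff_subset.trans ((erase_subset _ _).trans hUU))
      (le_trans (by rw [pow_succ', ← mul_assoc, mul_comm (U.card : ℝ)]; gcongr) hs)
    refine ⟨𝒞₁ ∪ 𝒞₂.image (insert v), ?_, ?_, ?_⟩
    · have h1 : ((𝒞₁ ∪ 𝒞₂.image (insert v)).card : ℝ) ≤ 𝒞₁.card + 𝒞₂.card := by
        exact_mod_cast (card_union_le _ _).trans (Nat.add_le_add_left card_image_le _)
      -- The bound satisfies the recursion with equality: `y ^ (k + 1) + y ^ k = y ^ (k + 1) * (1 +
      -- y⁻¹)`.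
      refine h1.trans ((add_le_add h11 h21).trans_eq ?_)
      rw [pow_succ y, pow_succ (1 + y⁻¹)]
      field_simp
    · intro C hC
      rcases mem_union.1 hC with hC | hC
      · exact h12 C hC
      · obtain ⟨C', hC', rfl⟩ := mem_image.1 hC
        have h1 := h22 C' hC'
        have h2 : ((insert v C').card : ℝ) ≤ C'.card + 1 := by exact_mod_cast card_insert_le _ _
        push_cast
        linarith
    · intro Q hQ hind
      by_cases hvQ : v ∈ Q
      · obtain ⟨C, hC, hQC⟩ := h23 (Q.erase v) (fun w hw ↦ by
          obtain ⟨hw1, hw2⟩ := mem_erase.1 hw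
          refine Finset.mem_sdiff.2 ⟨mem_erase.2 ⟨hw1, hQ hw2⟩, fun hw3 ↦ ?_⟩
          exact hind v hvQ w hw2 hw1 (mem_filter.1 hw3).2.2)
          (fun i hi j hj ↦ hind i (mem_of_mem_erase hi) j (mem_of_mem_erase hj))
        exact ⟨insert v C, mem_union_right _ (mem_image_of_mem _ hC), subset_insert_iff.2 hQC⟩
      · obtain ⟨C, hC, hQC⟩ := h13 Q (subset_erase.2 ⟨hQ, hvQ⟩) hind
        exact ⟨C, mem_union_left _ hC, hQC⟩

/-- In a linear set system with many members, some member meets many others. -/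
theorem exists_large_degree (N : ι → Finset β) {P : Finset β} {m ε : ℝ} (hm : 0 < m) (hε : 0 < ε)
    {U : Finset ι} (hN : ∀ i ∈ U, N i ⊆ P) (hmN : ∀ i ∈ U, m ≤ (N i).card)
    (hlin : ∀ i ∈ U, ∀ j ∈ U, j ≠ i → (N i ∩ N j).card ≤ 1)
    (hU : (1 + ε) * P.card / m < U.card) :
    ∃ v ∈ U, ε / (1 + ε) * m ^ 2 / P.card * U.card ≤
      (U.filter fun w ↦ w ≠ v ∧ ¬ Disjoint (N v) (N w)).card := by
  have hU0 : (0 : ℝ) < U.card := lt_of_le_of_lt (by positivity) hU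
  have hUne : U.Nonempty := card_pos.1 (by exact_mod_cast hU0)
  rcases Nat.eq_zero_or_pos P.card with hP | hP
  · obtain ⟨v, hv⟩ := hUne
    exact ⟨v, hv, by rw [hP]; simp⟩
  have hP' : (0 : ℝ) < P.card := by exact_mod_cast hP
  let T : ℝ := ∑ i ∈ U, ((N i).card : ℝ)
  let D : ι → ℝ := fun v ↦ (U.filter fun w ↦ w ≠ v ∧ ¬ Disjoint (N v) (N w)).card
  let μ : β → ℝ := fun p ↦ (U.filter fun i ↦ p ∈ N i).card
  have hT : ∑ p ∈ P, μ p = T := by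
    have h1 : ∀ p, μ p = ∑ i ∈ U, if p ∈ N i then (1 : ℝ) else 0 := fun p ↦ by
      rw [sum_boole]
    simp_rw [h1]
    rw [sum_comm]
    refine sum_congr rfl fun i hi ↦ ?_
    rw [sum_boole, filter_mem_eq_inter, inter_eq_right.2 (hN i hi)]
  -- Pairs of members through a common point: the diagonal gives `T`, and by linearity an
  -- intersecting pair contributes at most one.
  have hsq : ∑ p ∈ P, μ p ^ 2 ≤ T + ∑ i ∈ U, D i := by
    have h1 : ∀ p, μ p ^ 2 = ∑ i ∈ U, ∑ j ∈ U, if p ∈ N i ∩ N j then (1 : ℝ) else 0 := by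
      intro p
      have : μ p = ∑ i ∈ U, if p ∈ N i then (1 : ℝ) else 0 := by rw [sum_boole]
      rw [this, sq, sum_mul_sum]
      refine sum_congr rfl fun i _ ↦ sum_congr rfl fun j _ ↦ ?_
      by_cases h1 : p ∈ N i <;> by_cases h2 : p ∈ N j <;> simp [h1, h2]
    simp_rw [h1]
    rw [sum_comm, ← sum_add_distrib]
    refine sum_le_sum fun i hi ↦ ?_
    rw [sum_comm]
    have h2 : ∀ j ∈ U, (∑ p ∈ P, if p ∈ N i ∩ N j then (1 : ℝ) else 0) ≤
        (if j = i then ((N i).card : ℝ) else 0) +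
          if j ≠ i ∧ ¬ Disjoint (N i) (N j) then (1 : ℝ) else 0 := by
      intro j hj
      rw [sum_boole, filter_mem_eq_inter,
        inter_eq_right.2 (inter_subset_left.trans (hN i hi))]
      by_cases hji : j = i
      · subst hji; simp
      · by_cases hd : Disjoint (N i) (N j)
        · simp [hji, hd, disjoint_iff_inter_eq_empty.1 hd]
        · rw [if_neg hji, if_pos ⟨hji, hd⟩, zero_add]
          exact_mod_cast hlin i hi j hj hji
    refine (sum_le_sum h2).trans ?_
    rw [sum_add_distrib, sum_ite_eq' U i, if_pos hi, sum_boole]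
  have hcs : T ^ 2 ≤ P.card * ∑ p ∈ P, μ p ^ 2 := by
    rw [← hT]
    exact sq_sum_le_card_mul_sum_sq
  have hTm : U.card * m ≤ T := by
    have := sum_le_sum hmN
    rwa [sum_const, nsmul_eq_mul] at this
  have hTP : (1 + ε) * P.card ≤ T := by
    rw [div_lt_iff₀ hm] at hU
    linarith
  by_contra! hcon
  have h1 : ∑ i ∈ U, D i < ∑ i ∈ U, ε / (1 + ε) * m ^ 2 / P.card * U.card :=
    sum_lt_sum_of_nonempty hUne hcon
  rw [sum_const, nsmul_eq_mul] at h1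
  have h2 : (P.card : ℝ) * ∑ i ∈ U, D i < ε / (1 + ε) * (U.card * m) ^ 2 := by
    calc (P.card : ℝ) * ∑ i ∈ U, D i
        < P.card * (U.card * (ε / (1 + ε) * m ^ 2 / P.card * U.card)) := by gcongr
      _ = ε / (1 + ε) * (U.card * m) ^ 2 := by field_simp
  have h3 : T ^ 2 ≤ P.card * T + P.card * ∑ i ∈ U, D i := by
    rw [← mul_add]
    exact hcs.trans (by gcongr)
  have hT0 : 0 < T := lt_of_lt_of_le (by positivity) hTm
  have h4 : ε / (1 + ε) * (U.card * m) ^ 2 ≤ ε / (1 + ε) * T ^ 2 := by gcongr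
  -- Since `T ≥ (1 + ε) * P.card`, the diagonal accounts for at most the share `1 / (1 + ε)` of the
  -- Cauchy–Schwarz bound. The rest must come from intersecting pairs.
  have h5 : P.card * T ≤ 1 / (1 + ε) * T ^ 2 := by
    rw [div_mul_eq_mul_div, le_div_iff₀ (by positivity)]
    nlinarith
  have h6 : 1 / (1 + ε) * T ^ 2 + ε / (1 + ε) * T ^ 2 = T ^ 2 := by
    field_simp
  linarith

/-- Containers for the packings in a linear set system. -/
theorem exists_packing_containers (N : ι → Finset β) {P : Finset β} {m ε y : ℝ} (hm : 0 < m)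
    (hε : 0 < ε) (hy : 1 ≤ y) {U : Finset ι} (hN : ∀ i ∈ U, N i ⊆ P)
    (hmN : ∀ i ∈ U, m ≤ (N i).card) (hlin : ∀ i ∈ U, ∀ j ∈ U, j ≠ i → (N i ∩ N j).card ≤ 1)
    {k : ℕ} (hk : U.card * Real.exp (-(ε / (1 + ε) * m ^ 2 / P.card) * k) ≤ (1 + ε) * P.card / m) :
    ∃ 𝒞 : Finset (Finset ι), (𝒞.card : ℝ) ≤ y ^ k * (1 + y⁻¹) ^ U.card ∧
      (∀ C ∈ 𝒞, (C.card : ℝ) ≤ (1 + ε) * P.card / m + k) ∧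
      ∀ Q ⊆ U, (∀ i ∈ Q, ∀ j ∈ Q, j ≠ i → Disjoint (N i) (N j)) → ∃ C ∈ 𝒞, Q ⊆ C := by
  obtain ⟨𝒞, h1, h2, h3⟩ := exists_containers (fun i j ↦ ¬ Disjoint (N i) (N j)) hy (U₀ := U)
    (s := (1 + ε) * P.card / m) (γ := ε / (1 + ε) * m ^ 2 / P.card)
    (fun U' hU' hs ↦ exists_large_degree N hm hε (fun i hi ↦ hN i (hU' hi))
      (fun i hi ↦ hmN i (hU' hi)) (fun i hi j hj ↦ hlin i (hU' hi) j (hU' hj)) hs)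
    U.card k U le_rfl subset_rfl (by rwa [← Real.exp_nat_mul, mul_comm (k : ℝ)])
  exact ⟨𝒞, h1, h2, fun Q hQ hd ↦ h3 Q hQ fun i hi j hj hji ↦ not_not.2 (hd i hi j hj hji)⟩

end Containers

/-! ### Counting encoded families relative to a known part -/

section Counting

variable {α : Type*} [DecidableEq α] [Fintype α]

open Classical in
/-- The stable sets of the Johnson graph on the `r`-subsets of `α`. -/
noncomputable def stableSets (α : Type*) [DecidableEq α] [Fintype α] (r : ℕ) :
    Finset (Finset (Finset α)) :=
  (layer α r).powerset.filter IsStable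

theorem mem_stableSets {r : ℕ} {S : Finset (Finset α)} :
    S ∈ stableSets α r ↔ S ⊆ layer α r ∧ IsStable S := by
  simp [stableSets]

/-- Adding stable subsets of the known part to the encoding stable sets produces many stable
sets. -/
theorem card_mul_le_card_stableSets_mul {r B m L : ℕ} {𝓚 Q : Finset (Finset α)}
    {c : Finset (Finset α)} {𝒦 : Finset (Finset (Finset α))}
    {S : Finset (Finset α) → Finset (Finset α)}
    (hS : ∀ K ∈ 𝒦, Encodes r B m 𝓚 K (S K)) (hc : ∀ K ∈ 𝒦, items B 𝓚 (S K) ⊆ c)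
    (h𝓚 : 𝓚 ⊆ layer α r) (hQ𝓚 : Q ⊆ 𝓚) (hQ : IsStable Q)
    (hL : ∀ X ∈ Q, (c.filter fun G ↦ X ∈ clique r G).card ≤ L) :
    𝒦.card * (1 + 2 ^ L) ^ Q.card ≤ (stableSets α r).card * 2 ^ (L * Q.card) := by
  classical
  let near : Finset (Finset α) → Finset (Finset α) := fun T ↦
    c.filter fun G ↦ ∃ Y ∈ T, Y ∈ clique r G
  -- `T` is grafted onto `S K`. Members of `S K` adjacent to `T` are dropped to keep stability, and
  -- the items around `T` are recorded, because their cliques contain everything dropped.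
  let Φ : Finset (Finset α) × Finset (Finset α) →
      (_ : Finset (Finset α)) × Finset (Finset α) := fun p ↦
    ⟨((S p.1).filter fun X ↦ ∀ Y ∈ p.2, (X \ Y).card ≠ 1) ∪ p.2,
      (items B 𝓚 (S p.1)).filter fun G ↦ ∃ Y ∈ p.2, Y ∈ clique r G⟩
  -- `S K` avoids `𝓚`, so `T` is recovered by intersecting with `𝓚`.
  have hinter : ∀ K ∈ 𝒦, ∀ T ⊆ Q,
      (((S K).filter fun X ↦ ∀ Y ∈ T, (X \ Y).card ≠ 1) ∪ T) ∩ 𝓚 = T := by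
    intro K hK T hT
    rw [union_inter_distrib_right, inter_eq_left.2 (hT.trans hQ𝓚),
      disjoint_iff_inter_eq_empty.1 (disjoint_of_subset_left (filter_subset _ _) (hS K hK).disjoint),
      empty_union]
  have hK : ∀ K ∈ 𝒦, ∀ T ⊆ Q, forced r B 𝓚 (((Φ (K, T)).1 \ 𝓚) ∪
      ((Φ (K, T)).2.biUnion (clique r) \ 𝓚)) = K := by
    intro K hK T hT
    refine (hS K hK).forced_eq _ ?_ ?_
    · intro X hX
      have hX𝓚 : X ∉ 𝓚 := fun h ↦ disjoint_left.1 (hS K hK).disjoint hX h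
      by_cases h : ∀ Y ∈ T, (X \ Y).card ≠ 1
      · exact mem_union_left _ (Finset.mem_sdiff.2
          ⟨mem_union_left _ (mem_filter.2 ⟨hX, h⟩), hX𝓚⟩)
      · push Not at h
        obtain ⟨Y, hY, hXY⟩ := h
        obtain ⟨G, hG, hXG, hYG⟩ := (hS K hK).exists_item X hX Y (hQ𝓚 (hT hY)) hXY
        exact mem_union_right _ (Finset.mem_sdiff.2
          ⟨mem_biUnion.2 ⟨G, mem_filter.2 ⟨hG, Y, hY, hYG⟩, hXG⟩, hX𝓚⟩)
    · refine union_subset_union ?_ (sdiff_subset_sdiff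
        (biUnion_subset_biUnion_of_subset_left _ (filter_subset _ _)) subset_rfl)
      intro X hX
      obtain ⟨hX1, hX2⟩ := Finset.mem_sdiff.1 hX
      rcases mem_union.1 hX1 with h | h
      · exact (mem_filter.1 h).1
      · exact absurd (hQ𝓚 (hT h)) hX2
  have hinj : Set.InjOn Φ (𝒦 ×ˢ Q.powerset : Finset _) := by
    rintro ⟨K, T⟩ h ⟨K', T'⟩ h' he
    rw [mem_coe, mem_product, mem_powerset] at h h'
    have e1 : T = T' := by
      rw [← hinter K h.1 T h.2, ← hinter K' h'.1 T' h'.2]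
      exact congrArg (fun p ↦ p.1 ∩ 𝓚) he
    have e2 : K = K' := by rw [← hK K h.1 T h.2, ← hK K' h'.1 T' h'.2, he]
    rw [e1, e2]
  let tgt : Finset ((_ : Finset (Finset α)) × Finset (Finset α)) :=
    ((stableSets α r).filter fun U ↦ U ∩ 𝓚 ⊆ Q).sigma fun U ↦ (near (U ∩ 𝓚)).powerset
  have hmaps : ∀ p ∈ 𝒦 ×ˢ Q.powerset, Φ p ∈ tgt := by
    rintro ⟨K, T⟩ h
    rw [mem_product, mem_powerset] at h
    obtain ⟨h1, h2⟩ := h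
    simp only at h1 h2
    have hTl : ∀ Y ∈ T, Y.card = r := fun Y hY ↦ mem_layer.1 (h𝓚 (hQ𝓚 (h2 hY)))
    refine mem_sigma.2 ⟨mem_filter.2 ⟨mem_stableSets.2 ⟨?_, ?_⟩, ?_⟩, ?_⟩
    · exact union_subset ((filter_subset _ _).trans (hS K h1).subset_layer)
        (h2.trans (hQ𝓚.trans h𝓚))
    · intro X hX Y hY
      rcases mem_union.1 hX with hX | hX <;> rcases mem_union.1 hY with hY | hY
      · exact (hS K h1).stable X (mem_filter.1 hX).1 Y (mem_filter.1 hY).1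
      · exact (mem_filter.1 hX).2 Y hY
      · rw [card_sdiff_comm ((hTl X hX).trans
          (mem_layer.1 ((hS K h1).subset_layer (mem_filter.1 hY).1)).symm)]
        exact (mem_filter.1 hY).2 X hX
      · exact hQ X (h2 hX) Y (h2 hY)
    · rw [hinter K h1 T h2]; exact h2
    · rw [show (Φ (K, T)).1 ∩ 𝓚 = T from hinter K h1 T h2, mem_powerset]
      exact filter_subset_filter _ (hc K h1)
  -- The weight of a pair depends on the size of `T` so as to offset the at most `2 ^ (L * T.card)`
  -- possible records of items around `T`.
  have hsum : ∑ p ∈ 𝒦 ×ˢ Q.powerset, (2 ^ L) ^ (Q.card - p.2.card) =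
      𝒦.card * (1 + 2 ^ L) ^ Q.card := by
    simp only [sum_product, sum_const, smul_eq_mul]
    congr 1
    rw [← Finset.sum_pow_mul_eq_add_pow]
    exact sum_congr rfl fun T _ ↦ by rw [one_pow, one_mul]
  rw [← hsum]
  calc ∑ p ∈ 𝒦 ×ˢ Q.powerset, (2 ^ L) ^ (Q.card - p.2.card)
      = ∑ p ∈ 𝒦 ×ˢ Q.powerset, (2 ^ L) ^ (Q.card - ((Φ p).1 ∩ 𝓚).card) := by
        refine sum_congr rfl ?_
        rintro ⟨K, T⟩ h
        rw [mem_product, mem_powerset] at h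
        have := hinter K h.1 T h.2
        simp only [Φ, this]
    _ = ∑ q ∈ (𝒦 ×ˢ Q.powerset).image Φ, (2 ^ L) ^ (Q.card - (q.1 ∩ 𝓚).card) :=
        (sum_image (f := fun q : (_ : Finset (Finset α)) × Finset (Finset α) ↦
          (2 ^ L) ^ (Q.card - (q.1 ∩ 𝓚).card)) hinj).symm
    _ ≤ ∑ q ∈ tgt, (2 ^ L) ^ (Q.card - (q.1 ∩ 𝓚).card) :=
        sum_le_sum_of_subset (image_subset_iff.2 hmaps)
    _ = ∑ U ∈ (stableSets α r).filter fun U ↦ U ∩ 𝓚 ⊆ Q,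
          2 ^ (near (U ∩ 𝓚)).card * (2 ^ L) ^ (Q.card - (U ∩ 𝓚).card) := by
        rw [sum_sigma]
        refine sum_congr rfl fun U _ ↦ ?_
        simp only [sum_const, card_powerset, smul_eq_mul]
    _ ≤ ∑ U ∈ (stableSets α r).filter fun U ↦ U ∩ 𝓚 ⊆ Q, 2 ^ (L * Q.card) := by
        refine sum_le_sum fun U hU ↦ ?_
        have hU := (mem_filter.1 hU).2
        have h1 : near (U ∩ 𝓚) ⊆
            (U ∩ 𝓚).biUnion fun Y ↦ c.filter fun G ↦ Y ∈ clique r G := by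
          intro G hG
          obtain ⟨hG1, Y, hY, hG2⟩ := mem_filter.1 hG
          exact mem_biUnion.2 ⟨Y, hY, mem_filter.2 ⟨hG1, hG2⟩⟩
        have h2 := (card_le_card h1).trans (card_biUnion_le_card_mul _ _ L fun Y hY ↦ hL Y (hU hY))
        rw [← pow_mul, ← pow_add]
        refine Nat.pow_le_pow_right two_pos ?_
        have h3 := card_le_card hU
        calc (near (U ∩ 𝓚)).card + L * (Q.card - (U ∩ 𝓚).card)
            ≤ (U ∩ 𝓚).card * L + L * (Q.card - (U ∩ 𝓚).card) := Nat.add_le_add_right h2 _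
          _ = L * ((U ∩ 𝓚).card + (Q.card - (U ∩ 𝓚).card)) := by ring
          _ = L * Q.card := by rw [Nat.add_sub_of_le h3]
    _ ≤ (stableSets α r).card * 2 ^ (L * Q.card) := by
        rw [sum_const, smul_eq_mul]
        exact Nat.mul_le_mul_right _ (card_le_card (filter_subset _ _))

theorem card_clique_le {r : ℕ} {G : Finset α} (hG : G.card + 1 = r ∨ G.card = r + 1) :
    (clique r G).card ≤ Fintype.card α := by
  have key : ∀ f : α → Finset α, clique r G ⊆ univ.image f →
      (clique r G).card ≤ Fintype.card α := fun f hf ↦ (card_le_card hf).trans card_image_le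
  rcases hG with hG | hG
  · refine key (insert · G) fun X hX ↦ ?_
    have h1 := subset_of_mem_clique_of_lt hX hG
    have h2 := card_sdiff_of_subset h1
    rw [(mem_clique.1 hX).1, ← hG, Nat.add_sub_cancel_left, card_eq_one] at h2
    obtain ⟨a, ha⟩ := h2
    refine mem_image.2 ⟨a, mem_univ _, ?_⟩
    rw [← sdiff_union_of_subset h1, ha, insert_eq]
  · refine key G.erase fun X hX ↦ ?_
    have h1 := subset_of_mem_clique_of_gt hX hG
    have h2 := card_sdiff_of_subset h1
    rw [(mem_clique.1 hX).1, hG, Nat.add_sub_cancel_left, card_eq_one] at h2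
    obtain ⟨a, ha⟩ := h2
    refine mem_image.2 ⟨a, mem_univ _, ?_⟩
    rw [← Finset.sdiff_sdiff_eq_self h1, ha, sdiff_singleton_eq_erase]

/-- Each clique has at most `n` members, so a set of `𝓚` lies on average in at most `17` cliques of
`c`. By Markov, at least half lie in at most `2 * 17`. -/
theorem card_low_ge {r : ℕ} {𝓚 c : Finset (Finset α)}
    (hc : ∀ G ∈ c, G.card + 1 = r ∨ G.card = r + 1)
    (hcard : c.card * Fintype.card α ≤ 17 * 𝓚.card) :
    𝓚.card ≤ 2 * (𝓚.filter fun X ↦ (c.filter fun G ↦ X ∈ clique r G).card ≤ 34).card := by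
  have h1 : ∑ X ∈ 𝓚, (c.filter fun G ↦ X ∈ clique r G).card ≤ 17 * 𝓚.card := by
    have : ∑ X ∈ 𝓚, (c.filter fun G ↦ X ∈ clique r G).card =
        ∑ G ∈ c, (𝓚.filter fun X ↦ X ∈ clique r G).card :=
      sum_card_bipartiteAbove_eq_sum_card_bipartiteBelow fun X G ↦ X ∈ clique r G
    rw [this]
    refine le_trans (sum_le_card_nsmul _ _ (Fintype.card α) fun G hG ↦ ?_) hcard
    refine (card_le_card fun X hX ↦ ?_).trans (card_clique_le (hc G hG))
    exact (mem_filter.1 hX).2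
  have h2 := card_filter_add_card_filter_not (s := 𝓚)
    (fun X ↦ (c.filter fun G ↦ X ∈ clique r G).card ≤ 34)
  have h3 : (𝓚.filter fun X ↦ ¬ (c.filter fun G ↦ X ∈ clique r G).card ≤ 34).card * 35 ≤
      ∑ X ∈ 𝓚, (c.filter fun G ↦ X ∈ clique r G).card := by
    refine le_trans (card_nsmul_le_sum _ (fun X ↦ (c.filter fun G ↦ X ∈ clique r G).card) 35
      fun X hX ↦ ?_) (sum_le_sum_of_subset (filter_subset _ _))
    have := (mem_filter.1 hX).2
    omega
  omega

/-- The colouring of the Johnson graph of Graham and Sloane. -/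
theorem exists_stable_subset {n r : ℕ} (hn : 0 < n) {T : Finset (Finset (Fin n))}
    (hT : T ⊆ layer (Fin n) r) : ∃ Q ⊆ T, IsStable Q ∧ T.card ≤ n * Q.card := by
  let f : Finset (Fin n) → ℕ := fun X ↦ (∑ x ∈ X, (x : ℕ)) % n
  obtain ⟨a, ha, hle⟩ : ∃ a ∈ range n, T.card ≤ n * (T.filter fun X ↦ f X = a).card := by
    by_contra! hcon
    have h1 := card_eq_sum_card_fiberwise (f := f) (s := T) (t := range n)
      (fun X _ ↦ mem_coe.2 (mem_range.2 (Nat.mod_lt _ hn)))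
    have h2 : n * T.card < n * T.card := by
      calc n * T.card = ∑ a ∈ range n, n * (T.filter fun X ↦ f X = a).card := by
            rw [← mul_sum, ← h1]
        _ < ∑ a ∈ range n, T.card := sum_lt_sum_of_nonempty ⟨0, mem_range.2 hn⟩ hcon
        _ = n * T.card := by rw [sum_const, card_range, smul_eq_mul]
    exact lt_irrefl _ h2
  refine ⟨T.filter fun X ↦ f X = a, filter_subset _ _, fun X hX Y hY hXY ↦ ?_, hle⟩
  obtain ⟨hX, hfX⟩ := mem_filter.1 hX
  obtain ⟨hY, hfY⟩ := mem_filter.1 hY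
  obtain ⟨x, hx, y, hy, rfl⟩ := exists_eq_swap
    ((mem_layer.1 (hT hX)).trans (mem_layer.1 (hT hY)).symm) hXY
  have h1 : ∑ z ∈ swap X x y, (z : ℕ) = y + ∑ z ∈ X.erase x, (z : ℕ) :=
    sum_insert fun h ↦ hy (mem_of_mem_erase h)
  have h2 : ∑ z ∈ X, (z : ℕ) = x + ∑ z ∈ X.erase x, (z : ℕ) := (add_sum_erase _ _ hx).symm
  -- Adjacent sets with the same sum modulo `n` would exchange congruent elements, both less than
  -- `n`.
  have h3 : (y + ∑ z ∈ X.erase x, (z : ℕ)) ≡ (x + ∑ z ∈ X.erase x, (z : ℕ)) [MOD n] := by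
    rw [← h1, ← h2]
    exact hfY.trans hfX.symm
  have h4 := Nat.ModEq.add_right_cancel' _ h3
  have h5 := Nat.ModEq.eq_of_lt_of_lt h4 y.2 x.2
  exact hy (Fin.ext h5 ▸ hx)

/-- Few families of nonbases are encoded relative to a large known part. -/
theorem card_encoded_le_of_large {n r B m k : ℕ} {y : ℝ} (hn : 0 < n) (hy : 1 ≤ y)
    (hm : n ≤ 4 * m) {𝓚 : Finset (Finset (Fin n))} (h𝓚 : 𝓚 ⊆ layer (Fin n) r)
    {𝒦 : Finset (Finset (Finset (Fin n)))} (h𝒦 : ∀ K ∈ 𝒦, ∃ S, Encodes r B m 𝓚 K S)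
    (hkn : k * n ≤ 𝓚.card)
    (hk : 2 ^ n * Real.exp (-((m : ℝ) ^ 2 / (4 * 𝓚.card) * k)) ≤ 4 * 𝓚.card / m) :
    (𝒦.card : ℝ) ≤ y ^ k * (1 + y⁻¹) ^ (2 ^ n) * ((stableSets (Fin n) r).card *
      ((2 ^ 34 / (1 + 2 ^ 34) : ℝ) ^ ((𝓚.card : ℝ) / (2 * n)))) := by
  classical
  have hm0 : (0 : ℝ) < m := by
    have : 0 < m := by omega
    exact_mod_cast this
  have hn0 : (0 : ℝ) < n := by exact_mod_cast hn
  let U : Finset (Finset (Fin n)) :=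
    {G | (G.card + 1 = r ∨ G.card = r + 1) ∧ m ≤ (trace r B 𝓚 G).card}
  have hU : ∀ G, G ∈ U ↔ (G.card + 1 = r ∨ G.card = r + 1) ∧ m ≤ (trace r B 𝓚 G).card :=
    fun G ↦ by simp [U]
  have hUc : U.card ≤ 2 ^ n := by
    have := card_le_univ U
    rwa [Fintype.card_finset, Fintype.card_fin] at this
  have hP : ((𝓚 ×ˢ (univ : Finset Bool)).card : ℝ) = 2 * 𝓚.card := by
    rw [card_product, card_univ, Fintype.card_bool]; push_cast; ring
  obtain ⟨𝒞, h1, h2, h3⟩ := exists_packing_containers (taggedTrace r B 𝓚)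
    (P := 𝓚 ×ˢ (univ : Finset Bool)) (ε := 1) (k := k) hm0 one_pos hy (U := U)
    (fun G _ p hp ↦ mem_product.2 ⟨(mem_trace.1 (mem_taggedTrace.1 hp).1).1, mem_univ _⟩)
    (fun G hG ↦ by rw [card_taggedTrace]; exact_mod_cast ((hU G).1 hG).2)
    (fun G hG G' hG' hne ↦ card_taggedTrace_inter_le ((hU G).1 hG).1 ((hU G').1 hG').1 hne.symm)
    (by
      rw [hP]
      have e1 : (1 + 1 : ℝ) * (2 * 𝓚.card) / m = 4 * 𝓚.card / m := by ring
      have e2 : (1 : ℝ) / (1 + 1) * (m : ℝ) ^ 2 / (2 * 𝓚.card) = (m : ℝ) ^ 2 / (4 * 𝓚.card) := by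
        rw [show (4 : ℝ) * 𝓚.card = 2 * (2 * 𝓚.card) by ring, ← div_div (_ ^ 2)]
        ring
      rw [e1, e2, neg_mul]
      refine le_trans ?_ hk
      gcongr
      exact_mod_cast hUc)
  choose! S hS using h𝒦
  have hitems : ∀ K ∈ 𝒦, items B 𝓚 (S K) ⊆ U := fun K hK G hG ↦ (hU G).2
    ⟨card_of_mem_items (hS K hK).subset_layer hG, (hS K hK).le_card_trace G hG⟩
  set δ : ℝ := 2 ^ 34 / (1 + 2 ^ 34) with hδ
  have hδ0 : 0 < δ := by positivity
  have hδ1 : δ ≤ 1 := by rw [hδ]; norm_num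
  have hfib : ∀ C ∈ 𝒞, ((𝒦.filter fun K ↦ items B 𝓚 (S K) ⊆ C).card : ℝ) ≤
      (stableSets (Fin n) r).card * δ ^ ((𝓚.card : ℝ) / (2 * n)) := by
    intro C hC
    -- `16 = 2 * 2 * 4` comes from `1 + ε = 2`, the two tags and `n ≤ 4 * m`. The extra `1` absorbs
    -- the `k` vertices added to a container.
    have hC17 : (C ∩ U).card * Fintype.card (Fin n) ≤ 17 * 𝓚.card := by
      have e1 := h2 C hC
      rw [hP] at e1
      have e2 : ((C ∩ U).card : ℝ) ≤ C.card := by exact_mod_cast card_le_card inter_subset_left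
      have e3 : (k : ℝ) * n ≤ 𝓚.card := by exact_mod_cast hkn
      have e4 : (n : ℝ) ≤ 4 * m := by exact_mod_cast hm
      have e5 : (1 + 1 : ℝ) * (2 * 𝓚.card) / m * n ≤ 16 * 𝓚.card := by
        rw [div_mul_eq_mul_div, div_le_iff₀ hm0]
        have : (0 : ℝ) ≤ 𝓚.card := by positivity
        nlinarith
      have e6 : ((C ∩ U).card : ℝ) * n ≤ 17 * 𝓚.card := by
        calc ((C ∩ U).card : ℝ) * n ≤ ((1 + 1 : ℝ) * (2 * 𝓚.card) / m + k) * n := by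
              gcongr; exact e2.trans e1
          _ ≤ 17 * 𝓚.card := by rw [add_mul]; linarith
      rw [Fintype.card_fin]
      exact_mod_cast e6
    have hlow := card_low_ge (r := r) (fun G hG ↦ ((hU G).1 (mem_inter.1 hG).2).1) hC17
    obtain ⟨Q, hQ, hQst, hQc⟩ := exists_stable_subset (n := n) (r := r) hn
      ((filter_subset (fun X ↦ ((C ∩ U).filter fun G ↦ X ∈ clique r G).card ≤ 34) 𝓚).trans h𝓚)
    have hmain := card_mul_le_card_stableSets_mul (L := 34) (c := C ∩ U)
      (𝒦 := 𝒦.filter fun K ↦ items B 𝓚 (S K) ⊆ C) (S := S)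
      (fun K hK ↦ hS K (mem_filter.1 hK).1)
      (fun K hK ↦ subset_inter (mem_filter.1 hK).2 (hitems K (mem_filter.1 hK).1))
      h𝓚 (hQ.trans (filter_subset _ _)) hQst (fun X hX ↦ (mem_filter.1 (hQ hX)).2)
    have hmain' : ((𝒦.filter fun K ↦ items B 𝓚 (S K) ⊆ C).card : ℝ) * (1 + 2 ^ 34) ^ Q.card ≤
        (stableSets (Fin n) r).card * (2 ^ 34) ^ Q.card := by
      rw [← pow_mul]
      exact_mod_cast hmain
    have hQn : (𝓚.card : ℝ) / (2 * n) ≤ Q.card := by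
      rw [div_le_iff₀ (by positivity)]
      have : 𝓚.card ≤ Q.card * (2 * n) := by nlinarith
      exact_mod_cast this
    calc ((𝒦.filter fun K ↦ items B 𝓚 (S K) ⊆ C).card : ℝ)
        ≤ (stableSets (Fin n) r).card * δ ^ Q.card := by
          rw [hδ, div_pow, ← mul_div_assoc, le_div_iff₀ (by positivity)]
          exact hmain'
      _ ≤ (stableSets (Fin n) r).card * δ ^ ((𝓚.card : ℝ) / (2 * n)) := by
          gcongr
          rw [← Real.rpow_natCast]
          exact Real.rpow_le_rpow_of_exponent_ge hδ0 hδ1 hQn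
  have hcov : 𝒦 ⊆ 𝒞.biUnion fun C ↦ 𝒦.filter fun K ↦ items B 𝓚 (S K) ⊆ C := by
    intro K hK
    obtain ⟨C, hC, hKC⟩ := h3 (items B 𝓚 (S K)) (hitems K hK)
      (fun G hG G' hG' hne ↦ (hS K hK).disjoint_taggedTrace G hG G' hG' hne.symm)
    exact mem_biUnion.2 ⟨C, hC, mem_filter.2 ⟨hK, hKC⟩⟩
  calc (𝒦.card : ℝ) ≤ ∑ C ∈ 𝒞, ((𝒦.filter fun K ↦ items B 𝓚 (S K) ⊆ C).card : ℝ) := by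
        exact_mod_cast (card_le_card hcov).trans card_biUnion_le
    _ ≤ 𝒞.card * ((stableSets (Fin n) r).card * δ ^ ((𝓚.card : ℝ) / (2 * n))) := by
        rw [← nsmul_eq_mul]
        exact sum_le_card_nsmul _ _ _ hfib
    _ ≤ _ := by
        gcongr
        refine h1.trans ?_
        gcongr
        have : 0 < y⁻¹ := by positivity
        linarith

/-- The number of small stable sets of the Johnson graph. -/
theorem card_small_stableSets_le {n r k : ℕ} {y ε w : ℝ} (hr : 0 < r) (hε : 0 < ε)
    (hy : 1 ≤ y)
    (hk : n.choose r * Real.exp (-(ε / (1 + ε) * (r : ℝ) ^ 2 / n.choose (r - 1) * k)) ≤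
      (1 + ε) * n.choose (r - 1) / r) :
    (((stableSets (Fin n) r).filter fun W ↦ (W.card : ℝ) ≤ w).card : ℝ) ≤
      y ^ k * (1 + y⁻¹) ^ (n.choose r) *
        (9 ^ w * (10 / 9 : ℝ) ^ ((1 + ε) * n.choose (r - 1) / r + k)) := by
  classical
  have hr0 : (0 : ℝ) < r := by exact_mod_cast hr
  have hP : (powersetCard (r - 1) (univ : Finset (Fin n))).card = n.choose (r - 1) := by
    rw [card_powersetCard, card_univ, Fintype.card_fin]
  have hlay : (layer (Fin n) r).card = n.choose r := by
    rw [card_powersetCard, card_univ, Fintype.card_fin]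
  obtain ⟨𝒞, h1, h2, h3⟩ := exists_packing_containers
    (fun X : Finset (Fin n) ↦ powersetCard (r - 1) X)
    (P := powersetCard (r - 1) (univ : Finset (Fin n))) (k := k) hr0 hε hy (U := layer (Fin n) r)
    (fun X _ ↦ powersetCard_mono (subset_univ _))
    (fun X hX ↦ by
      rw [card_powersetCard, mem_layer.1 hX, Nat.choose_symm (by omega), Nat.choose_one_right])
    -- Linearity of the shadow system: distinct `r`-sets share at most one `(r - 1)`-subset.
    -- Nonadjacent ones share none, so stable sets are packings of shadows.
    (fun X hX Y hY hne ↦ by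
      rw [card_le_one]
      intro I hI J hJ
      rw [mem_inter, mem_powersetCard, mem_powersetCard] at hI hJ
      have h1 := subset_inter hI.1.1 hI.2.1
      have h2 := subset_inter hJ.1.1 hJ.2.1
      have hXc := mem_layer.1 hX
      have hYc := mem_layer.1 hY
      have h3 : (X ∩ Y).card ≤ r - 1 := by
        by_contra h
        have h4 := card_le_card (inter_subset_left (s₁ := X) (s₂ := Y))
        have e1 := eq_of_subset_of_card_le (inter_subset_left (s₁ := X) (s₂ := Y)) (by omega)
        have e2 := eq_of_subset_of_card_le (inter_subset_right (s₁ := X) (s₂ := Y)) (by omega)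
        exact hne (e2.symm.trans e1)
      rw [eq_of_subset_of_card_le h1 (by omega), eq_of_subset_of_card_le h2 (by omega)])
    (by rw [hP, hlay, neg_mul]; exact hk)
  rw [hlay] at h1
  simp only [hP] at h2
  have hcov : ((stableSets (Fin n) r).filter fun W ↦ (W.card : ℝ) ≤ w) ⊆
      𝒞.biUnion fun C ↦ C.powerset.filter fun W ↦ (W.card : ℝ) ≤ w := by
    intro W hW
    obtain ⟨hW, hWw⟩ := mem_filter.1 hW
    obtain ⟨hW1, hW2⟩ := mem_stableSets.1 hW
    obtain ⟨C, hC, hWC⟩ := h3 W hW1 (fun X hX Y hY hne ↦ by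
      rw [disjoint_left]
      intro I hI hJ
      rw [mem_powersetCard] at hI hJ
      have h1 := card_le_card (subset_inter hI.1 hJ.1)
      have h2 := card_sdiff_add_card_inter X Y
      have hXc := mem_layer.1 (hW1 hX)
      have hYc := mem_layer.1 (hW1 hY)
      have h4 := hW2 X hX Y hY
      have h5 : (X \ Y).card = 0 := by omega
      rw [card_eq_zero, sdiff_eq_empty_iff_subset] at h5
      exact hne (eq_of_subset_of_card_le h5 (by omega)).symm)
    exact mem_biUnion.2 ⟨C, hC, mem_filter.2 ⟨mem_powerset.2 hWC, hWw⟩⟩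
  calc (((stableSets (Fin n) r).filter fun W ↦ (W.card : ℝ) ≤ w).card : ℝ)
      ≤ ∑ C ∈ 𝒞, ((C.powerset.filter fun W ↦ (W.card : ℝ) ≤ w).card : ℝ) := by
        exact_mod_cast (card_le_card hcov).trans card_biUnion_le
    _ ≤ 𝒞.card * (9 ^ w * (10 / 9 : ℝ) ^ ((1 + ε) * n.choose (r - 1) / r + k)) := by
        rw [← nsmul_eq_mul]
        refine sum_le_card_nsmul _ _ _ fun C hC ↦ ?_
        -- The weight `9` is close to optimal for subsets of size `scale n / 5` in containers of
        -- size `9 / 4 * scale n`.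
        refine (card_filter_powerset_le (y := 9) (by norm_num) C).trans ?_
        gcongr
        rw [show (1 + 9⁻¹ : ℝ) = 10 / 9 by norm_num, ← Real.rpow_natCast]
        exact Real.rpow_le_rpow_of_exponent_le (by norm_num) (h2 C hC)
    _ ≤ _ := by gcongr

/-- The isolated members of a family of `r`-sets. -/
def isolated (K : Finset (Finset α)) : Finset (Finset α) := {X ∈ K | ∀ Y ∈ K, (X \ Y).card ≠ 1}

/-- Few families of nonbases with few isolated members are encoded relative to a small known
part. -/
theorem card_encoded_le_of_small {n r B m : ℕ} {y w : ℝ} (hy : 1 ≤ y) (hm : 0 < m)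
    {𝓚 : Finset (Finset (Fin n))} {𝒦 : Finset (Finset (Finset (Fin n)))}
    (h𝒦 : ∀ K ∈ 𝒦, (∃ S, Encodes r B m 𝓚 K S) ∧ ((isolated K).card : ℝ) ≤ w) :
    (𝒦.card : ℝ) ≤ y ^ (2 * 𝓚.card / m : ℝ) * (1 + y⁻¹) ^ (2 ^ n) *
      ((stableSets (Fin n) r).filter fun W ↦ (W.card : ℝ) ≤ w).card := by
  classical
  have hm0 : (0 : ℝ) < m := by exact_mod_cast hm
  have h𝒦' := fun K hK ↦ (h𝒦 K hK).1
  choose! S hS using h𝒦'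
  -- The members of `S K` that produce no item. They are isolated nonbases; the other members lie in
  -- the cliques of the items and need not be recorded.
  let W : Finset (Finset (Fin n)) → Finset (Finset (Fin n)) := fun K ↦
    (S K).filter fun X ↦ coloopsIn 𝓚 B X = ∅ ∧ spannedIn 𝓚 B X = ∅
  -- The tagged traces are disjoint sets of size at least `m` inside two copies of `𝓚`.
  have hitem : ∀ K ∈ 𝒦, ((items B 𝓚 (S K)).card : ℝ) ≤ 2 * 𝓚.card / m := by
    intro K hK
    rw [le_div_iff₀ hm0]
    have h1 : ((items B 𝓚 (S K)).biUnion (taggedTrace r B 𝓚)) ⊆ 𝓚 ×ˢ (univ : Finset Bool) := by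
      intro p hp
      obtain ⟨G, -, hp⟩ := mem_biUnion.1 hp
      exact mem_product.2 ⟨(mem_trace.1 (mem_taggedTrace.1 hp).1).1, mem_univ _⟩
    have h2 := card_le_card h1
    rw [card_biUnion (hS K hK).disjoint_taggedTrace, card_product, card_univ,
      Fintype.card_bool] at h2
    have h3 := card_nsmul_le_sum (items B 𝓚 (S K)) (fun G ↦ (taggedTrace r B 𝓚 G).card) m
      (fun G hG ↦ by rw [card_taggedTrace]; exact (hS K hK).le_card_trace G hG)
    rw [smul_eq_mul] at h3
    have h4 : (items B 𝓚 (S K)).card * m ≤ 2 * 𝓚.card := by omega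
    exact_mod_cast h4
  let Φ : Finset (Finset (Fin n)) → Finset (Finset (Fin n)) × Finset (Finset (Fin n)) :=
    fun K ↦ (items B 𝓚 (S K), W K)
  have hK : ∀ K ∈ 𝒦, forced r B 𝓚 ((Φ K).2 ∪ ((Φ K).1.biUnion (clique r) \ 𝓚)) = K := by
    intro K hK
    have hE := hS K hK
    refine hE.forced_eq _ ?_ (union_subset_union (filter_subset _ _) subset_rfl)
    intro X hX
    have hX𝓚 : X ∉ 𝓚 := fun h ↦ disjoint_left.1 hE.disjoint hX h
    have hXc := mem_layer.1 (hE.subset_layer hX)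
    by_cases h1 : coloopsIn 𝓚 B X = ∅
    · by_cases h2 : spannedIn 𝓚 B X = ∅
      · exact mem_union_left _ (mem_filter.2 ⟨hX, h1, h2⟩)
      · obtain ⟨x, hx⟩ := nonempty_iff_ne_empty.2 h2
        exact mem_union_right _ (Finset.mem_sdiff.2 ⟨mem_biUnion.2
          ⟨insert x X, mem_items.2 ⟨X, hX, Or.inr ⟨x, hx, rfl⟩⟩, mem_clique_insert hXc x⟩, hX𝓚⟩)
    · obtain ⟨x, hx⟩ := nonempty_iff_ne_empty.2 h1
      exact mem_union_right _ (Finset.mem_sdiff.2 ⟨mem_biUnion.2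
        ⟨X.erase x, mem_items.2 ⟨X, hX, Or.inl ⟨x, hx, rfl⟩⟩, mem_clique_erase hXc x⟩, hX𝓚⟩)
  have hinj : Set.InjOn Φ 𝒦 := fun K h K' h' he ↦ by rw [← hK K h, ← hK K' h', he]
  let A : Finset (Finset (Finset (Fin n))) :=
    (univ : Finset (Finset (Fin n))).powerset.filter fun T ↦ (T.card : ℝ) ≤ 2 * 𝓚.card / m
  let D := (stableSets (Fin n) r).filter fun W ↦ (W.card : ℝ) ≤ w
  have hcard : 𝒦.card ≤ (A ×ˢ D).card := by
    refine card_le_card_of_injOn Φ (fun K hK ↦ ?_) hinj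
    have hE := hS K hK
    refine mem_coe.2 (mem_product.2 ⟨mem_filter.2 ⟨mem_powerset.2 (subset_univ _), hitem K hK⟩,
      mem_filter.2 ⟨mem_stableSets.2 ⟨(filter_subset _ _).trans hE.subset_layer, ?_⟩, ?_⟩⟩)
    · exact fun X hX Y hY ↦ hE.stable X (mem_filter.1 hX).1 Y (mem_filter.1 hY).1
    · refine le_trans ?_ (h𝒦 K hK).2
      have : W K ⊆ isolated K := fun X hX ↦ by
        obtain ⟨h1, h2, h3⟩ := mem_filter.1 hX
        exact mem_filter.2 (hE.isolated X h1 h2 h3)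
      exact_mod_cast card_le_card this
  have hA : (A.card : ℝ) ≤ y ^ (2 * 𝓚.card / m : ℝ) * (1 + y⁻¹) ^ (2 ^ n) := by
    have := card_filter_powerset_le (w := 2 * 𝓚.card / m) hy (univ : Finset (Finset (Fin n)))
    rwa [card_univ, Fintype.card_finset, Fintype.card_fin] at this
  calc (𝒦.card : ℝ) ≤ A.card * D.card := by rw [card_product] at hcard; exact_mod_cast hcard
    _ ≤ _ := by gcongr

end Counting

/-! ### From matroids to rank functions -/

section RankFunction

variable {α : Type*} [Finite α]

theorem coe_toNat_eRk (M : Matroid α) (X : Set α) : ((M.eRk X).toNat : ℕ∞) = M.eRk X :=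
  ENat.natCast_toNat (((M.eRk_le_encard X).trans_lt (Set.toFinite X).encard_lt_top).ne)

theorem coe_rank (M : Matroid α) : (rank M : ℕ∞) = M.eRank := by
  rw [rank, ← M.eRk_ground]
  exact coe_toNat_eRk M _

variable [DecidableEq α]

/-- The rank function of a matroid on a finite type. -/
noncomputable def rankFunction (M : Matroid α) : RankFunction α where
  rk S := (M.eRk S).toNat
  rk_empty := by simp
  mono S T h := by
    have := M.eRk_mono (coe_subset.2 h)
    rw [← coe_toNat_eRk M S, ← coe_toNat_eRk M T] at this
    exact_mod_cast this
  rk_insert_le x S := by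
    have := M.eRk_insert_le_add_one x S
    rw [← coe_insert, ← coe_toNat_eRk M S, ← coe_toNat_eRk M (insert x S : Finset α)] at this
    exact_mod_cast this
  submod S T := by
    have := M.eRk_inter_add_eRk_union_le S T
    rw [← coe_inter, ← coe_union, ← coe_toNat_eRk M S, ← coe_toNat_eRk M T,
      ← coe_toNat_eRk M (S ∩ T : Finset α), ← coe_toNat_eRk M (S ∪ T : Finset α)] at this
    have h : (M.eRk (S ∩ T : Finset α)).toNat + (M.eRk (S ∪ T : Finset α)).toNat ≤
      (M.eRk S).toNat + (M.eRk T).toNat := by exact_mod_cast this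
    rwa [add_comm] at h

theorem coe_rk (M : Matroid α) (X : Finset α) : ((rankFunction M).rk X : ℕ∞) = M.eRk X :=
  coe_toNat_eRk M X

end RankFunction

theorem circuitHyperplanes_subset_nonBases {α : Type*} (M : Matroid α) :
    circuitHyperplanes M ⊆ nonBases M := fun _ hX ↦
  ⟨hX.1.dep, by rw [← hX.1.eRk_add_one_eq, hX.2.2]⟩

theorem w_le_d {α : Type*} [Finite α] (M : Matroid α) : w M ≤ d M := by
  rw [w, d]
  gcongr
  · exact Set.toFinite _
  · exact circuitHyperplanes_subset_nonBases M

/-! ### Nonbases, circuit-hyperplanes and sparse paving matroids -/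

section Nonbases

variable {α : Type*} [Fintype α] [DecidableEq α]

/-- The `r`-sets that are not bases, where `r` is the rank. -/
noncomputable def nonbasesOf (M : Matroid α) : Finset (Finset α) :=
  (rankFunction M).nonbases (rank M)

variable {M M' : Matroid α} {X : Finset α}

theorem isBase_iff : M.IsBase X ↔ X.card = rank M ∧ X ∉ nonbasesOf M := by
  rw [nonbasesOf, RankFunction.mem_nonbases]
  constructor
  · intro h
    have h1 := h.encard_eq_eRank
    have h2 := h.eRk_eq_eRank
    rw [Set.encard_coe_eq_coe_finsetCard, ← coe_rank] at h1
    rw [← coe_rk, ← coe_rank] at h2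
    exact ⟨by exact_mod_cast h1, fun h' ↦ h'.2.ne (by exact_mod_cast h2)⟩
  · rintro ⟨h1, h2⟩
    have h3 : rank M ≤ (rankFunction M).rk X := by by_contra! h; exact h2 ⟨h1, h⟩
    have h4 : M.eRank ≤ M.eRk X := by
      rw [← coe_rk, ← coe_rank]; exact_mod_cast h3
    have hX : (X : Set α).encard ≤ M.eRk X := by
      rw [Set.encard_coe_eq_coe_finsetCard, ← coe_rk, h1]; exact_mod_cast h3
    exact ((M.isRkFinite_set X).indep_of_encard_le_eRk hX).isBase_of_eRk_ge (Set.toFinite _) h4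

theorem eq_of_nonbasesOf_eq (hM : M.E = Set.univ) (hM' : M'.E = Set.univ)
    (hr : rank M = rank M') (h : nonbasesOf M = nonbasesOf M') : M = M' := by
  refine Matroid.ext_isBase (hM.trans hM'.symm) fun B _ ↦ ?_
  obtain ⟨X, rfl⟩ : ∃ X : Finset α, ↑X = B := ⟨(Set.toFinite B).toFinset, by simp⟩
  rw [isBase_iff, isBase_iff, hr, h]

theorem card_of_mem_nonbasesOf (hX : X ∈ nonbasesOf M) : X.card = rank M :=
  (RankFunction.mem_nonbases _).1 hX |>.1

/-- Every exchange of an isolated nonbase gives a base. Hence each `X \ {x}` is independent, which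
makes `X` a circuit, and adding any outside element spans, which makes `X` a hyperplane. -/
theorem mem_circuitHyperplanes_of_mem_isolated (hM : M.E = Set.univ)
    (hX : X ∈ isolated (nonbasesOf M)) : (X : Set α) ∈ circuitHyperplanes M := by
  obtain ⟨hX, hiso⟩ := mem_filter.1 hX
  obtain ⟨hXc, hXr⟩ := (RankFunction.mem_nonbases _).1 hX
  have hswap : ∀ x ∈ X, ∀ y ∉ X, M.IsBase (swap X x y : Finset α) := fun x hx y hy ↦ by
    refine (isBase_iff).2 ⟨(card_swap hx hy).trans hXc, fun h ↦ hiso _ h ?_⟩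
    rw [sdiff_swap hx hy, card_singleton]
  obtain ⟨x₀, hx₀⟩ : X.Nonempty := card_pos.1 (by omega)
  obtain ⟨y₀, hy₀⟩ : ∃ y, y ∉ X := by
    by_contra! hcon
    have h1 : (X : Set α) = M.E := by rw [hM]; exact Set.eq_univ_of_forall hcon
    have h2 : M.eRk X = M.eRank := by rw [h1, M.eRk_ground]
    rw [← coe_rk, ← coe_rank] at h2
    exact hXr.ne (by exact_mod_cast h2)
  have herase : ∀ x ∈ X, M.Indep ((X : Set α) \ {x}) := fun x hx ↦ by
    rw [← coe_erase]
    refine (hswap x hx y₀ hy₀).indep.subset (coe_subset.2 (subset_insert _ _))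
  have hrk : (rankFunction M).rk X + 1 = rank M := by
    have h1 := (herase x₀ hx₀).eRk_eq_encard
    rw [← coe_erase, ← coe_rk, Set.encard_coe_eq_coe_finsetCard, card_erase_of_mem hx₀] at h1
    have h2 : (rankFunction M).rk (X.erase x₀) = X.card - 1 := by exact_mod_cast h1
    have h3 := (rankFunction M).mono _ _ (erase_subset x₀ X)
    omega
  have hdep : M.Dep X := by
    rw [← Matroid.not_indep_iff (by rw [hM]; exact Set.subset_univ _)]
    intro h
    have h1 := h.eRk_eq_encard
    rw [← coe_rk, Set.encard_coe_eq_coe_finsetCard] at h1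
    have h2 : (rankFunction M).rk X = X.card := by exact_mod_cast h1
    omega
  refine ⟨Matroid.isCircuit_iff_dep_forall_sdiff_singleton_indep.2 ⟨hdep, herase⟩,
    ⟨fun I Y hIX hIY ↦ ?_, by rw [hM]; exact Set.subset_univ _⟩, ?_⟩
  · intro y hy
    by_contra hyX
    have h1 : M.eRk (insert y (X : Set α)) = M.eRk X := by
      rw [← hIX.eRk_eq_eRk_insert, hIY.eRk_eq_eRk_insert, Set.insert_eq_of_mem hy,
        ← hIY.eRk_eq_eRk, hIX.eRk_eq_eRk]
    have h2 : M.eRank ≤ M.eRk (insert y (X : Set α)) := by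
      rw [← (hswap x₀ hx₀ y hyX).eRk_eq_eRank, ← coe_insert]
      exact M.eRk_mono (coe_subset.2 (insert_subset_insert _ (erase_subset _ _)))
    rw [h1, ← coe_rk, ← coe_rank] at h2
    have h3 : rank M ≤ (rankFunction M).rk X := by exact_mod_cast h2
    omega
  · rw [← coe_rk, ← coe_rank]; exact_mod_cast hrk

theorem card_isolated_le (hM : M.E = Set.univ) :
    (isolated (nonbasesOf M)).card ≤ (circuitHyperplanes M).ncard := by
  rw [← Set.ncard_coe_finset]
  exact Set.ncard_le_ncard_of_injOn (fun X : Finset α ↦ (X : Set α))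
    (fun X hX ↦ mem_circuitHyperplanes_of_mem_isolated hM hX) (coe_injective.injOn) (Set.toFinite _)

/-- A stable family of `r`-sets is the set of nonbases of a matroid. -/
theorem exists_matroid_of_isStable {r : ℕ} (hr : 0 < r) (hrn : r < Fintype.card α)
    {S : Finset (Finset α)} (hS : IsStable S) :
    ∃ M : Matroid α, M.E = Set.univ ∧ ∀ X : Finset α, M.IsBase X ↔ X.card = r ∧ X ∉ S := by
  -- Two exchanges of `a` for different elements give adjacent sets, so at most one of them is in
  -- `S`. The exchange property then needs care only when `Y \ X` has one element, and there the
  -- exchange produces `Y` itself.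
  have hpair : ∀ X : Finset α, ∀ a ∈ X, ∀ b ∉ X, ∀ c ∉ X, b ≠ c →
      swap X a b ∉ S ∨ swap X a c ∉ S := by
    intro X a ha b hb c hc hbc
    by_contra! h
    refine hS _ h.1 _ h.2 ?_
    have : swap X a b \ swap X a c = {b} := by
      ext z
      simp only [swap, Finset.mem_sdiff, mem_insert, mem_erase, mem_singleton]
      constructor
      · tauto
      · rintro rfl; tauto
    rw [this, card_singleton]
  let P : Set α → Prop := fun B ↦ ∃ X : Finset α, ↑X = B ∧ X.card = r ∧ X ∉ S
  have hP : ∀ X : Finset α, P X ↔ X.card = r ∧ X ∉ S := fun X ↦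
    ⟨fun ⟨Y, h, hY⟩ ↦ by rwa [← coe_injective h], fun h ↦ ⟨X, rfl, h⟩⟩
  have hex : ∃ B, P B := by
    obtain ⟨X, -, hX⟩ := exists_subset_card_eq (s := (univ : Finset α)) (n := r)
      (by rw [card_univ]; exact hrn.le)
    obtain ⟨a, ha⟩ : X.Nonempty := card_pos.1 (by omega)
    obtain ⟨b, hb⟩ : ∃ b, b ∉ X := by
      by_contra! h
      rw [eq_univ_of_forall h, card_univ] at hX
      omega
    by_cases hXS : X ∈ S
    · refine ⟨_, (hP (swap X a b)).2 ⟨(card_swap ha hb).trans hX, fun h ↦ hS _ hXS _ h ?_⟩⟩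
      rw [sdiff_swap ha hb, card_singleton]
    · exact ⟨_, (hP X).2 ⟨hX, hXS⟩⟩
  have hexch : Matroid.ExchangeProperty P := by
    rintro _ _ ⟨X, rfl, hX, hXS⟩ ⟨Y, rfl, hY, hYS⟩ a ha
    rw [← coe_sdiff, mem_coe, Finset.mem_sdiff] at ha
    have key : ∃ b ∈ Y \ X, swap X a b ∉ S := by
      have hcard : (Y \ X).card = (X \ Y).card := card_sdiff_comm (hY.trans hX.symm)
      have hpos : 0 < (Y \ X).card := by
        rw [hcard]; exact card_pos.2 ⟨a, Finset.mem_sdiff.2 ha⟩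
      rcases Nat.lt_or_ge 1 (Y \ X).card with h | h
      · obtain ⟨b, hb, c, hc, hbc⟩ := one_lt_card.1 h
        rcases hpair X a ha.1 b (Finset.mem_sdiff.1 hb).2 c (Finset.mem_sdiff.1 hc).2 hbc with h | h
        exacts [⟨b, hb, h⟩, ⟨c, hc, h⟩]
      · obtain ⟨b, hb⟩ := card_eq_one.1 (le_antisymm h hpos)
        have hb' : b ∈ Y \ X := by rw [hb]; exact mem_singleton_self b
        refine ⟨b, hb', ?_⟩
        have hsub : Y ⊆ swap X a b := by
          intro z hz
          by_cases hzX : z ∈ X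
          · refine mem_insert_of_mem (mem_erase.2 ⟨?_, hzX⟩)
            rintro rfl; exact ha.2 hz
          · have : z ∈ Y \ X := Finset.mem_sdiff.2 ⟨hz, hzX⟩
            rw [hb, mem_singleton] at this
            exact this ▸ mem_insert_self _ _
        rwa [← eq_of_subset_of_card_le hsub
          (by rw [card_swap ha.1 (Finset.mem_sdiff.1 hb').2, hX, hY])]
    obtain ⟨b, hb, hbS⟩ := key
    refine ⟨b, by rwa [← coe_sdiff], ?_⟩
    rw [← coe_erase, ← coe_insert]
    exact (hP (swap X a b)).2 ⟨(card_swap ha.1 (Finset.mem_sdiff.1 hb).2).trans hX, hbS⟩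
  exact ⟨Matroid.ofIsBaseOfFinite Set.finite_univ P hex hexch fun _ _ ↦ Set.subset_univ _, rfl, hP⟩

end Nonbases

theorem finite_matroidsOn (n : ℕ) : (matroidsOn n).Finite :=
  haveI := finite_matroid (Fin n)
  Set.toFinite _

theorem card_stableSets_le_ncard {n r : ℕ} (hr : 0 < r) (hrn : r < n) :
    (stableSets (Fin n) r).card ≤ (matroidsOn n).ncard := by
  have h : ∀ S : Finset (Finset (Fin n)), ∃ M : Matroid (Fin n), S ∈ stableSets (Fin n) r →
      M.E = Set.univ ∧ ∀ X : Finset (Fin n), M.IsBase X ↔ X.card = r ∧ X ∉ S := fun S ↦ by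
    by_cases hS : S ∈ stableSets (Fin n) r
    · obtain ⟨M, hM⟩ := exists_matroid_of_isStable hr (by rwa [Fintype.card_fin])
        (mem_stableSets.1 hS).2
      exact ⟨M, fun _ ↦ hM⟩
    · exact ⟨Matroid.emptyOn _, fun h ↦ absurd h hS⟩
  choose f hf using h
  rw [← Set.ncard_coe_finset]
  refine Set.ncard_le_ncard_of_injOn f (fun S hS ↦ (hf S hS).1) (fun S hS T hT h ↦ ?_)
    (finite_matroidsOn n)
  have hiff : ∀ X : Finset (Fin n), X.card = r → (X ∈ S ↔ X ∈ T) := fun X hX ↦ by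
    have h1 := (hf S hS).2 X
    have h2 := (hf T hT).2 X
    rw [h] at h1
    tauto
  ext X
  have hS' := (mem_stableSets.1 hS).1
  have hT' := (mem_stableSets.1 hT).1
  exact ⟨fun hX ↦ (hiff X (mem_layer.1 (hS' hX))).1 hX,
    fun hX ↦ (hiff X (mem_layer.1 (hT' hX))).2 hX⟩

/-- All subsets of one Graham–Sloane colour class are stable. -/
theorem exists_two_pow_le_card_stableSets {n : ℕ} (hn : 0 < n) (r : ℕ) :
    ∃ q, n.choose r ≤ n * q ∧ 2 ^ q ≤ (stableSets (Fin n) r).card := by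
  obtain ⟨Q, hQ, hst, hcard⟩ := exists_stable_subset hn (Subset.refl (layer (Fin n) r))
  refine ⟨Q.card, ?_, ?_⟩
  · rwa [layer, card_powersetCard, card_univ, Fintype.card_fin] at hcard
  · rw [← card_powerset]
    refine card_le_card fun S hS ↦ mem_stableSets.2 ⟨(mem_powerset.1 hS).trans hQ, ?_⟩
    exact fun X hX Y hY ↦ hst X (mem_powerset.1 hS hX) Y (mem_powerset.1 hS hY)

theorem ncard_le_card_of_nonbasesOf_mem {n r : ℕ} {𝓜 : Set (Matroid (Fin n))}
    {𝒦 : Finset (Finset (Finset (Fin n)))}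
    (h : ∀ M ∈ 𝓜, M.E = Set.univ ∧ rank M = r ∧ nonbasesOf M ∈ 𝒦) : 𝓜.ncard ≤ 𝒦.card := by
  rw [← Set.ncard_coe_finset 𝒦]
  exact Set.ncard_le_ncard_of_injOn nonbasesOf (fun M hM ↦ (h M hM).2.2)
    (fun M hM M' hM' he ↦ eq_of_nonbasesOf_eq (h M hM).1 (h M' hM').1
      ((h M hM).2.1.trans (h M' hM').2.1.symm) he) (Set.toFinite _)

theorem ncard_rank_le (n r : ℕ) :
    {M ∈ matroidsOn n | rank M = r}.ncard ≤ 2 ^ n.choose r := by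
  have h := ncard_le_card_of_nonbasesOf_mem (r := r) (𝓜 := {M ∈ matroidsOn n | rank M = r})
    (𝒦 := (layer (Fin n) r).powerset) fun M hM ↦ ⟨hM.1, hM.2, mem_powerset.2 fun X hX ↦
      mem_layer.2 ((card_of_mem_nonbasesOf hX).trans hM.2)⟩
  rwa [card_powerset, layer, card_powersetCard, card_univ, Fintype.card_fin] at h

/-! ### Binomial estimates and assembly of the matroid count -/

theorem choose_le_two_pow_mul_exp {n : ℕ} (hn : 0 < n) (k : ℕ) :
    (n.choose k : ℝ) ≤ 2 ^ n * Real.exp (-((2 * k - n : ℝ) ^ 2 / (2 * n))) := by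
  have hn0 : (0 : ℝ) < n := by exact_mod_cast hn
  rcases lt_or_ge n k with hk | hk
  · rw [Nat.choose_eq_zero_of_lt hk]; push_cast; positivity
  -- Chernoff's method with the tilt that minimises `n * l ^ 2 / 2 - l * (2 * k - n)`.
  set l : ℝ := (2 * k - n) / n with hl
  have h1 : (n.choose k : ℝ) * Real.exp (l * (2 * k - n)) ≤ (Real.exp l + Real.exp (-l)) ^ n := by
    rw [add_pow]
    refine le_trans (le_of_eq ?_) (single_le_sum
      (f := fun j ↦ Real.exp l ^ j * Real.exp (-l) ^ (n - j) * (n.choose j : ℝ))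
      (fun j _ ↦ by positivity) (mem_range.2 (Nat.lt_succ_of_le hk)))
    rw [← Real.exp_nat_mul, ← Real.exp_nat_mul, ← Real.exp_add, Nat.cast_sub hk, mul_comm]
    congr 2
    ring
  have h2 : (Real.exp l + Real.exp (-l)) ^ n ≤ 2 ^ n * Real.exp (n * (l ^ 2 / 2)) := by
    rw [Real.exp_nat_mul, ← mul_pow]
    refine pow_le_pow_left₀ (by positivity) ?_ n
    have := Real.cosh_le_exp_half_sq l
    rw [Real.cosh_eq] at this
    linarith
  have h3 : (n.choose k : ℝ) = n.choose k * Real.exp (l * (2 * k - n)) *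
      Real.exp (-(l * (2 * k - n))) := by
    rw [mul_assoc, ← Real.exp_add, add_neg_cancel, Real.exp_zero, mul_one]
  rw [h3]
  calc _ ≤ 2 ^ n * Real.exp (n * (l ^ 2 / 2)) * Real.exp (-(l * (2 * k - n))) :=
        mul_le_mul_of_nonneg_right (h1.trans h2) (Real.exp_pos _).le
    _ = _ := by
        rw [mul_assoc, ← Real.exp_add]
        congr 2
        rw [hl]
        field_simp
        ring

theorem two_pow_le_mul_choose (n : ℕ) : 2 ^ n ≤ (n + 1) * n.choose (n / 2) := by
  rw [← Nat.sum_range_choose]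
  refine (sum_le_card_nsmul _ _ _ fun k _ ↦ Nat.choose_le_middle k n).trans ?_
  rw [card_range, smul_eq_mul]

theorem RankFunction.certificate_certified {α : Type*} [DecidableEq α] [Fintype α]
    {ρ : RankFunction α} {r B θ m : ℕ} {𝓕 : Finset (Finset α)}
    (h1 : certified r 𝓕 ⊆ ρ.nonbases r)
    (h2 : ∀ X ∈ ρ.nonbases r, X ∉ certified r 𝓕 →
      ρ.rk X + 1 = r ∧ (ρ.coloops X).card < B ∧ (ρ.spanned X).card < B)
    (h3 : ∀ G ∈ ρ.full r, (clique r G \ certified r 𝓕).card < θ)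
    (hr : m + B + θ ≤ r) (hr' : m + B + θ + r ≤ Fintype.card α) :
    ρ.Certificate r B θ (m := m) (certified r 𝓕) where
  subset := h1
  rk_eq X hX hX' := (h2 X hX hX').1
  coloops_lt X hX hX' := (h2 X hX hX').2.1
  spanned_lt X hX hX' := (h2 X hX hX').2.2
  covered := h3
  le_rank := hr
  le_corank := hr'

/-- A bound for the number of matroids of rank `r` with few circuit-hyperplanes, given a bound for
the number of encoded families relative to each known part. -/
theorem ncard_few_circuitHyperplanes_le {n r B θ m : ℕ} {y t v R : ℝ} (hB : 2 ≤ B) (hθ : 0 < θ)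
    (hr : m + B + θ ≤ r) (hr' : m + B + θ + r ≤ n) (hy : 1 ≤ y)
    (ht : (n.choose (r - B) + n.choose (r + B) + n.choose r * B / ((r - B) * (n - r - B)) +
      n.choose r * (r * B) / (θ * ((r - B) * (n - r - B))) : ℝ) ≤ t)
    (hR : ∀ (𝓚 : Finset (Finset (Fin n))) (𝒦 : Finset (Finset (Finset (Fin n)))),
      𝓚 ⊆ layer (Fin n) r →
      (∀ K ∈ 𝒦, (∃ S, Encodes r B m 𝓚 K S) ∧ ((isolated K).card : ℝ) ≤ v) → (𝒦.card : ℝ) ≤ R) :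
    ({M ∈ matroidsOn n | rank M = r ∧ ((circuitHyperplanes M).ncard : ℝ) ≤ v}.ncard : ℝ) ≤
      y ^ t * (1 + y⁻¹) ^ (2 ^ n) * R := by
  classical
  set 𝔽 := ((univ : Finset (Finset (Fin n))).powerset.filter fun 𝓕 ↦ (𝓕.card : ℝ) ≤ t) with h𝔽
  let fam : Finset (Finset (Fin n)) → Finset (Finset (Finset (Fin n))) := fun 𝓕 ↦
    {K ∈ (layer (Fin n) r).powerset |
      (∃ S, Encodes r B m (certified r 𝓕) K S) ∧ ((isolated K).card : ℝ) ≤ v}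
  have hfam : ∀ 𝓕, ((fam 𝓕).card : ℝ) ≤ R := fun 𝓕 ↦
    hR (certified r 𝓕) _ (filter_subset _ _) fun K hK ↦ (mem_filter.1 hK).2
  have h0R : 0 ≤ R := (Nat.cast_nonneg _).trans (hfam ∅)
  have hcount := card_filter_powerset_le (w := t) hy (univ : Finset (Finset (Fin n)))
  rw [card_univ, Fintype.card_finset, Fintype.card_fin, ← h𝔽] at hcount
  refine le_trans ?_ (mul_le_mul_of_nonneg_right hcount h0R)
  have hmain : {M ∈ matroidsOn n | rank M = r ∧ ((circuitHyperplanes M).ncard : ℝ) ≤ v}.ncard ≤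
      (𝔽.biUnion fam).card := by
    refine ncard_le_card_of_nonbasesOf_mem (r := r) ?_
    rintro M ⟨hM, hMr, hMv⟩
    refine ⟨hM, hMr, ?_⟩
    obtain ⟨𝓕, z, g, hcard, hz, hg, hsub, hrest, hfull⟩ :=
      (rankFunction M).exists_certificate hB (show B ≤ r by omega) hθ
    rw [Fintype.card_fin] at hcard hz hg
    have hnb : nonbasesOf M = (rankFunction M).nonbases r := by rw [nonbasesOf, hMr]
    have hcert := RankFunction.certificate_certified (m := m) hsub hrest hfull hr
      (by rwa [Fintype.card_fin])
    refine mem_biUnion.2 ⟨𝓕, mem_filter.2 ⟨mem_powerset.2 (subset_univ _), le_trans ?_ ht⟩,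
      mem_filter.2 ⟨mem_powerset.2 ?_, ?_, ?_⟩⟩
    · have e1 : (((r - B : ℕ)) : ℝ) = r - B := Nat.cast_sub (by omega)
      have e2 : (((n - r - B : ℕ)) : ℝ) = n - r - B := by
        rw [Nat.cast_sub (by omega), Nat.cast_sub (by omega)]
      have p1 : (0 : ℝ) < r - B := by rw [← e1]; exact_mod_cast (by omega : 0 < r - B)
      have p2 : (0 : ℝ) < n - r - B := by rw [← e2]; exact_mod_cast (by omega : 0 < n - r - B)
      have p3 : (0 : ℝ) < θ := by exact_mod_cast hθ
      have hz' : (z : ℝ) ≤ n.choose r * B / ((r - B) * (n - r - B)) := by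
        rw [le_div_iff₀ (by positivity), ← e1, ← e2]
        exact_mod_cast hz
      have hg' : (g : ℝ) ≤ n.choose r * (r * B) / (θ * ((r - B) * (n - r - B))) := by
        rw [le_div_iff₀ (by positivity), ← e1, ← e2, ← mul_assoc]
        exact_mod_cast hg
      have hc' : (𝓕.card : ℝ) ≤ n.choose (r - B) + n.choose (r + B) + z + g := by
        exact_mod_cast hcard
      linarith
    · rw [hnb]; exact filter_subset _ _
    · rw [hnb]; exact hcert.exists_encodes
    · exact le_trans (by exact_mod_cast card_isolated_le hM) hMv
  calc ({M ∈ matroidsOn n | rank M = r ∧ ((circuitHyperplanes M).ncard : ℝ) ≤ v}.ncard : ℝ)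
      ≤ ((𝔽.biUnion fam).card : ℝ) := by exact_mod_cast hmain
    _ ≤ ∑ 𝓕 ∈ 𝔽, ((fam 𝓕).card : ℝ) := by exact_mod_cast card_biUnion_le
    _ ≤ 𝔽.card * R := by
        rw [← nsmul_eq_mul]
        exact sum_le_card_nsmul _ _ _ fun 𝓕 _ ↦ hfam 𝓕

/-! ### Asymptotic estimates -/

/-- The largest binomial coefficient divided by `n`, the scale of the logarithm of the number of
matroids. -/
noncomputable def scale (n : ℕ) : ℝ := n.choose (n / 2) / n

/-- `n` is large, with `q` its fourth root and `L` its logarithm. -/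
structure IsLarge (n : ℕ) (q L : ℝ) : Prop where
  pow_root : q ^ 4 = n
  exp_log : Real.exp L = n
  le_log : 2 ^ 60 ≤ L
  le_root : L ^ 6 ≤ q

theorem eventually_isLarge : ∀ᶠ n : ℕ in atTop, ∃ q L, IsLarge n q L := by
  -- `24 = 4 * 6`: the fourth root must dominate the sixth power of the logarithm.
  have h1 : ∀ᶠ x : ℝ in atTop, (Real.log x) ^ 24 ≤ x := by
    have := (Real.isLittleO_pow_log_id_atTop (n := 24)).bound one_pos
    filter_upwards [this, eventually_ge_atTop 1] with x hx h1
    rw [one_mul, id, Real.norm_of_nonneg (by positivity), Real.norm_of_nonneg (by positivity)] at hx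
    exact hx
  have h2 : ∀ᶠ x : ℝ in atTop, 2 ^ 60 ≤ Real.log x :=
    Real.tendsto_log_atTop.eventually_ge_atTop _
  filter_upwards [tendsto_natCast_atTop_atTop.eventually h1,
    tendsto_natCast_atTop_atTop.eventually h2, eventually_gt_atTop 0] with n h1 h2 hn
  have hn0 : (0 : ℝ) < n := by exact_mod_cast hn
  have hq : ((n : ℝ) ^ (1 / 4 : ℝ)) ^ 4 = n := by
    rw [← Real.rpow_natCast, ← Real.rpow_mul hn0.le]; norm_num
  refine ⟨(n : ℝ) ^ (1 / 4 : ℝ), Real.log n, hq, Real.exp_log hn0, h2, ?_⟩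
  refine le_of_pow_le_pow_left₀ (n := 4) (by norm_num) (by positivity) ?_
  rw [hq, ← pow_mul]
  exact h1

namespace IsLarge

variable {n : ℕ} {q L : ℝ}

theorem log_ge_one (h : IsLarge n q L) : 1 ≤ L := le_trans (by norm_num) h.le_log

theorem log_pos (h : IsLarge n q L) : 0 < L := lt_of_lt_of_le one_pos h.log_ge_one

theorem log_le_root (h : IsLarge n q L) : L ≤ q :=
  (le_self_pow₀ h.log_ge_one (by norm_num)).trans h.le_root

theorem root_ge (h : IsLarge n q L) : 2 ^ 60 ≤ q := h.le_log.trans h.log_le_root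

theorem root_ge_one (h : IsLarge n q L) : 1 ≤ q := h.log_ge_one.trans h.log_le_root

theorem root_pos (h : IsLarge n q L) : 0 < q := lt_of_lt_of_le one_pos h.root_ge_one

theorem root_le (h : IsLarge n q L) : q ≤ n := by
  rw [← h.pow_root]
  exact le_self_pow₀ h.root_ge_one (by norm_num)

theorem ge_one (h : IsLarge n q L) : (1 : ℝ) ≤ n := h.root_ge_one.trans h.root_le

theorem cast_pos (h : IsLarge n q L) : (0 : ℝ) < n := lt_of_lt_of_le one_pos h.ge_one

theorem pos (h : IsLarge n q L) : 0 < n := by exact_mod_cast h.cast_pos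

theorem log_pow_le (h : IsLarge n q L) : L ^ 6 ≤ n := h.le_root.trans h.root_le

theorem exp_four_log (h : IsLarge n q L) : Real.exp (4 * L) = (n : ℝ) ^ 4 := by
  rw [show (4 : ℝ) * L = (4 : ℕ) * L by norm_num, Real.exp_nat_mul, h.exp_log]

theorem choose_eq (h : IsLarge n q L) : (n.choose (n / 2) : ℝ) = n * scale n := by
  rw [scale]; field_simp [h.cast_pos.ne']

theorem two_pow_le (h : IsLarge n q L) : (2 : ℝ) ^ n ≤ 2 * n ^ 2 * scale n := by
  have h1 : (2 : ℝ) ^ n ≤ (n + 1) * n.choose (n / 2) := by exact_mod_cast two_pow_le_mul_choose n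
  have h2 := h.ge_one
  have h3 : (0 : ℝ) ≤ n.choose (n / 2) := Nat.cast_nonneg _
  calc (2 : ℝ) ^ n ≤ (n + 1) * n.choose (n / 2) := h1
    _ ≤ (2 * n) * n.choose (n / 2) := by gcongr; linarith
    _ = _ := by rw [h.choose_eq]; ring

theorem le_scale (h : IsLarge n q L) : (n : ℝ) ≤ scale n := by
  have h1 := h.two_pow_le
  have hn := h.ge_one
  have hn0 := h.cast_pos
  have h2 : (n : ℝ) ^ 4 ≤ 2 ^ n := by
    rw [← h.exp_four_log, ← Real.exp_log (show (0 : ℝ) < 2 by norm_num), ← Real.exp_nat_mul]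
    apply Real.exp_le_exp.2
    have h3 := Real.log_two_gt_d9
    have h4 : 8 * L ≤ n := by
      have := h.root_ge
      have h5 : q * q ≤ n := by
        rw [← h.pow_root]
        nlinarith [pow_le_pow_right₀ h.root_ge_one (show 2 ≤ 4 by norm_num)]
      have h6 := h.log_le_root
      nlinarith
    nlinarith [Nat.cast_nonneg (α := ℝ) n]
  have h3 : 2 * (n : ℝ) ≤ n ^ 2 := by
    have : (2 : ℝ) ≤ n := le_trans (by norm_num) (h.root_ge.trans h.root_le)
    nlinarith
  have h4 : (n : ℝ) ^ 4 ≤ 2 * n ^ 2 * scale n := h2.trans h1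
  have h5 : (n : ℝ) ^ 2 ≤ 2 * scale n := by
    refine le_of_mul_le_mul_left ?_ (show (0 : ℝ) < n ^ 2 by positivity)
    linarith [show (n : ℝ) ^ 2 * n ^ 2 = n ^ 4 by ring, show
      (n : ℝ) ^ 2 * (2 * scale n) = 2 * n ^ 2 * scale n by ring]
  linarith

theorem scale_pos (h : IsLarge n q L) : 0 < scale n := h.cast_pos.trans_le h.le_scale

theorem two_pow_mul_exp_le (h : IsLarge n q L) :
    (2 : ℝ) ^ n * Real.exp (-(4 * L)) ≤ 2 * scale n / n ^ 2 := by
  have hn0 := h.cast_pos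
  rw [Real.exp_neg, h.exp_four_log, ← div_eq_mul_inv, div_le_div_iff₀ (by positivity)
    (by positivity)]
  calc (2 : ℝ) ^ n * n ^ 2 ≤ 2 * n ^ 2 * scale n * n ^ 2 := by gcongr; exact h.two_pow_le
    _ = _ := by ring

/-- With weight `y = n ^ 4` this factor of the counting bounds is negligible, as `2 ^ n / n ^ 4` is
at most `2 * scale n / n ^ 2`. -/
theorem one_add_inv_pow_le (h : IsLarge n q L) {j : ℕ} (hj : j ≤ 2 ^ n) :
    (1 + (Real.exp (4 * L))⁻¹) ^ j ≤ Real.exp (2 * scale n / n ^ 2) := by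
  calc (1 + (Real.exp (4 * L))⁻¹) ^ j ≤ Real.exp ((Real.exp (4 * L))⁻¹) ^ j := by
        gcongr
        rw [add_comm]
        exact Real.add_one_le_exp _
    _ = Real.exp (j * Real.exp (-(4 * L))) := by rw [← Real.exp_nat_mul, Real.exp_neg]
    _ ≤ Real.exp (2 ^ n * Real.exp (-(4 * L))) := by
        gcongr
        exact_mod_cast hj
    _ ≤ _ := Real.exp_le_exp.2 h.two_pow_mul_exp_le

/-- A deviation of `√n * log n` makes the Chernoff exponent at least `L ^ 2 / 2`, which exceeds `4 *
L`. -/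
theorem choose_le_of_far (h : IsLarge n q L) {B : ℝ} {j : ℕ} (hB : q ^ 2 * L ≤ B)
    (hj : B ^ 2 ≤ (2 * j - n : ℝ) ^ 2) : (n.choose j : ℝ) ≤ 2 * scale n / n ^ 2 := by
  have hn0 := h.cast_pos
  have hL := h.log_pos
  have hq := h.root_pos
  refine (choose_le_two_pow_mul_exp h.pos j).trans (le_trans ?_ h.two_pow_mul_exp_le)
  gcongr
  rw [le_div_iff₀ (by positivity)]
  have h1 : (q ^ 2 * L) ^ 2 ≤ B ^ 2 := by gcongr
  have h2 : (q ^ 2 * L) ^ 2 = n * (L * L) := by rw [← h.pow_root]; ring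
  have h3 : 8 * L ≤ L * L := by
    have := h.le_log
    nlinarith
  nlinarith

/-- The bound for the size of the certifying families. -/
theorem certificate_size_le (h : IsLarge n q L) {r B θ : ℕ} (hB : q ^ 2 * L ≤ B)
    (hB' : (B : ℝ) ≤ 2 * (q ^ 2 * L)) (hθ : q ^ 3 ≤ θ) (h1 : (n : ℝ) - B ≤ 2 * r)
    (h2 : (2 * r : ℝ) ≤ n + B) (h3 : (n : ℝ) / 4 ≤ r - B) (h4 : (n : ℝ) / 4 ≤ n - r - B) :
    (n.choose (r - B) + n.choose (r + B) + n.choose r * B / ((r - B) * (n - r - B)) +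
      n.choose r * (r * B) / (θ * ((r - B) * (n - r - B))) : ℝ) ≤ 100 * (scale n * L / q) := by
  have hn0 := h.cast_pos
  have hL := h.log_pos
  have hL1 := h.log_ge_one
  have hq := h.root_pos
  have hq1 := h.root_ge_one
  have hU := h.scale_pos
  have hBr : B ≤ r := by
    have : (B : ℝ) ≤ r := by linarith
    exact_mod_cast this
  have hrn : (r : ℝ) ≤ n := by linarith [Nat.cast_nonneg (α := ℝ) B]
  have hB0 : (0 : ℝ) ≤ B := Nat.cast_nonneg _
  have hθ0 : (0 : ℝ) < θ := lt_of_lt_of_le (by positivity) hθ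
  have hN : (n.choose r : ℝ) ≤ n * scale n := by
    rw [← h.choose_eq]; exact_mod_cast Nat.choose_le_middle r n
  have hD : (n : ℝ) ^ 2 / 16 ≤ (r - B) * (n - r - B) := by
    have := mul_le_mul h3 h4 (by positivity) (by linarith)
    linarith [show (n : ℝ) / 4 * (n / 4) = n ^ 2 / 16 by ring]
  have hD0 : (0 : ℝ) < n ^ 2 / 16 := by positivity
  have hsmall : 2 * scale n / n ^ 2 ≤ 2 * (scale n * L / q) := by
    rw [← mul_div_assoc, div_le_div_iff₀ (by positivity) hq]
    have : q ≤ L * n ^ 2 := by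
      have h5 := h.root_le
      have h6 := h.ge_one
      nlinarith
    nlinarith
  have ha : (n.choose (r - B) : ℝ) ≤ 2 * (scale n * L / q) := by
    refine (h.choose_le_of_far hB ?_).trans hsmall
    rw [Nat.cast_sub hBr]
    refine sq_le_sq.2 ?_
    rw [abs_of_nonneg hB0]
    exact le_abs.2 (Or.inr (by linarith))
  have hb : (n.choose (r + B) : ℝ) ≤ 2 * (scale n * L / q) := by
    refine (h.choose_le_of_far hB ?_).trans hsmall
    rw [Nat.cast_add]
    refine sq_le_sq.2 ?_
    rw [abs_of_nonneg hB0]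
    exact le_abs.2 (Or.inl (by linarith))
  have hc : n.choose r * B / ((r - B) * (n - r - B)) ≤ 32 * (scale n * L / q) := by
    calc n.choose r * B / ((r - B) * (n - r - B))
        ≤ (n * scale n) * (2 * (q ^ 2 * L)) / (n ^ 2 / 16) := by gcongr
      _ = 32 * (scale n * L / q) * (q ^ 3 / n) := by field_simp; ring
      _ ≤ 32 * (scale n * L / q) * 1 := by
          gcongr
          rw [div_le_one hn0, ← h.pow_root]
          exact pow_le_pow_right₀ hq1 (by norm_num)
      _ = _ := mul_one _
  -- The dominant term, of order `scale n * B / θ`; it is the reason for taking `θ` larger than `B`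
  -- by a power of `n`.
  have hd : n.choose r * (r * B) / (θ * ((r - B) * (n - r - B))) ≤ 32 * (scale n * L / q) := by
    calc n.choose r * (r * B) / (θ * ((r - B) * (n - r - B)))
        ≤ (n * scale n) * (n * (2 * (q ^ 2 * L))) / (q ^ 3 * (n ^ 2 / 16)) := by gcongr
      _ = _ := by field_simp; ring
  have hpos : 0 ≤ scale n * L / q := by positivity
  linarith

end IsLarge

/-- The numerical core: `9 ^ (1/5) * (10/9) ^ (9/4) < 2`, with `1 / 100` to spare in the logarithm.
Taking the 20th power clears the fractions. -/
theorem log_nine_add_log_le : Real.log 9 / 5 + 9 / 4 * Real.log (10 / 9) + 1 / 100 ≤ Real.log 2 := by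
  have h1 : (9 : ℝ) ^ 4 * (10 / 9) ^ 45 * Real.exp (1 / 5) ≤ 2 ^ 20 := by
    have h2 : Real.exp (1 / 5) ≤ 5 / 4 := by
      have := Real.exp_bound_div_one_sub_of_interval (x := 1 / 5) (by norm_num) (by norm_num)
      norm_num at this ⊢
      exact this
    calc (9 : ℝ) ^ 4 * (10 / 9) ^ 45 * Real.exp (1 / 5) ≤ 9 ^ 4 * (10 / 9) ^ 45 * (5 / 4) := by gcongr
      _ ≤ _ := by norm_num
  have h2 := Real.log_le_log (by positivity) h1
  rw [Real.log_mul (by positivity) (by positivity), Real.log_mul (by positivity) (by positivity),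
    Real.log_pow, Real.log_pow, Real.log_pow, Real.log_exp] at h2
  push_cast at h2
  linarith

namespace IsLarge

variable {n : ℕ} {q L : ℝ}

theorem one_le_scale_mul_log_div (h : IsLarge n q L) : 1 ≤ scale n * L / n := by
  rw [le_div_iff₀ h.cast_pos, one_mul]
  exact h.le_scale.trans (le_mul_of_one_le_right h.scale_pos.le h.log_ge_one)

theorem scale_mul_log_sq_div_le (h : IsLarge n q L) : scale n * L ^ 2 / n ≤ scale n / L ^ 4 := by
  have hL := h.log_pos
  rw [div_le_div_iff₀ h.cast_pos (by positivity), mul_assoc, ← pow_add]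
  exact mul_le_mul_of_nonneg_left h.log_pow_le h.scale_pos.le

theorem scale_div_sq_le (h : IsLarge n q L) : scale n / n ^ 2 ≤ scale n / L ^ 4 := by
  have hL := h.log_pos
  have h1 : L ^ 4 ≤ n ^ 2 := by
    have h2 : L ^ 4 ≤ L ^ 6 := pow_le_pow_right₀ h.log_ge_one (by norm_num)
    have h3 := h.log_pow_le
    have h4 := h.ge_one
    nlinarith
  have := h.scale_pos
  gcongr

theorem scale_mul_log_sq_div_root_le (h : IsLarge n q L) :
    scale n * L ^ 2 / q ≤ scale n / L ^ 4 := by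
  have hL := h.log_pos
  rw [div_le_div_iff₀ h.root_pos (by positivity), mul_assoc, ← pow_add]
  exact mul_le_mul_of_nonneg_left h.le_root h.scale_pos.le

theorem log_le_scale_div (h : IsLarge n q L) : L ≤ scale n / L ^ 4 := by
  have hL := h.log_pos
  rw [le_div_iff₀ (by positivity)]
  calc L * L ^ 4 = L ^ 5 := by ring
    _ ≤ L ^ 6 := pow_le_pow_right₀ h.log_ge_one (by norm_num)
    _ ≤ _ := h.log_pow_le.trans h.le_scale

/-- Grafting gains `exp (-2⁻³⁶ * scale n / L ^ 2)`, while the containers cost only `exp (O(scale n /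
L ^ 4))`. The bound `2 ^ 60 ≤ L` pays for the constants. -/
theorem card_encoded_le_of_large (h : IsLarge n q L) {r B m : ℕ} (hm : n ≤ 4 * m) (hm' : m ≤ n)
    {𝓚 : Finset (Finset (Fin n))} (h𝓚 : 𝓚 ⊆ layer (Fin n) r)
    {𝒦 : Finset (Finset (Finset (Fin n)))} (h𝒦 : ∀ K ∈ 𝒦, ∃ S, Encodes r B m 𝓚 K S)
    (hlarge : scale n * n / L ^ 2 ≤ 𝓚.card) :
    (𝒦.card : ℝ) ≤ (stableSets (Fin n) r).card * Real.exp (-(scale n / L ^ 3)) := by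
  have hn0 := h.cast_pos
  have hn1 := h.ge_one
  have hL := h.log_pos
  have hL1 := h.log_ge_one
  have hU := h.scale_pos
  have hmn : (n : ℝ) ≤ 4 * m := by exact_mod_cast hm
  have hm1 : (m : ℝ) ≤ n := by exact_mod_cast hm'
  have hm0 : (0 : ℝ) < m := by linarith
  have hK0 : (0 : ℝ) < 𝓚.card := lt_of_lt_of_le (by positivity) hlarge
  have hKN : (𝓚.card : ℝ) ≤ n * scale n := by
    have h1 := card_le_card h𝓚
    rw [layer, card_powersetCard, card_univ, Fintype.card_fin] at h1
    rw [← h.choose_eq]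
    exact_mod_cast h1.trans (Nat.choose_le_middle r n)
  -- Large enough to make the container exponent at least `4 * L`, as `𝓚` has at most `n * scale n`
  -- members.
  set k := ⌈16 * (n * scale n) * L / m ^ 2⌉₊ with hk
  have hk1 : 16 * (n * scale n) * L / m ^ 2 ≤ k := Nat.le_ceil _
  have hk2 : (k : ℝ) ≤ 257 * (scale n * L / n) := by
    have h1 : (k : ℝ) ≤ 16 * (n * scale n) * L / m ^ 2 + 1 :=
      (Nat.ceil_lt_add_one (by positivity)).le
    have h2 : 16 * (n * scale n) * L / m ^ 2 ≤ 256 * (scale n * L / n) := by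
      calc 16 * (n * scale n) * L / m ^ 2 ≤ 16 * (n * scale n) * L / (n / 4) ^ 2 := by
            gcongr
            linarith
        _ = _ := by field_simp; ring
    linarith [h.one_le_scale_mul_log_div]
  have hkn : k * n ≤ 𝓚.card := by
    have h1 : (k : ℝ) * n ≤ scale n * n / L ^ 2 := by
      calc (k : ℝ) * n ≤ 257 * (scale n * L / n) * n := by gcongr
        _ = scale n * (257 * L) := by field_simp
        _ ≤ scale n * (n / L ^ 2) := by
            gcongr
            rw [le_div_iff₀ (by positivity)]
            refine le_trans ?_ h.log_pow_le
            have : (257 : ℝ) ≤ L ^ 3 := (le_trans (by norm_num) h.le_log).trans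
              (le_self_pow₀ hL1 (by norm_num))
            calc 257 * L * L ^ 2 = 257 * L ^ 3 := by ring
              _ ≤ L ^ 3 * L ^ 3 := by gcongr
              _ = L ^ 6 := by ring
        _ = _ := by ring
    exact_mod_cast h1.trans hlarge
  have hexp : 2 ^ n * Real.exp (-((m : ℝ) ^ 2 / (4 * 𝓚.card) * k)) ≤ 4 * 𝓚.card / m := by
    have h1 : 4 * L ≤ (m : ℝ) ^ 2 / (4 * 𝓚.card) * k := by
      calc 4 * L = (m : ℝ) ^ 2 / (4 * (n * scale n)) * (16 * (n * scale n) * L / m ^ 2) := by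
            field_simp; ring
        _ ≤ _ := by gcongr
    calc 2 ^ n * Real.exp (-((m : ℝ) ^ 2 / (4 * 𝓚.card) * k)) ≤ 2 ^ n * Real.exp (-(4 * L)) := by
          gcongr
      _ ≤ 2 * scale n / n ^ 2 := h.two_pow_mul_exp_le
      _ ≤ 4 * (scale n / L ^ 2) := by
          rw [← mul_div_assoc, div_le_div_iff₀ (by positivity) (by positivity)]
          have : L ^ 2 ≤ n ^ 2 := by
            have h2 := h.log_le_root.trans h.root_le
            gcongr
          nlinarith
      _ = 4 * (scale n * n / L ^ 2) / n := by field_simp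
      _ ≤ _ := by gcongr
  have hmain := MatroidAsymptotics.card_encoded_le_of_large h.pos
    (Real.one_le_exp (show 0 ≤ 4 * L by positivity)) hm h𝓚 h𝒦 hkn hexp
  refine hmain.trans ?_
  have h1 : Real.exp (4 * L) ^ k ≤ Real.exp (1028 * (scale n / L ^ 4)) := by
    rw [← Real.exp_nat_mul]
    apply Real.exp_le_exp.2
    calc (k : ℝ) * (4 * L) ≤ 257 * (scale n * L / n) * (4 * L) := by gcongr
      _ = 1028 * (scale n * L ^ 2 / n) := by ring
      _ ≤ _ := mul_le_mul_of_nonneg_left h.scale_mul_log_sq_div_le (by norm_num)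
  have h2 := h.one_add_inv_pow_le (le_refl (2 ^ n))
  have h3 : (2 ^ 34 / (1 + 2 ^ 34) : ℝ) ^ ((𝓚.card : ℝ) / (2 * n)) ≤
      Real.exp (-(2 ^ 36)⁻¹ * (scale n / L ^ 2)) := by
    have h4 : (2 ^ 34 / (1 + 2 ^ 34) : ℝ) ≤ Real.exp (-(2 ^ 35)⁻¹) := by
      have := Real.add_one_le_exp (-(2 ^ 35)⁻¹ : ℝ)
      refine le_trans ?_ this
      norm_num
    calc (2 ^ 34 / (1 + 2 ^ 34) : ℝ) ^ ((𝓚.card : ℝ) / (2 * n))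
        ≤ Real.exp (-(2 ^ 35)⁻¹) ^ ((𝓚.card : ℝ) / (2 * n)) := by gcongr
      _ = Real.exp (-((2 ^ 35)⁻¹ * ((𝓚.card : ℝ) / (2 * n)))) := by
          rw [← Real.exp_mul, neg_mul]
      _ ≤ Real.exp (-((2 ^ 35)⁻¹ * ((scale n * n / L ^ 2) / (2 * n)))) := by gcongr
      _ = _ := by congr 1; field_simp
  calc Real.exp (4 * L) ^ k * (1 + (Real.exp (4 * L))⁻¹) ^ (2 ^ n) *
        ((stableSets (Fin n) r).card * (2 ^ 34 / (1 + 2 ^ 34) : ℝ) ^ ((𝓚.card : ℝ) / (2 * n)))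
      ≤ Real.exp (1028 * (scale n / L ^ 4)) * Real.exp (2 * scale n / n ^ 2) *
        ((stableSets (Fin n) r).card * Real.exp (-(2 ^ 36)⁻¹ * (scale n / L ^ 2))) := by gcongr
    _ = (stableSets (Fin n) r).card * Real.exp (1028 * (scale n / L ^ 4) + 2 * scale n / n ^ 2 +
          -(2 ^ 36)⁻¹ * (scale n / L ^ 2)) := by
        rw [Real.exp_add, Real.exp_add]; ring
    _ ≤ _ := by
        gcongr
        have h5 := h.scale_div_sq_le
        have e1 : scale n / L ^ 3 = L * (scale n / L ^ 4) := by field_simp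
        have e2 : scale n / L ^ 2 = L ^ 2 * (scale n / L ^ 4) := by field_simp
        have e3 : 2 * scale n / n ^ 2 = 2 * (scale n / n ^ 2) := by ring
        have h6 : 0 < scale n / L ^ 4 := by positivity
        rw [e1, e2, e3]
        have h7 : 1030 + L ≤ (2 ^ 36)⁻¹ * L ^ 2 := by
          have := h.le_log
          nlinarith
        have := mul_le_mul_of_nonneg_right h7 h6.le
        linarith

/-- The main terms are the costs of recording the items, of choosing a container and of choosing a
small subset of it. `log_nine_add_log_le` leaves `scale n / 100`, which absorbs all lower-order
terms. -/
theorem small_exponent_le (h : IsLarge n q L) :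
    32 * (scale n / L) + 2 * scale n / n ^ 2 + 5380 * (scale n / L ^ 4) + 2 * scale n / n ^ 2 +
      Real.log 9 * (scale n / 5) + Real.log (10 / 9) * (9 / 4 * scale n) ≤
      Real.log 2 * scale n - scale n / L ^ 3 := by
  have hL := h.log_pos
  have hL1 := h.log_ge_one
  have hU := h.scale_pos
  have h9 := h.scale_div_sq_le
  have e1 : scale n / L ^ 3 = L * (scale n / L ^ 4) := by field_simp
  have e2 : scale n / L = L ^ 3 * (scale n / L ^ 4) := by field_simp
  have e3 : 2 * scale n / n ^ 2 = 2 * (scale n / n ^ 2) := by ring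
  have h10 : 0 < scale n / L ^ 4 := by positivity
  rw [e1, e2, e3]
  have h11 := mul_le_mul_of_nonneg_right log_nine_add_log_le hU.le
  have h12 : 32 * L ^ 3 + 5384 + L ≤ 1 / 100 * L ^ 4 := by
    have h14 : L ≤ L ^ 3 := le_self_pow₀ hL1 (by norm_num)
    calc 32 * L ^ 3 + 5384 + L ≤ 5417 * L ^ 3 := by linarith
      _ ≤ (1 / 100 * L) * L ^ 3 := by
          gcongr
          have := h.le_log
          linarith
      _ = _ := by ring
  have h13 := mul_le_mul_of_nonneg_right h12 h10.le
  have e4 : 1 / 100 * L ^ 4 * (scale n / L ^ 4) = 1 / 100 * scale n := by field_simp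
  rw [e4] at h13
  linarith

/-- There are only `O(scale n / L ^ 2)` items, each costing a factor `n ^ 4`. What remains is a
stable set of at most `scale n / 5` isolated nonbases. -/
theorem card_encoded_le_of_small (h : IsLarge n q L) {r B m : ℕ} {v : ℝ} (hm : n ≤ 4 * m)
    (hr : 12 / 25 * (n : ℝ) ≤ r) (hrn : r ≤ n) (hv : v ≤ scale n / 5)
    {𝓚 : Finset (Finset (Fin n))} {𝒦 : Finset (Finset (Finset (Fin n)))}
    (h𝒦 : ∀ K ∈ 𝒦, (∃ S, Encodes r B m 𝓚 K S) ∧ ((isolated K).card : ℝ) ≤ v)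
    (hsmall : (𝓚.card : ℝ) ≤ scale n * n / L ^ 2) :
    (𝒦.card : ℝ) ≤ Real.exp (Real.log 2 * scale n) * Real.exp (-(scale n / L ^ 3)) := by
  have hn0 := h.cast_pos
  have hn1 := h.ge_one
  have hL := h.log_pos
  have hL1 := h.log_ge_one
  have hU := h.scale_pos
  have hmn : (n : ℝ) ≤ 4 * m := by exact_mod_cast hm
  have hm0 : (0 : ℝ) < m := by linarith
  have hr0 : (0 : ℝ) < r := lt_of_lt_of_le (by positivity) hr
  have hr0' : 0 < r := by exact_mod_cast hr0
  have hy : 1 ≤ Real.exp (4 * L) := Real.one_le_exp (by positivity)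
  have hC0 : (0 : ℝ) < n.choose (r - 1) := by
    exact_mod_cast Nat.choose_pos (by omega)
  have hCN : (n.choose (r - 1) : ℝ) ≤ n * scale n := by
    rw [← h.choose_eq]; exact_mod_cast Nat.choose_le_middle _ n
  -- `84 = 4 * 21`, where `ε / (1 + ε) = 1 / 21` for `ε = 1 / 20`.
  set k := ⌈84 * (n * scale n) * L / r ^ 2⌉₊ with hk
  have hk1 : 84 * (n * scale n) * L / r ^ 2 ≤ k := Nat.le_ceil _
  have hk2 : (k : ℝ) ≤ 1345 * (scale n * L / n) := by
    have h1 : (k : ℝ) ≤ 84 * (n * scale n) * L / r ^ 2 + 1 :=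
      (Nat.ceil_lt_add_one (by positivity)).le
    have h2 : 84 * (n * scale n) * L / r ^ 2 ≤ 1344 * (scale n * L / n) := by
      calc 84 * (n * scale n) * L / r ^ 2 ≤ 84 * (n * scale n) * L / (n / 4) ^ 2 := by
            gcongr
            linarith
        _ = _ := by field_simp; ring
    linarith [h.one_le_scale_mul_log_div]
  have hexp : n.choose r * Real.exp (-(1 / 20 / (1 + 1 / 20) * (r : ℝ) ^ 2 /
      n.choose (r - 1) * k)) ≤ (1 + 1 / 20) * n.choose (r - 1) / r := by
    have h1 : 4 * L ≤ 1 / 20 / (1 + 1 / 20) * (r : ℝ) ^ 2 / n.choose (r - 1) * k := by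
      calc 4 * L = 1 / 21 * (r : ℝ) ^ 2 / (n * scale n) * (84 * (n * scale n) * L / r ^ 2) := by
            field_simp; norm_num
        _ ≤ 1 / 21 * (r : ℝ) ^ 2 / n.choose (r - 1) * k := by gcongr
        _ = _ := by norm_num
    have h2 : (n.choose r : ℝ) * r ≤ n.choose (r - 1) * n := by
      have h3 := Nat.choose_succ_right_eq n (r - 1)
      rw [Nat.sub_add_cancel hr0'] at h3
      have h4 : n.choose r * r ≤ n.choose (r - 1) * n := by
        rw [h3]; exact Nat.mul_le_mul_left _ (Nat.sub_le _ _)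
      exact_mod_cast h4
    calc n.choose r * Real.exp (-(1 / 20 / (1 + 1 / 20) * (r : ℝ) ^ 2 / n.choose (r - 1) * k))
        ≤ n.choose r * Real.exp (-L) := by
          gcongr
          linarith
      _ = n.choose r / n := by rw [Real.exp_neg, h.exp_log, div_eq_mul_inv]
      _ ≤ n.choose (r - 1) / r := by
          rw [div_le_div_iff₀ hn0 hr0]; exact h2
      _ ≤ _ := by
          gcongr
          linarith
  have h1 := MatroidAsymptotics.card_encoded_le_of_small hy (by exact_mod_cast hm0) h𝒦
  have h2 := card_small_stableSets_le (w := v) hr0' (show (0 : ℝ) < 1 / 20 by norm_num) hy hexp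
  have h3 : Real.exp (4 * L) ^ (2 * 𝓚.card / m : ℝ) ≤ Real.exp (32 * (scale n / L)) := by
    rw [← Real.exp_mul]
    apply Real.exp_le_exp.2
    calc 4 * L * (2 * 𝓚.card / m) ≤ 4 * L * (2 * (scale n * n / L ^ 2) / (n / 4)) := by
          gcongr
          linarith
      _ = _ := by field_simp; norm_num
  have h4 := h.one_add_inv_pow_le (le_refl (2 ^ n))
  have h5 := h.one_add_inv_pow_le (Nat.choose_le_two_pow n r)
  have h6 : Real.exp (4 * L) ^ k ≤ Real.exp (5380 * (scale n / L ^ 4)) := by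
    rw [← Real.exp_nat_mul]
    apply Real.exp_le_exp.2
    calc (k : ℝ) * (4 * L) ≤ 1345 * (scale n * L / n) * (4 * L) := by gcongr
      _ = 5380 * (scale n * L ^ 2 / n) := by ring
      _ ≤ _ := mul_le_mul_of_nonneg_left h.scale_mul_log_sq_div_le (by norm_num)
  have h7 : (9 : ℝ) ^ v ≤ Real.exp (Real.log 9 * (scale n / 5)) := by
    rw [Real.rpow_def_of_pos (by norm_num)]
    have := Real.log_nonneg (show (1 : ℝ) ≤ 9 by norm_num)
    gcongr
  have h8 : (10 / 9 : ℝ) ^ ((1 + 1 / 20) * n.choose (r - 1) / r + k : ℝ) ≤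
      Real.exp (Real.log (10 / 9) * (9 / 4 * scale n)) := by
    rw [Real.rpow_def_of_pos (by norm_num)]
    have := Real.log_nonneg (show (1 : ℝ) ≤ 10 / 9 by norm_num)
    gcongr
    -- `(21/20) / (12/25) = 35/16`. Of the total `9/4`, this leaves `1/16` for `k`.
    have h9 : (1 + 1 / 20) * n.choose (r - 1) / r ≤ 35 / 16 * scale n := by
      calc (1 + 1 / 20 : ℝ) * n.choose (r - 1) / r
          ≤ (1 + 1 / 20) * (n * scale n) / (12 / 25 * n) := by gcongr
        _ = _ := by field_simp; norm_num
    have h10 : (k : ℝ) ≤ 1 / 16 * scale n := by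
      refine hk2.trans ?_
      rw [← mul_div_assoc, div_le_iff₀ hn0]
      have h11 : 1345 * L ≤ 1 / 16 * n := by
        have h12 := h.le_log
        have h13 : L ^ 2 ≤ n := (pow_le_pow_right₀ hL1 (by norm_num)).trans h.log_pow_le
        nlinarith
      nlinarith
    linarith
  refine h1.trans ?_
  calc _ ≤ Real.exp (32 * (scale n / L)) * Real.exp (2 * scale n / n ^ 2) *
        (Real.exp (5380 * (scale n / L ^ 4)) * Real.exp (2 * scale n / n ^ 2) *
          (Real.exp (Real.log 9 * (scale n / 5)) *
            Real.exp (Real.log (10 / 9) * (9 / 4 * scale n)))) := by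
        gcongr
        refine h2.trans ?_
        gcongr
    _ ≤ _ := by
        simp only [← Real.exp_add]
        apply Real.exp_le_exp.2
        have := h.small_exponent_le
        linarith

/-- Few matroids of rank close to half the number of elements have few circuit-hyperplanes. -/
theorem ncard_few_le_of_near (h : IsLarge n q L) {r : ℕ} {v T : ℝ}
    (h1 : (n : ℝ) - ⌈q ^ 2 * L⌉₊ ≤ 2 * r) (h2 : (2 * r : ℝ) ≤ n + ⌈q ^ 2 * L⌉₊)
    (hv : v ≤ scale n / 5) (hT : ((stableSets (Fin n) r).card : ℝ) ≤ T)
    (hT' : Real.exp (Real.log 2 * scale n) ≤ T) :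
    ({M ∈ matroidsOn n | rank M = r ∧ ((circuitHyperplanes M).ncard : ℝ) ≤ v}.ncard : ℝ) ≤
      T * Real.exp (-(2 * L)) := by
  have hn0 := h.cast_pos
  have hL := h.log_pos
  have hL1 := h.log_ge_one
  have hq := h.root_pos
  have hq1 := h.root_ge_one
  have hU := h.scale_pos
  have hT0 : 0 < T := (Real.exp_pos _).trans_le hT'
  -- `B`, about `√n * log n`, reaches past the bulk of the binomial coefficients; `θ`, about `n ^
  -- (3/4)`, is much larger than `B` but still `o(n)`; `m`, about `n / 4`, leaves room below `r` and
  -- `n - r`.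
  set B := ⌈q ^ 2 * L⌉₊ with hBdef
  set θ := ⌈q ^ 3⌉₊ with hθdef
  set m := ⌈(n : ℝ) / 4⌉₊ with hmdef
  have hq2 : 1 ≤ q ^ 2 := one_le_pow₀ hq1
  have hB : q ^ 2 * L ≤ B := Nat.le_ceil _
  have hB' : (B : ℝ) ≤ 2 * (q ^ 2 * L) := by
    have : (B : ℝ) ≤ q ^ 2 * L + 1 := (Nat.ceil_lt_add_one (by positivity)).le
    nlinarith
  have hθ : q ^ 3 ≤ θ := Nat.le_ceil _
  have hθ' : (θ : ℝ) ≤ 2 * q ^ 3 := by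
    have : (θ : ℝ) ≤ q ^ 3 + 1 := (Nat.ceil_lt_add_one (by positivity)).le
    have := one_le_pow₀ hq1 (n := 3)
    linarith
  have hm : (n : ℝ) / 4 ≤ m := Nat.le_ceil _
  have hm' : (m : ℝ) ≤ n / 4 + 1 := (Nat.ceil_lt_add_one (by positivity)).le
  have hq3 : q ^ 3 ≤ n / 10000 := by
    rw [← h.pow_root]
    have := h.root_ge
    have h3 : (0 : ℝ) ≤ q ^ 3 := by positivity
    nlinarith
  have hBn : (B : ℝ) ≤ n / 5000 := by
    have : q ^ 2 * L ≤ q ^ 3 := by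
      rw [pow_succ q 2]
      gcongr
      exact h.log_le_root
    linarith
  have hn1 : (1 : ℝ) ≤ n / 10000 := (one_le_pow₀ hq1).trans hq3
  have hr1 : m + B + θ ≤ r := by
    have : (m + B + θ : ℝ) ≤ r := by linarith
    exact_mod_cast this
  have hr2 : m + B + θ + r ≤ n := by
    have : (m + B + θ + r : ℝ) ≤ n := by linarith
    exact_mod_cast this
  have hmn : n ≤ 4 * m := by
    have : (n : ℝ) ≤ 4 * m := by linarith
    exact_mod_cast this
  have hB2 : 2 ≤ B := by
    have : (2 : ℝ) ≤ B := by
      have := h.le_log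
      nlinarith
    exact_mod_cast this
  have hθ0 : 0 < θ := Nat.ceil_pos.2 (by positivity)
  have ht := h.certificate_size_le (θ := θ) hB hB' hθ h1 h2 (by linarith) (by linarith)
  have hmain := ncard_few_circuitHyperplanes_le (y := Real.exp (4 * L)) (v := v)
    (R := T * Real.exp (-(scale n / L ^ 3))) hB2 hθ0 hr1 hr2
    (Real.one_le_exp (by positivity)) ht fun 𝓚 𝒦 h𝓚 h𝒦 ↦ ?_
  · refine hmain.trans ?_
    have h3 : Real.exp (4 * L) ^ (100 * (scale n * L / q)) ≤
        Real.exp (400 * (scale n / L ^ 4)) := by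
      rw [← Real.exp_mul]
      apply Real.exp_le_exp.2
      calc 4 * L * (100 * (scale n * L / q)) = 400 * (scale n * L ^ 2 / q) := by ring
        _ ≤ _ := mul_le_mul_of_nonneg_left h.scale_mul_log_sq_div_root_le (by norm_num)
    calc _ ≤ Real.exp (400 * (scale n / L ^ 4)) * Real.exp (2 * scale n / n ^ 2) *
          (T * Real.exp (-(scale n / L ^ 3))) := by
          gcongr
          exact h.one_add_inv_pow_le le_rfl
      _ = T * Real.exp (400 * (scale n / L ^ 4) + 2 * scale n / n ^ 2 + -(scale n / L ^ 3)) := by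
          rw [Real.exp_add, Real.exp_add]; ring
      _ ≤ _ := by
          gcongr
          have h5 := h.scale_div_sq_le
          have h6 := h.log_le_scale_div
          have e1 : scale n / L ^ 3 = L * (scale n / L ^ 4) := by field_simp
          have e3 : 2 * scale n / n ^ 2 = 2 * (scale n / n ^ 2) := by ring
          rw [e1, e3]
          have h7 := h.le_log
          have h8 := mul_le_mul_of_nonneg_right
            (show (404 : ℝ) ≤ L from le_trans (by norm_num) h7) (hL.le.trans h6)
          linarith
  -- Few certified sets are compared with `2 ^ scale n`, many with the number of stable sets; `T`
  -- bounds both.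
  · rcases le_total (𝓚.card : ℝ) (scale n * n / L ^ 2) with hs | hs
    · refine (h.card_encoded_le_of_small hmn (by linarith) (by omega) hv h𝒦 hs).trans ?_
      gcongr
    · refine (h.card_encoded_le_of_large hmn (by omega) h𝓚 (fun K hK ↦ (h𝒦 K hK).1) hs).trans ?_
      gcongr

theorem exp_scale_le_ncard (h : IsLarge n q L) :
    Real.exp (Real.log 2 * scale n) ≤ (matroidsOn n).ncard := by
  obtain ⟨k, hk, hk'⟩ := exists_two_pow_le_card_stableSets h.pos (n / 2)
  have hn : 2 ≤ n := by
    have : (2 : ℝ) ≤ n := le_trans (by norm_num) (h.root_ge.trans h.root_le)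
    exact_mod_cast this
  have h1 := hk'.trans (card_stableSets_le_ncard (show 0 < n / 2 by omega) (by omega))
  have h2 : scale n ≤ k := by
    rw [scale, div_le_iff₀ h.cast_pos, mul_comm]
    exact_mod_cast hk
  calc Real.exp (Real.log 2 * scale n) ≤ Real.exp (Real.log 2 * k) := by
        have := Real.log_nonneg (show (1 : ℝ) ≤ 2 by norm_num)
        gcongr
    _ = 2 ^ k := by
        rw [mul_comm, Real.exp_nat_mul, Real.exp_log two_pos]
    _ ≤ _ := by exact_mod_cast h1

/-- Far from the middle the trivial bound suffices: the number of `r`-sets is itself a vanishing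
fraction of `scale n`. -/
theorem ncard_rank_le_of_far (h : IsLarge n q L) {r : ℕ}
    (hr : (⌈q ^ 2 * L⌉₊ : ℝ) ^ 2 ≤ (2 * r - n : ℝ) ^ 2) :
    ({M ∈ matroidsOn n | rank M = r}.ncard : ℝ) ≤
      (matroidsOn n).ncard * Real.exp (-(2 * L)) := by
  have hU := h.scale_pos
  have h1 := h.choose_le_of_far (Nat.le_ceil _) hr
  have h2 : ({M ∈ matroidsOn n | rank M = r}.ncard : ℝ) ≤ 2 ^ n.choose r := by
    exact_mod_cast ncard_rank_le n r
  have h3 := Real.log_two_gt_d9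
  refine h2.trans ?_
  calc (2 : ℝ) ^ n.choose r = Real.exp (Real.log 2 * n.choose r) := by
        rw [mul_comm, Real.exp_nat_mul, Real.exp_log two_pos]
    _ ≤ Real.exp (Real.log 2 * scale n + -(2 * L)) := by
        apply Real.exp_le_exp.2
        have h4 := h.scale_div_sq_le
        have h5 := h.log_le_scale_div
        have h6 : 16 * (scale n / L ^ 4) ≤ scale n := by
          have hL := h.log_pos
          rw [← mul_div_assoc, div_le_iff₀ (by positivity), mul_comm]
          gcongr
          exact (le_trans (by norm_num) h.le_log).trans (le_self_pow₀ h.log_ge_one (by norm_num))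
        have h7 : (n.choose r : ℝ) ≤ 2 * (scale n / n ^ 2) := by
          rw [← mul_div_assoc]; exact h1
        nlinarith
    _ = Real.exp (Real.log 2 * scale n) * Real.exp (-(2 * L)) := Real.exp_add _ _
    _ ≤ _ := by
        gcongr
        exact h.exp_scale_le_ncard

/-- Few matroids of any given rank have few circuit-hyperplanes. -/
theorem ncard_few_rank_le (h : IsLarge n q L) {r : ℕ} :
    ({M ∈ matroidsOn n | rank M = r ∧ w M < 1 / (5 * n)}.ncard : ℝ) ≤
      (matroidsOn n).ncard * Real.exp (-(2 * L)) := by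
  rcases le_or_gt ((⌈q ^ 2 * L⌉₊ : ℝ) ^ 2) ((2 * r - n : ℝ) ^ 2) with hr | hr
  · refine le_trans ?_ (h.ncard_rank_le_of_far hr)
    refine Nat.cast_le.2 (Set.ncard_le_ncard ?_
      ((finite_matroidsOn n).subset (Set.sep_subset _ _)))
    rintro M ⟨hM, hMr, -⟩
    exact ⟨hM, hMr⟩
  · have habs := abs_lt_of_sq_lt_sq' hr (Nat.cast_nonneg _)
    have hn0 := h.cast_pos
    have hU := h.scale_pos
    have hBn : (⌈q ^ 2 * L⌉₊ : ℝ) < n := by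
      have hL := h.log_pos
      have hq := h.root_pos
      have h1 : (⌈q ^ 2 * L⌉₊ : ℝ) < q ^ 2 * L + 1 := Nat.ceil_lt_add_one (by positivity)
      have h2 := h.root_ge
      have h3 : q ^ 2 * L ≤ q ^ 2 * q := by
        gcongr
        exact h.log_le_root
      have h4 : 1 ≤ q ^ 2 * q := by
        rw [← pow_succ]; exact one_le_pow₀ h.root_ge_one
      rw [← h.pow_root]
      nlinarith
    have hr0 : 0 < r := by
      have : (0 : ℝ) < r := by linarith
      exact_mod_cast this
    have hrn : r < n := by
      have : (r : ℝ) < n := by linarith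
      exact_mod_cast this
    refine le_trans ?_ (h.ncard_few_le_of_near (r := r) (v := n.choose r / (5 * n)) (by linarith)
      (by linarith) ?_ (by exact_mod_cast card_stableSets_le_ncard hr0 hrn) h.exp_scale_le_ncard)
    · refine Nat.cast_le.2 (Set.ncard_le_ncard ?_
        ((finite_matroidsOn n).subset (Set.sep_subset _ _)))
      rintro M ⟨hM, hMr, hw⟩
      refine ⟨hM, hMr, ?_⟩
      have hE : M.E.ncard = n := by
        rw [show M.E = Set.univ from hM, Set.ncard_univ, Nat.card_eq_fintype_card, Fintype.card_fin]
      have hC : (0 : ℝ) < n.choose r := by exact_mod_cast Nat.choose_pos hrn.le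
      rw [w, hE, hMr, div_lt_iff₀ hC, one_div, inv_mul_eq_div] at hw
      exact hw.le
    · rw [scale, div_div, mul_comm (n : ℝ) 5]
      gcongr
      exact Nat.choose_le_middle r n

end IsLarge

/-! ### Summing over the ranks and passing to the limit -/

theorem one_sub_le_proportion {n : ℕ} {q L : ℝ} (h : IsLarge n q L) :
    1 - 2 / (n : ℝ) ≤ ({M ∈ matroidsOn n | (1 : ℝ) / (5 * (n : ℝ)) ≤ w M}.ncard : ℝ) /
      (matroidsOn n).ncard := by
  have hn0 := h.cast_pos
  have hT : (0 : ℝ) < (matroidsOn n).ncard := (Real.exp_pos _).trans_le h.exp_scale_le_ncard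
  have hfin := finite_matroidsOn n
  have h1 : (matroidsOn n).ncard ≤ {M ∈ matroidsOn n | (1 : ℝ) / (5 * (n : ℝ)) ≤ w M}.ncard +
      ∑ r ∈ range (n + 1), {M ∈ matroidsOn n | rank M = r ∧ w M < 1 / (5 * n)}.ncard := by
    have h2 : matroidsOn n ⊆ {M ∈ matroidsOn n | (1 : ℝ) / (5 * (n : ℝ)) ≤ w M} ∪
        ⋃ r ∈ range (n + 1), {M ∈ matroidsOn n | rank M = r ∧ w M < 1 / (5 * n)} := by
      intro M hM
      rcases le_or_gt ((1 : ℝ) / (5 * (n : ℝ))) (w M) with hw | hw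
      · exact Or.inl ⟨hM, hw⟩
      · refine Or.inr (Set.mem_biUnion (x := rank M) ?_ ⟨hM, rfl, hw⟩)
        obtain ⟨B, hB⟩ := M.exists_isBase
        have h3 := hB.encard_eq_eRank
        have h4 : B.encard ≤ n := by
          have := Set.encard_le_encard (Set.subset_univ B)
          rwa [Set.encard_univ, ENat.card_eq_coe_fintype_card, Fintype.card_fin] at this
        rw [h3, ← coe_rank] at h4
        exact mem_coe.2 (mem_range.2 (Nat.lt_succ_of_le (by exact_mod_cast h4)))
    refine (Set.ncard_le_ncard h2 ?_).trans ((Set.ncard_union_le _ _).trans ?_)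
    · refine hfin.subset (Set.union_subset (Set.sep_subset _ _) ?_)
      exact Set.iUnion₂_subset fun r _ ↦ Set.sep_subset _ _
    · gcongr
      exact Finset.set_ncard_biUnion_le _ _
  have h2 : ∑ r ∈ range (n + 1),
      ({M ∈ matroidsOn n | rank M = r ∧ w M < 1 / (5 * n)}.ncard : ℝ) ≤
      (n + 1) * ((matroidsOn n).ncard * Real.exp (-(2 * L))) := by
    refine (sum_le_card_nsmul _ _ _ fun r _ ↦ h.ncard_few_rank_le).trans ?_
    rw [card_range, nsmul_eq_mul]
    push_cast
    exact le_rfl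
  -- The factor `n⁻²` per rank survives the sum over `n + 1 ≤ 2 * n` ranks and leaves `2 / n`.
  have h3 : Real.exp (-(2 * L)) = 1 / (n : ℝ) ^ 2 := by
    rw [Real.exp_neg, show 2 * L = (2 : ℕ) * L by norm_num, Real.exp_nat_mul, h.exp_log, one_div]
  have h4 : ((matroidsOn n).ncard : ℝ) ≤
      {M ∈ matroidsOn n | (1 : ℝ) / (5 * (n : ℝ)) ≤ w M}.ncard +
      ∑ r ∈ range (n + 1), ({M ∈ matroidsOn n | rank M = r ∧ w M < 1 / (5 * n)}.ncard : ℝ) := by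
    exact_mod_cast h1
  have h5 : ((n : ℝ) + 1) * ((matroidsOn n).ncard * Real.exp (-(2 * L))) ≤
      2 / n * (matroidsOn n).ncard := by
    calc ((n : ℝ) + 1) * ((matroidsOn n).ncard * Real.exp (-(2 * L)))
        ≤ (2 * n) * ((matroidsOn n).ncard * Real.exp (-(2 * L))) := by
          gcongr
          linarith [h.ge_one]
      _ = _ := by rw [h3]; field_simp
  rw [le_div_iff₀ hT]
  linarith

theorem proportion_le_one (n : ℕ) (P : Matroid (Fin n) → Prop) :
    ({M ∈ matroidsOn n | P M}.ncard : ℝ) / (matroidsOn n).ncard ≤ 1 :=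
  div_le_one_of_le₀ (Nat.cast_le.2 (Set.ncard_le_ncard (Set.sep_subset _ _) (finite_matroidsOn n)))
    (Nat.cast_nonneg _)

theorem almostAll_le_w : AlmostAll fun n M ↦ (1 : ℝ) / (5 * (n : ℝ)) ≤ w M := by
  have h : Tendsto (fun n : ℕ ↦ 1 - 2 / (n : ℝ)) atTop (𝓝 1) := by
    simpa using tendsto_const_nhds.sub (tendsto_const_div_atTop_nhds_zero_nat (2 : ℝ))
  refine tendsto_of_tendsto_of_tendsto_of_le_of_le' h tendsto_const_nhds ?_
    (Eventually.of_forall fun n ↦ proportion_le_one n _)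
  filter_upwards [eventually_isLarge] with n ⟨q, L, hn⟩
  exact one_sub_le_proportion hn

theorem AlmostAll.mono {P Q : (n : ℕ) → Matroid (Fin n) → Prop} (hP : AlmostAll P)
    (h : ∀ n M, P n M → Q n M) : AlmostAll Q := by
  refine tendsto_of_tendsto_of_tendsto_of_le_of_le hP tendsto_const_nhds (fun n ↦ ?_)
    fun n ↦ proportion_le_one n _
  dsimp only
  gcongr
  · exact (finite_matroidsOn n).subset (Set.sep_subset _ _)
  · exact h n _

end MatroidAsymptotics

theorem theorem5p3 :
    MatroidAsymptotics.AlmostAll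
        (fun n M ↦ (1 : ℝ) / (5 * (n : ℝ)) ≤ MatroidAsymptotics.w M) ∧
      ∃ c : ℝ, 0 < c ∧
        MatroidAsymptotics.AlmostAll (fun n M ↦ c / (n : ℝ) ≤ MatroidAsymptotics.d M) := by
  refine ⟨MatroidAsymptotics.almostAll_le_w, 1 / 5, by norm_num,
    MatroidAsymptotics.almostAll_le_w.mono fun n M h ↦ ?_⟩
  rw [div_div]
  exact h.trans (MatroidAsymptotics.w_le_d M)
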